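/- Let $k$ be an algebraically closed field. **Quantum groupoids.** A (finite) quantum groupoid over $k$ is a finite-dimensional unital associative $k$-algebra $H$ which is also a coalgebra $(H,\Delta,\varepsilon)$, $\Delta(h)=h_{(1)}\otimes h_{(2)}$, such that - $\Delta(gh)=\Delta(g)\Delta(h)$ and $(\Delta\otimes\mathrm{id})\Delta(1)=(\Delta(1)\otimes1)(1\otimes\Delta(1))=(1\otimes\Delta(1))(\Delta(1)\otimes1)$; - $\varepsilon(fgh)=\varepsilon(fg_{(1)})\,\varepsilon(g_{(2)}h)=\varepsilon(fg_{(2)})\,\varepsilon(g_{(1)}h)$ for all $f,g,h\in H$; - there is a linear map $S:H\to H$ (the antipode), which is a unital algebra anti-homomorphism and a counital coalgebra anti-homomorphism, with $$h_{(1)}S(h_{(2)})=(\varepsilon\otimes\mathrm{id})(\Delta(1)(h\otimes1))=:\varepsilon_t(h),\qquad S(h_{(1)})h_{(2)}=(\mathrm{id}\otimes\varepsilon)((1\otimes h)\Delta(1))=:\varepsilon_s(h).$$ Put $H_t=\varepsilon_t(H)$, $H_s=\varepsilon_s(H)$. Call $H$ *connected* if $H\neq0$ and $H_s\cap Z(H)=k\cdot1$,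 where $Z(H)$ is the center. A *Haar integral* is an element $h\in H$ with $xh=\varepsilon_t(x)h$, $hx=h\varepsilon_s(x)$ for all $x\in H$, and $\varepsilon_t(h)=\varepsilon_s(h)=1$. $H$ is *quasitriangular* if it is equipped with $\mathcal R\in\Delta^{op}(1)(H\otimes H)\Delta(1)$ such that $\Delta^{op}(h)\mathcal R=\mathcal R\Delta(h)$ for all $h\in H$, $(\mathrm{id}\otimes\Delta)\mathcal R=\mathcal R_{13}\mathcal R_{12}$, $(\Delta\otimes\mathrm{id})\mathcal R=\mathcal R_{13}\mathcal R_{23}$, and for which there is $\bar{\mathcal R}\in\Delta(1)(H\otimes H)\Delta^{op}(1)$ with $\mathcal R\bar{\mathcal R}=\Delta^{op}(1)$, $\bar{\mathcal R}\mathcal R=\Delta(1)$. It is *ribbon* if moreover it is equipped with an invertible central $\nu\in H$ such that $\Delta(\nu)=\mathcal R_{21}\mathcal R(\nu\otimes\nu)$ and $S(\nu)=\nu$. It is *factorizable* if the map $F(\phi)=(\phi\otimes\mathrm{id})(\mathcal R_{21}\mathcal R)$ takes the dual space $H^*$ onto the centralizer $C_H(H_s)$ of $H_s$ in $H$. **The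 category $\mathrm{Rep}(H)$.** For a ribbon quantum groupoid $H$, let $\mathrm{Rep}(H)$ be the $k$-linear category of finite-dimensional left $H$-modules, with - tensor product $V\otimes W=\{x\in V\otimes_kW: x=\Delta(1)\cdot x\}$, on which $H$ acts through $\Delta$, tensor products of morphisms being the restrictions of those over $k$, and the associativity isomorphisms inherited from $\otimes_k$; - unit object $H_t$ with $h\cdot z=\varepsilon_t(hz)$, with $l_V(1_{(1)}\cdot z\otimes1_{(2)}\cdot v)=z\cdot v$ and with $r_V$ the inverse of $v\mapsto1_{(1)}\cdot v\otimes1_{(2)}\cdot1$; - duals $V^*=\mathrm{Hom}_k(V,k)$ with $(h\cdot\phi)(v)=\phi(S(h)\cdot v)$, $d_V(\sum_j\phi_j\otimes v_j)=\sum_j\phi_j(1_{(1)}\cdot v_j)1_{(2)}$ on $V^*\otimes V$ and $b_V(z)=z\cdot\sum_if_i\otimes\xi^i$, for dual bases $\{f_i\}$, $\{\xi^i\}$ of $V$, $V^*$; - braiding $c_{V,W}(x)=\mathcal R^{(2)}\cdot x^{(2)}\otimes\mathcal R^{(1)}\cdot x^{(1)}$ and twist $\theta_V(v)=\nu\cdot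 v$. With this structure $\mathrm{Rep}(H)$ is a ribbon category. **Modular categories.** In a ribbon $k$-linear category with unit object $\mathbf 1$, an object $V$ is *simple* if $k\to\mathrm{End}(V)$, $c\mapsto c\,\mathrm{id}_V$, is bijective, and the quantum trace of $f:V\to V$ is $\mathrm{tr}_q(f)=d_V\circ c_{V,V^*}\circ(\theta_Vf\otimes\mathrm{id}_{V^*})\circ b_V\in\mathrm{End}(\mathbf 1)$. The category is *modular* if there is a finite family $\{V_i\}_{i\in I}$ of simple objects such that 1. $\mathbf 1=V_0$ for some index $0\in I$; 2. for every $i\in I$ there is $j\in I$ with $V_j\cong V_i^*$; 3. the family dominates every object $V$, i.e. $\mathrm{id}_V=\sum_rf_rg_r$ is a finite sum with $g_r:V\to V_{i(r)}$ and $f_r:V_{i(r)}\to V$; 4. the square matrix $(S_{ij})_{i,j\in I}$, $S_{ij}=\mathrm{tr}_q(c_{V_i,V_j}\circ c_{V_j,V_i})\in\mathrm{End}(\mathbf 1)=k$, is invertible over $k$. **Lemma.** Let $H$ be a connected, ribbon, factorizable quantum groupoid over an algebraically closed field $k$, and suppose that $H$ has a Haar integral. Then $\mathrm{Rep}(H)$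 is a modular category. -/

import Mathlib

open scoped TensorProduct
open CategoryTheory

universe u

set_option linter.unusedSectionVars false

noncomputable section

namespace QG

/-- A finite quantum groupoid (finite-dimensional weak Hopf algebra) over `k`. -/
class QuantumGroupoid (k H : Type u) [Field k] [Ring H] [Algebra k H]
    extends Coalgebra k H where
  finiteDimensional : FiniteDimensional k H
  /-- `Δ` is multiplicative (but need not preserve the unit). -/
  comul_mul : ∀ x y : H, comul (x * y) = comul x * comul y
  /-- `(Δ ⊗ id) Δ(1) = (Δ(1) ⊗ 1) (1 ⊗ Δ(1))`. -/
  comul_one_left :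
    Algebra.TensorProduct.assoc k k k H H H (comul.rTensor H (comul 1)) =
      Algebra.TensorProduct.assoc k k k H H H (comul 1 ⊗ₜ[k] (1 : H)) *
        ((1 : H) ⊗ₜ[k] comul (1 : H))
  /-- `(Δ ⊗ id) Δ(1) = (1 ⊗ Δ(1)) (Δ(1) ⊗ 1)`. -/
  comul_one_right :
    Algebra.TensorProduct.assoc k k k H H H (comul.rTensor H (comul 1)) =
      ((1 : H) ⊗ₜ[k] comul (1 : H)) *
        Algebra.TensorProduct.assoc k k k H H H (comul 1 ⊗ₜ[k] (1 : H))
  /-- `ε(fgh) = ε(f g₍₁₎) ε(g₍₂₎ h)`. -/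
  counit_mul_left : ∀ f g h : H, counit (f * g * h) =
    LinearMap.mul' k k (TensorProduct.map (counit ∘ₗ LinearMap.mulLeft k f)
      (counit ∘ₗ LinearMap.mulRight k h) (comul g))
  /-- `ε(fgh) = ε(f g₍₂₎) ε(g₍₁₎ h)`. -/
  counit_mul_right : ∀ f g h : H, counit (f * g * h) =
    LinearMap.mul' k k (TensorProduct.map (counit ∘ₗ LinearMap.mulRight k h)
      (counit ∘ₗ LinearMap.mulLeft k f) (comul g))
  /-- The antipode. -/
  antipode : H →ₗ[k] H
  antipode_one : antipode 1 = 1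
  antipode_mul : ∀ x y : H, antipode (x * y) = antipode y * antipode x
  counit_antipode : ∀ x : H, counit (antipode x) = counit x
  comul_antipode : ∀ x : H, comul (antipode x) =
    TensorProduct.comm k H H (TensorProduct.map antipode antipode (comul x))
  /-- `h₍₁₎ S(h₍₂₎) = (ε ⊗ id)(Δ(1)(h ⊗ 1))`. -/
  mul_antipode : ∀ h : H, LinearMap.mul' k H (antipode.lTensor H (comul h)) =
    TensorProduct.lid k H (counit.rTensor H (comul 1 * (h ⊗ₜ[k] 1)))
  /-- `S(h₍₁₎) h₍₂₎ = (id ⊗ ε)((1 ⊗ h)Δ(1))`. -/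
  antipode_mul_self : ∀ h : H, LinearMap.mul' k H (antipode.rTensor H (comul h)) =
    TensorProduct.rid k H (counit.lTensor H ((1 ⊗ₜ[k] h) * comul 1))

open Coalgebra QuantumGroupoid

section Algebra

variable (k : Type u) {H : Type u} [Field k] [Ring H] [Algebra k H] [QuantumGroupoid k H]

/-- `Δ` with the ground field explicit. -/
abbrev Δ : H →ₗ[k] H ⊗[k] H := comul

/-- The antipode with the ground field explicit. -/
abbrev S : H →ₗ[k] H := antipode

/-- The target counital map `ε_t(h) = h₍₁₎ S(h₍₂₎)`. -/
def epsT : H →ₗ[k] H := LinearMap.mul' k H ∘ₗ (S k).lTensor H ∘ₗ Δ k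

/-- The source counital map `ε_s(h) = S(h₍₁₎) h₍₂₎`. -/
def epsS : H →ₗ[k] H := LinearMap.mul' k H ∘ₗ (S k).rTensor H ∘ₗ Δ k

variable (H) in
/-- The target counital subalgebra `H_t = ε_t(H)` (as a subspace). -/
def Ht : Submodule k H := LinearMap.range (epsT k)

variable (H) in
/-- The source counital subalgebra `H_s = ε_s(H)` (as a subspace). -/
def Hs : Submodule k H := LinearMap.range (epsS k)

/-- `x ⊗ y ↦ x ⊗ y ⊗ 1`. -/
def j12 : H ⊗[k] H →ₐ[k] H ⊗[k] (H ⊗[k] H) :=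
  (Algebra.TensorProduct.assoc k k k H H H).toAlgHom.comp Algebra.TensorProduct.includeLeft

/-- `x ⊗ y ↦ 1 ⊗ x ⊗ y`. -/
def j23 : H ⊗[k] H →ₐ[k] H ⊗[k] (H ⊗[k] H) := Algebra.TensorProduct.includeRight

/-- `x ⊗ y ↦ x ⊗ 1 ⊗ y`. -/
def j13 : H ⊗[k] H →ₐ[k] H ⊗[k] (H ⊗[k] H) :=
  Algebra.TensorProduct.map (AlgHom.id k H) Algebra.TensorProduct.includeRight

/-- `id ⊗ Δ`. -/
def idΔ : H ⊗[k] H →ₗ[k] H ⊗[k] (H ⊗[k] H) := (Δ k).lTensor H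

/-- `Δ ⊗ id`, with values in `H ⊗ (H ⊗ H)`. -/
def Δid : H ⊗[k] H →ₗ[k] H ⊗[k] (H ⊗[k] H) :=
  (TensorProduct.assoc k H H H).toLinearMap ∘ₗ (Δ k).rTensor H

@[simp] lemma j12_tmul (x y : H) : j12 k (x ⊗ₜ[k] y) = x ⊗ₜ (y ⊗ₜ 1) := rfl
@[simp] lemma j23_tmul (x y : H) : j23 k (x ⊗ₜ[k] y) = 1 ⊗ₜ (x ⊗ₜ y) := rfl
@[simp] lemma j13_tmul (x y : H) : j13 k (x ⊗ₜ[k] y) = x ⊗ₜ (1 ⊗ₜ y) := rfl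
@[simp] lemma idΔ_tmul (x y : H) : idΔ k (x ⊗ₜ[k] y) = x ⊗ₜ Δ k y := rfl
lemma Δid_tmul (x y : H) : Δid k (x ⊗ₜ[k] y) = TensorProduct.assoc k H H H (Δ k x ⊗ₜ y) := rfl
lemma Δid_tmul_one (x : H) : Δid k (x ⊗ₜ[k] (1 : H)) = j12 k (Δ k x) := rfl

lemma idΔ_mul (s t : H ⊗[k] H) : idΔ k (s * t) = idΔ k s * idΔ k t := by
  induction s with
  | zero => simp
  | add a b ha hb => simp only [add_mul, map_add, ha, hb]
  | tmul a b =>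
    induction t with
    | zero => simp
    | add a b ha hb => simp only [mul_add, map_add, ha, hb]
    | tmul c d => simp [Δ, comul_mul]

lemma Δid_mul (s t : H ⊗[k] H) : Δid k (s * t) = Δid k s * Δid k t := by
  induction s with
  | zero => simp
  | add a b ha hb => simp only [add_mul, map_add, ha, hb]
  | tmul a b =>
    induction t with
    | zero => simp
    | add a b ha hb => simp only [mul_add, map_add, ha, hb]
    | tmul c d =>
      simp only [Algebra.TensorProduct.tmul_mul_tmul, Δid_tmul, Δ, comul_mul]
      rw [← Algebra.TensorProduct.tmul_mul_tmul]
      exact map_mul (Algebra.TensorProduct.assoc k k k H H H) _ _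

lemma Δid_comul (x : H) : Δid k (Δ k x) = idΔ k (Δ k x) := Coalgebra.coassoc_apply x

lemma j12_mul_j23 : j12 k (Δ k (1 : H)) * j23 k (Δ k 1) = idΔ k (Δ k 1) := by
  rw [← Δid_comul]; exact (comul_one_left).symm

lemma j23_mul_j12 : j23 k (Δ k (1 : H)) * j12 k (Δ k 1) = idΔ k (Δ k 1) := by
  rw [← Δid_comul]; exact (comul_one_right).symm

lemma one_comul (x : H) : Δ k 1 * Δ k x = Δ k x := by
  rw [← QuantumGroupoid.comul_mul, one_mul]
lemma comul_one' (x : H) : Δ k x * Δ k 1 = Δ k x := by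
  rw [← QuantumGroupoid.comul_mul, mul_one]

lemma B1 (h : H) : j12 k (Δ k 1) * j23 k (Δ k h) = idΔ k (Δ k 1 * (1 ⊗ₜ h)) := by
  rw [← one_comul k h, map_mul, ← mul_assoc, j12_mul_j23, idΔ_mul]; rfl

lemma B2 (h : H) : j12 k (Δ k h) * j23 k (Δ k 1) = Δid k ((h ⊗ₜ 1) * Δ k 1) := by
  rw [← comul_one' k h, map_mul, mul_assoc, j12_mul_j23, Δid_mul, Δid_comul]; rfl

lemma B3 (h : H) : j23 k (Δ k 1) * j12 k (Δ k h) = Δid k (Δ k 1 * (h ⊗ₜ 1)) := by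
  rw [← one_comul k h, map_mul, ← mul_assoc, j23_mul_j12, Δid_mul, Δid_comul]; rfl

lemma epsT_apply (h : H) :
    epsT k h = TensorProduct.lid k H ((counit (R := k)).rTensor H (Δ k 1 * (h ⊗ₜ[k] 1))) :=
  mul_antipode h

lemma epsS_apply (h : H) :
    epsS k h = TensorProduct.rid k H ((counit (R := k)).lTensor H ((1 ⊗ₜ[k] h) * Δ k 1)) :=
  antipode_mul_self h

/-- a functional version of the formula for `ε_t` -/
lemma epsT_apply' {M : Type*} [AddCommGroup M] [Module k M] (f : H →ₗ[k] M) (h : H) :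
    f (epsT k h) = TensorProduct.lid k M (TensorProduct.map
      ((counit (R := k)) ∘ₗ LinearMap.mulRight k h) f (Δ k 1)) := by
  rw [epsT_apply]
  generalize Δ k (1 : H) = s
  induction s with
  | zero => simp
  | add a b ha hb => simp only [add_mul, map_add, ha, hb]
  | tmul a b => simp

lemma counit_mul_epsT (x y : H) : counit (R := k) (x * epsT k y) = counit (R := k) (x * y) := by
  have := epsT_apply' k ((counit (R := k)) ∘ₗ LinearMap.mulLeft k x) y
  simp only [LinearMap.comp_apply, LinearMap.mulLeft_apply] at this
  rw [this]
  have h2 := counit_mul_right (k := k) x 1 y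
  rw [mul_one] at h2
  rw [h2]
  generalize (comul (1 : H) : H ⊗[k] H) = s
  induction s with
  | zero => simp
  | add a b ha hb => simp only [map_add, ha, hb]
  | tmul a b => simp

@[simp] lemma epsT_mul_epsT (x y : H) : epsT k (x * epsT k y) = epsT k (x * y) := by
  have h1 := epsT_apply' k (LinearMap.id) (x * epsT k y)
  have h2 := epsT_apply' k (LinearMap.id) (x * y)
  simp only [LinearMap.id_apply] at h1 h2
  rw [h1, h2]
  congr 3
  ext a
  simp [counit_mul_epsT]

lemma counit_epsT (x : H) : counit (R := k) (epsT k x) = counit (R := k) x := by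
  simpa using counit_mul_epsT k 1 x

@[simp] lemma epsT_epsT (x : H) : epsT k (epsT k x) = epsT k x := by
  simpa using epsT_mul_epsT k 1 x

lemma epsT_one : epsT k (1 : H) = 1 := by
  rw [epsT_apply, ← Algebra.TensorProduct.one_def, mul_one]
  simp [Δ, Coalgebra.rTensor_counit_comul]

lemma epsS_one : epsS k (1 : H) = 1 := by
  rw [epsS_apply, ← Algebra.TensorProduct.one_def, one_mul]
  simp [Δ, Coalgebra.lTensor_counit_comul]

lemma epsT_mem (x : H) : epsT k x ∈ Ht k H := ⟨x, rfl⟩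

lemma epsT_of_mem {z : H} (hz : z ∈ Ht k H) : epsT k z = z := by
  obtain ⟨x, rfl⟩ := hz; simp

lemma comul_of_mem {z : H} (hz : z ∈ Ht k H) : Δ k z = Δ k 1 * (z ⊗ₜ 1) := by
  obtain ⟨h, rfl⟩ := hz
  rw [epsT_apply' k (Δ k) h]
  have key : ∀ s t : H ⊗[k] H, TensorProduct.lid k _ (TensorProduct.map
      ((counit (R := k)) ∘ₗ LinearMap.mulRight k h) LinearMap.id (j23 k s * j12 k t)) =
      s * ((TensorProduct.lid k _ (TensorProduct.map
      ((counit (R := k)) ∘ₗ LinearMap.mulRight k h) LinearMap.id t)) ⊗ₜ 1) := by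
    intro s t
    induction s with
    | zero => simp
    | add a b ha hb => simp only [add_mul, map_add, ha, hb]
    | tmul a b =>
      induction t with
      | zero => simp
      | add a b ha hb => simp only [mul_add, map_add, ha, hb, TensorProduct.add_tmul]
      | tmul c d => simp [TensorProduct.smul_tmul']
  have h1 := epsT_apply' k LinearMap.id h
  rw [LinearMap.id_apply] at h1
  rw [h1, ← key, j23_mul_j12]
  generalize Δ k (1 : H) = s
  induction s with
  | zero => simp
  | add a b ha hb => simp only [map_add, ha, hb]
  | tmul a b => simp

/-- `ε_t(h₍₁₎ z) h₍₂₎ = ε(h₍₁₎ z) h₍₂₎` -/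
lemma epsT_mul_contract (z h : H) :
    LinearMap.mul' k H (TensorProduct.map (epsT k ∘ₗ LinearMap.mulRight k z) LinearMap.id (Δ k h))
    = TensorProduct.lid k H (TensorProduct.map
      ((counit (R := k)) ∘ₗ LinearMap.mulRight k z) LinearMap.id (Δ k h)) := by
  conv_rhs => rw [← one_comul k h]
  generalize Δ k h = t
  induction t with
  | zero => simp
  | add a b ha hb => simp only [mul_add, map_add, ha, hb]
  | tmul a b =>
    simp only [TensorProduct.map_tmul, LinearMap.comp_apply, LinearMap.mulRight_apply,
      LinearMap.mul'_apply, LinearMap.id_apply, epsT_apply]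
    generalize Δ k (1 : H) = s
    induction s with
    | zero => simp
    | add a b ha hb => simp only [add_mul, map_add, ha, hb]
    | tmul c d => simp [mul_assoc]

lemma counit_contract_of_mem {z : H} (hz : z ∈ Ht k H) (h : H) :
    TensorProduct.lid k H (TensorProduct.map
      ((counit (R := k)) ∘ₗ LinearMap.mulRight k z) LinearMap.id (Δ k h)) = h * z := by
  have h1 : Δ k (h * z) = Δ k h * (z ⊗ₜ 1) := by
    rw [Δ, QuantumGroupoid.comul_mul]
    change Δ k h * Δ k z = _
    rw [comul_of_mem k hz, ← mul_assoc, comul_one']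
  have h2 := congrArg (fun t => TensorProduct.lid k H ((counit (R := k)).rTensor H t)) h1
  simp only [Δ, Coalgebra.rTensor_counit_comul, TensorProduct.lid_tmul, one_smul] at h2
  rw [h2]
  generalize (comul h : H ⊗[k] H) = s
  induction s with
  | zero => simp
  | add a b ha hb => simp only [add_mul, map_add, ha, hb]
  | tmul c d => simp

/-- contraction of the middle factor with the counit -/
def c2 : H ⊗[k] (H ⊗[k] H) →ₗ[k] H ⊗[k] H :=
  LinearMap.lTensor H ((TensorProduct.lid k H).toLinearMap ∘ₗ (counit (R := k)).rTensor H)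

@[simp] lemma c2_tmul (a b c : H) :
    c2 k (a ⊗ₜ[k] (b ⊗ₜ[k] c)) = a ⊗ₜ (counit (R := k) b • c) := rfl

lemma c2_idΔ (s : H ⊗[k] H) : c2 k (idΔ k s) = s := by
  induction s with
  | zero => simp
  | add a b ha hb => simp only [map_add, ha, hb]
  | tmul c d =>
    simp [c2, Δ, Coalgebra.rTensor_counit_comul]

lemma c2_Δid (s : H ⊗[k] H) : c2 k (Δid k s) = s := by
  have : ∀ (t : H ⊗[k] H) (d : H), c2 k (TensorProduct.assoc k H H H (t ⊗ₜ d)) =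
      (TensorProduct.rid k H ((counit (R := k)).lTensor H t)) ⊗ₜ d := by
    intro t d
    induction t with
    | zero => simp
    | add a b ha hb => simp only [TensorProduct.add_tmul, map_add, ha, hb]
    | tmul a b => simp [TensorProduct.smul_tmul]
  induction s with
  | zero => simp
  | add a b ha hb => simp only [map_add, ha, hb]
  | tmul c d => simp [Δid_tmul, this, Δ, Coalgebra.lTensor_counit_comul]

/-- `h₍₁₎ ε(h₍₂₎ z) = h 1₍₁₎ ε(1₍₂₎ z)` -/
lemma counit_contract_right (z h : H) :
    TensorProduct.rid k H (TensorProduct.map LinearMap.id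
      ((counit (R := k)) ∘ₗ LinearMap.mulRight k z) (Δ k h)) =
    h * TensorProduct.rid k H (TensorProduct.map LinearMap.id
      ((counit (R := k)) ∘ₗ LinearMap.mulRight k z) (Δ k 1)) := by
  have key : ∀ s : H ⊗[k] H, TensorProduct.rid k H (TensorProduct.map LinearMap.id
      ((counit (R := k)) ∘ₗ LinearMap.mulRight k z) s) =
      TensorProduct.rid k H (TensorProduct.map LinearMap.id
      ((counit (R := k)) ∘ₗ LinearMap.mulRight k z) (c2 k (j12 k s * j23 k (Δ k 1)))) := by
    intro s
    induction s with
    | zero => simp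
    | add a b ha hb => simp only [add_mul, map_add, ha, hb]
    | tmul a b =>
      have h2 := counit_mul_left (k := k) b 1 z
      rw [mul_one] at h2
      simp only [TensorProduct.map_tmul, LinearMap.comp_apply, LinearMap.mulRight_apply,
        LinearMap.id_apply, TensorProduct.rid_tmul, h2, Δ]
      generalize (comul (1 : H) : H ⊗[k] H) = s
      induction s with
      | zero => simp
      | add a b ha hb => simp only [mul_add, map_add, add_smul, ha, hb]
      | tmul c d => simp [smul_smul]
  rw [key, B2, c2_Δid]
  generalize Δ k (1 : H) = s
  induction s with
  | zero => simp
  | add a b ha hb => simp only [mul_add, map_add, ha, hb]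
  | tmul c d => simp

/-- `h₍₁₎ ⊗ ε_t(h₍₂₎) = 1₍₁₎ h ⊗ 1₍₂₎` -/
lemma id_epsT_comul (h : H) : (epsT k).lTensor H (Δ k h) = Δ k 1 * (h ⊗ₜ 1) := by
  have key : ∀ s : H ⊗[k] H,
      (epsT k).lTensor H s = c2 k (j23 k (Δ k 1) * j12 k s) := by
    intro s
    induction s with
    | zero => simp
    | add a b ha hb => simp only [mul_add, map_add, ha, hb]
    | tmul a b =>
      rw [LinearMap.lTensor_tmul, epsT_apply]
      generalize Δ k (1 : H) = s
      induction s with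
      | zero => simp
      | add a b ha hb => simp only [add_mul, map_add, TensorProduct.tmul_add, ha, hb]
      | tmul c d => simp
  rw [key, B3, c2_Δid]

lemma id_epsT_comul_one : (epsT k).lTensor H (Δ k 1) = Δ k 1 := by
  rw [id_epsT_comul, ← Algebra.TensorProduct.one_def, mul_one]

/-- `ε_t(x₍₁₎) ε(x₍₂₎ z) = ε_t(x z)` -/
lemma epsT_counit_contract (x z : H) :
    TensorProduct.rid k H (TensorProduct.map (epsT k)
      ((counit (R := k)) ∘ₗ LinearMap.mulRight k z) (Δ k x)) = epsT k (x * z) := by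
  have h1 := epsT_apply' k LinearMap.id (x * z)
  rw [LinearMap.id_apply] at h1
  rw [h1]
  have key : ∀ s : H ⊗[k] H, TensorProduct.lid k H (TensorProduct.map
      ((counit (R := k)) ∘ₗ LinearMap.mulRight k (x * z)) LinearMap.id s) =
      TensorProduct.rid k H (TensorProduct.map
      ((TensorProduct.lid k H).toLinearMap ∘ₗ (counit (R := k)).rTensor H ∘ₗ
        LinearMap.mulLeft k s ∘ₗ (TensorProduct.mk k H H).flip 1)
      ((counit (R := k)) ∘ₗ LinearMap.mulRight k z) (Δ k x)) := by
    intro s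
    induction s with
    | zero => simp
    | add a b ha hb =>
      have : LinearMap.mulLeft k (a + b) = LinearMap.mulLeft k a + LinearMap.mulLeft k b := by
        ext; simp [add_mul]
      simp only [map_add, ha, hb, this, LinearMap.add_comp, LinearMap.comp_add,
        TensorProduct.map_add_left, LinearMap.add_apply]
    | tmul a b =>
      simp only [TensorProduct.map_tmul, LinearMap.comp_apply, LinearMap.mulRight_apply,
        LinearMap.id_apply, TensorProduct.lid_tmul]
      rw [← mul_assoc, counit_mul_left (k := k) a x z]
      simp only [Δ]
      generalize (comul x : H ⊗[k] H) = s
      induction s with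
      | zero => simp
      | add a b ha hb => simp only [map_add, add_smul, ha, hb]
      | tmul c d => simp [smul_smul, mul_comm]
  rw [key]
  congr 3
  ext a
  simp [epsT_apply]

/-- `ε_t(h₍₁₎) ⊗ h₍₂₎ = ε_t(1₍₁₎) ⊗ 1₍₂₎ h` -/
lemma epsT_id_comul (h : H) :
    (epsT k).rTensor H (Δ k h) = (epsT k).rTensor H (Δ k 1 * (1 ⊗ₜ h)) := by
  have key : ∀ s : H ⊗[k] H, (epsT k).rTensor H s =
      (epsT k).rTensor H (c2 k (j12 k (Δ k 1) * j23 k s)) := by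
    intro s
    induction s with
    | zero => simp
    | add a b ha hb => simp only [mul_add, map_add, ha, hb]
    | tmul a b =>
      have := epsT_counit_contract k 1 a
      rw [one_mul] at this
      rw [LinearMap.rTensor_tmul, ← this]
      generalize Δ k (1 : H) = s
      induction s with
      | zero => simp
      | add a b ha hb => simp only [add_mul, map_add, TensorProduct.add_tmul, ha, hb]
      | tmul c d => simp [TensorProduct.smul_tmul]
  rw [key, B1, c2_idΔ]

end Algebra
end QG

namespace QG
open Coalgebra QuantumGroupoid

section Act
variable {k A B V W : Type u} [Field k] [Ring A] [Algebra k A] [Ring B] [Algebra k B]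
  [AddCommGroup V] [Module k V] [AddCommGroup W] [Module k W]

/-- The action of `A ⊗ B` on `V ⊗ W`. -/
def act2 (ρ : A →ₐ[k] Module.End k V) (σ : B →ₐ[k] Module.End k W) :
    A ⊗[k] B →ₐ[k] Module.End k (V ⊗[k] W) :=
  (Module.endTensorEndAlgHom).comp (Algebra.TensorProduct.map ρ σ)

@[simp] lemma act2_tmul (ρ : A →ₐ[k] Module.End k V) (σ : B →ₐ[k] Module.End k W)
    (a : A) (b : B) (v : V) (w : W) :
    act2 ρ σ (a ⊗ₜ b) (v ⊗ₜ w) = ρ a v ⊗ₜ σ b w := rfl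

end Act

/-- The category of finite-dimensional left `H`-modules. An `H`-module is given as a `k`-vector
space `V` with a unital algebra homomorphism `ρ : H → End_k(V)`. -/
structure RepCat (k H : Type u) [Field k] [Ring H] [Algebra k H] : Type (u + 1) where
  V : Type u
  [addCommGroup : AddCommGroup V]
  [module : Module k V]
  [finiteDimensional : FiniteDimensional k V]
  ρ : H →ₐ[k] Module.End k V

namespace RepCat

attribute [instance] addCommGroup module finiteDimensional

section Cat
variable {k H : Type u} [Field k] [Ring H] [Algebra k H]

/-- The space of `H`-linear maps. -/
def homSubmodule (X Y : RepCat k H) : Submodule k (X.V →ₗ[k] Y.V) where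
  carrier := {f | ∀ h x, f (X.ρ h x) = Y.ρ h (f x)}
  add_mem' hf hg h x := by simp [hf h x, hg h x]
  zero_mem' h x := by simp
  smul_mem' c f hf h x := by simp [hf h x]

instance : Category (RepCat k H) where
  Hom X Y := homSubmodule X Y
  id X := ⟨LinearMap.id, fun _ _ => rfl⟩
  comp f g := ⟨g.1 ∘ₗ f.1, fun h x => by
    simp only [LinearMap.comp_apply]; rw [f.2 h x, g.2 h]⟩

/-- The linear map underlying a morphism. -/
def lin {X Y : RepCat k H} (f : X ⟶ Y) : X.V →ₗ[k] Y.V := Subtype.val f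

/-- A morphism from an `H`-linear map. -/
def ofLin {X Y : RepCat k H} (f : X.V →ₗ[k] Y.V) (hf : ∀ h x, f (X.ρ h x) = Y.ρ h (f x)) :
    X ⟶ Y := (⟨f, hf⟩ : homSubmodule X Y)

@[simp] lemma lin_ofLin {X Y : RepCat k H} (f : X.V →ₗ[k] Y.V) (hf) :
    lin (ofLin f hf : X ⟶ Y) = f := rfl
@[simp] lemma lin_id (X : RepCat k H) : lin (𝟙 X) = LinearMap.id := rfl
@[simp] lemma lin_comp {X Y Z : RepCat k H} (f : X ⟶ Y) (g : Y ⟶ Z) :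
    lin (f ≫ g) = lin g ∘ₗ lin f := rfl
lemma lin_ρ {X Y : RepCat k H} (f : X ⟶ Y) (h : H) (x : X.V) :
    lin f (X.ρ h x) = Y.ρ h (lin f x) := Subtype.property f h x
lemma hom_ext {X Y : RepCat k H} {f g : X ⟶ Y} (h : ∀ x, lin f x = lin g x) : f = g :=
  Subtype.ext (LinearMap.ext h)

instance : Preadditive (RepCat k H) where
  homGroup X Y := inferInstanceAs (AddCommGroup (homSubmodule X Y))
  add_comp _ _ _ _ _ g := hom_ext fun _ => map_add (lin g) _ _
  comp_add _ _ _ _ _ _ := hom_ext fun _ => rfl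

instance : Linear k (RepCat k H) where
  homModule X Y := inferInstanceAs (Module k (homSubmodule X Y))
  smul_comp _ _ _ _ _ g := hom_ext fun _ => map_smul (lin g) _ _
  comp_smul _ _ _ _ _ _ := hom_ext fun _ => rfl

@[simp] lemma lin_add {X Y : RepCat k H} (f g : X ⟶ Y) : lin (f + g) = lin f + lin g := rfl
@[simp] lemma lin_zero {X Y : RepCat k H} : lin (0 : X ⟶ Y) = 0 := rfl
@[simp] lemma lin_smul {X Y : RepCat k H} (c : k) (f : X ⟶ Y) : lin (c • f) = c • lin f := rfl

/-- The action of `H ⊗ H` on `X ⊗ Y`. -/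
abbrev act (X Y : RepCat k H) : H ⊗[k] H →ₐ[k] Module.End k (X.V ⊗[k] Y.V) := act2 X.ρ Y.ρ

/-- The action of `H ⊗ H ⊗ H` on `X ⊗ Y ⊗ Z`. -/
abbrev act3 (X Y Z : RepCat k H) :
    H ⊗[k] (H ⊗[k] H) →ₐ[k] Module.End k (X.V ⊗[k] (Y.V ⊗[k] Z.V)) := act2 X.ρ (act Y Z)

lemma act_map {X Y X' Y' : RepCat k H} (f : X ⟶ X') (g : Y ⟶ Y') (t : H ⊗[k] H)
    (x : X.V ⊗[k] Y.V) :
    TensorProduct.map (lin f) (lin g) (act X Y t x) =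
      act X' Y' t (TensorProduct.map (lin f) (lin g) x) := by
  induction t with
  | zero => simp
  | add a b ha hb => simp only [map_add, LinearMap.add_apply, ha, hb]
  | tmul a b =>
    induction x with
    | zero => simp
    | add a b ha hb => simp only [map_add, ha, hb]
    | tmul v w => simp [lin_ρ]

end Cat

variable {k H : Type u} [Field k] [Ring H] [Algebra k H] [QuantumGroupoid k H]

/-- The underlying space `{x ∈ X ⊗_k Y | x = Δ(1) · x}` of the tensor product. -/
def carrier (X Y : RepCat k H) : Submodule k (X.V ⊗[k] Y.V) where
  carrier := {x | act X Y (Δ k 1) x = x}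
  add_mem' {a b} ha hb := by simp only [Set.mem_ofPred_eq, map_add] at *; rw [ha, hb]
  zero_mem' := by simp
  smul_mem' c x hx := by simp only [Set.mem_ofPred_eq, map_smul] at *; rw [hx]

lemma act_one_act (X Y : RepCat k H) (h : H) (x : X.V ⊗[k] Y.V) :
    act X Y (Δ k 1) (act X Y (Δ k h) x) = act X Y (Δ k h) x := by
  rw [← Module.End.mul_apply, ← map_mul, one_comul]

lemma act_act_one (X Y : RepCat k H) (h : H) (x : X.V ⊗[k] Y.V) :
    act X Y (Δ k h) (act X Y (Δ k 1) x) = act X Y (Δ k h) x := by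
  rw [← Module.End.mul_apply, ← map_mul, comul_one']

/-- The tensor product of representations, with `H` acting through `Δ`. -/
def tensor (X Y : RepCat k H) : RepCat k H where
  V := carrier X Y
  ρ := AlgHom.ofLinearMap
    { toFun := fun h => (act X Y (Δ k h)).restrict (p := carrier X Y) (q := carrier X Y)
        (fun x _ => act_one_act X Y h x)
      map_add' := fun a b => by ext x; simp; rfl
      map_smul' := fun c a => by ext x; simp; rfl }
    (by ext x; exact x.2)
    (fun a b => by
      ext x
      simp [Δ, QuantumGroupoid.comul_mul]; rfl)

/-- The inclusion of the tensor product into the tensor product over `k`. -/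
def incl (X Y : RepCat k H) : (tensor X Y).V →ₗ[k] X.V ⊗[k] Y.V := (carrier X Y).subtype

/-- The action of `Δ(1)`, a projection onto the tensor product. -/
def proj (X Y : RepCat k H) : X.V ⊗[k] Y.V →ₗ[k] (tensor X Y).V :=
  (act X Y (Δ k 1)).codRestrict (carrier X Y) (fun x => act_one_act X Y 1 x)

variable (X Y Z : RepCat k H)

lemma incl_injective : Function.Injective (incl X Y) := Subtype.val_injective

@[simp] lemma incl_proj (x : X.V ⊗[k] Y.V) : incl X Y (proj X Y x) = act X Y (Δ k 1) x := rfl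

@[simp] lemma act_incl (x : (tensor X Y).V) : act X Y (Δ k 1) (incl X Y x) = incl X Y x := x.2

@[simp] lemma proj_incl (x : (tensor X Y).V) : proj X Y (incl X Y x) = x :=
  incl_injective X Y (by simp)

@[simp] lemma incl_ρ (h : H) (x : (tensor X Y).V) :
    incl X Y ((tensor X Y).ρ h x) = act X Y (Δ k h) (incl X Y x) := rfl

/-- The tensor product of morphisms: the restriction of the tensor product over `k`. -/
def tensorMap {X Y X' Y' : RepCat k H} (f : X ⟶ X') (g : Y ⟶ Y') : tensor X Y ⟶ tensor X' Y' :=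
  ofLin ((TensorProduct.map (lin f) (lin g)).restrict (p := carrier X Y) (q := carrier X' Y')
    (fun x hx => by
      change act X' Y' (Δ k 1) _ = _
      rw [← act_map, show act X Y (Δ k 1) x = x from hx]))
    (fun h x => incl_injective X' Y' (act_map f g (Δ k h) (incl X Y x)))

@[simp] lemma incl_tensorMap {X Y X' Y' : RepCat k H} (f : X ⟶ X') (g : Y ⟶ Y')
    (x : (tensor X Y).V) :
    incl X' Y' (lin (tensorMap f g) x) = TensorProduct.map (lin f) (lin g) (incl X Y x) := rfl

/-! ### Associativity -/

lemma act_lTensor_incl (t : H ⊗[k] H) (x : X.V ⊗[k] (tensor Y Z).V) :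
    (incl Y Z).lTensor X.V (act X (tensor Y Z) t x) =
      act3 X Y Z (idΔ k t) ((incl Y Z).lTensor X.V x) := by
  induction t with
  | zero => simp
  | add a b ha hb => simp only [map_add, LinearMap.add_apply, ha, hb]
  | tmul a b =>
    induction x with
    | zero => simp
    | add a b ha hb => simp only [map_add, ha, hb]
    | tmul v w => simp

lemma assoc_act (t : H ⊗[k] H) (b : H) (x : (X.V ⊗[k] Y.V)) (z : Z.V) :
    TensorProduct.assoc k X.V Y.V Z.V (act X Y t x ⊗ₜ[k] Z.ρ b z) =
      act3 X Y Z (TensorProduct.assoc k H H H (t ⊗ₜ b))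
        (TensorProduct.assoc k X.V Y.V Z.V (x ⊗ₜ z)) := by
  induction t with
  | zero => simp
  | add a b ha hb =>
    simp only [map_add, LinearMap.add_apply, TensorProduct.add_tmul, ha, hb]
  | tmul a b =>
    induction x with
    | zero => simp
    | add a b ha hb => simp only [map_add, TensorProduct.add_tmul, ha, hb]
    | tmul v w => simp

lemma act_rTensor_incl (t : H ⊗[k] H) (x : (tensor X Y).V ⊗[k] Z.V) :
    TensorProduct.assoc k X.V Y.V Z.V ((incl X Y).rTensor Z.V (act (tensor X Y) Z t x)) =
      act3 X Y Z (Δid k t) (TensorProduct.assoc k X.V Y.V Z.V ((incl X Y).rTensor Z.V x)) := by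
  induction t with
  | zero => simp
  | add a b ha hb => simp only [map_add, LinearMap.add_apply, ha, hb]
  | tmul a b =>
    induction x with
    | zero => simp
    | add a b ha hb => simp only [map_add, ha, hb]
    | tmul v w =>
      simp only [act2_tmul, LinearMap.rTensor_tmul, incl_ρ]
      exact assoc_act X Y Z _ _ _ _

/-- The inclusion of `X ⊗ (Y ⊗ Z)` into `X ⊗_k (Y ⊗_k Z)`. -/
def inclR : (tensor X (tensor Y Z)).V →ₗ[k] X.V ⊗[k] (Y.V ⊗[k] Z.V) :=
  (incl Y Z).lTensor X.V ∘ₗ incl X (tensor Y Z)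

/-- The inclusion of `(X ⊗ Y) ⊗ Z` into `(X ⊗_k Y) ⊗_k Z ≅ X ⊗_k (Y ⊗_k Z)`. -/
def inclL : (tensor (tensor X Y) Z).V →ₗ[k] X.V ⊗[k] (Y.V ⊗[k] Z.V) :=
  (TensorProduct.assoc k X.V Y.V Z.V).toLinearMap ∘ₗ
    (incl X Y).rTensor Z.V ∘ₗ incl (tensor X Y) Z

/-- The projection of `X ⊗_k (Y ⊗_k Z)` onto `X ⊗ (Y ⊗ Z)`. -/
def projR : X.V ⊗[k] (Y.V ⊗[k] Z.V) →ₗ[k] (tensor X (tensor Y Z)).V :=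
  proj X (tensor Y Z) ∘ₗ (proj Y Z).lTensor X.V

/-- The projection of `X ⊗_k (Y ⊗_k Z) ≅ (X ⊗_k Y) ⊗_k Z` onto `(X ⊗ Y) ⊗ Z`. -/
def projL : X.V ⊗[k] (Y.V ⊗[k] Z.V) →ₗ[k] (tensor (tensor X Y) Z).V :=
  proj (tensor X Y) Z ∘ₗ (proj X Y).rTensor Z.V ∘ₗ
    (TensorProduct.assoc k X.V Y.V Z.V).symm.toLinearMap

lemma projR_inclR (x) : projR X Y Z (inclR X Y Z x) = x := by
  have : (proj Y Z) ∘ₗ incl Y Z = LinearMap.id := by ext; simp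
  simp only [projR, inclR, LinearMap.comp_apply]
  rw [← LinearMap.comp_apply ((proj Y Z).lTensor X.V), ← LinearMap.lTensor_comp, this]
  simp

lemma projL_inclL (x) : projL X Y Z (inclL X Y Z x) = x := by
  have : (proj X Y) ∘ₗ incl X Y = LinearMap.id := by ext; simp
  simp only [projL, inclL, LinearMap.comp_apply, LinearEquiv.coe_coe,
    LinearEquiv.symm_apply_apply]
  rw [← LinearMap.comp_apply ((proj X Y).rTensor Z.V), ← LinearMap.rTensor_comp, this]
  simp

lemma inclR_injective : Function.Injective (inclR X Y Z) :=
  Function.LeftInverse.injective (projR_inclR X Y Z)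

lemma inclL_injective : Function.Injective (inclL X Y Z) :=
  Function.LeftInverse.injective (projL_inclL X Y Z)

lemma inclR_ρ (h : H) (x) : inclR X Y Z ((tensor X (tensor Y Z)).ρ h x) =
    act3 X Y Z (idΔ k (Δ k h)) (inclR X Y Z x) := by
  simp only [inclR, LinearMap.comp_apply, incl_ρ, act_lTensor_incl]

lemma inclL_ρ (h : H) (x) : inclL X Y Z ((tensor (tensor X Y) Z).ρ h x) =
    act3 X Y Z (idΔ k (Δ k h)) (inclL X Y Z x) := by
  simp only [inclL, LinearMap.comp_apply, incl_ρ, LinearEquiv.coe_coe, act_rTensor_incl,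
    Δid_comul]

lemma act_inclR (x) : act3 X Y Z (idΔ k (Δ k 1)) (inclR X Y Z x) = inclR X Y Z x := by
  rw [← inclR_ρ, map_one]; rfl

lemma act_inclL (x) : act3 X Y Z (idΔ k (Δ k 1)) (inclL X Y Z x) = inclL X Y Z x := by
  rw [← inclL_ρ, map_one]; rfl

lemma inclR_projR (x) : inclR X Y Z (projR X Y Z x) = act3 X Y Z (idΔ k (Δ k 1)) x := by
  have h1 : ∀ x, (incl Y Z).lTensor X.V ((proj Y Z).lTensor X.V x) =
      act3 X Y Z (1 ⊗ₜ Δ k 1) x := by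
    intro x
    induction x with
    | zero => simp
    | add a b ha hb => simp only [map_add, ha, hb]
    | tmul v w => simp
  have h2 : idΔ k (Δ k (1 : H)) * (1 ⊗ₜ Δ k 1) = idΔ k (Δ k 1) := by
    rw [← idΔ_tmul, ← idΔ_mul, ← Algebra.TensorProduct.one_def, mul_one]
  simp only [inclR, projR, LinearMap.comp_apply, incl_proj, act_lTensor_incl, h1]
  rw [← Module.End.mul_apply, ← map_mul, h2]

lemma inclL_projL (x) : inclL X Y Z (projL X Y Z x) = act3 X Y Z (idΔ k (Δ k 1)) x := by
  have h1 : ∀ x, (TensorProduct.assoc k X.V Y.V Z.V)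
      ((incl X Y).rTensor Z.V ((proj X Y).rTensor Z.V x)) =
      act3 X Y Z (j12 k (Δ k 1)) (TensorProduct.assoc k X.V Y.V Z.V x) := by
    intro x
    induction x with
    | zero => simp
    | add a b ha hb => simp only [map_add, ha, hb]
    | tmul v w =>
      have := assoc_act X Y Z (Δ k 1) 1 v w
      simp only [map_one, Module.End.one_apply] at this
      simp only [LinearMap.rTensor_tmul, incl_proj]
      exact this
  have h2 : idΔ k (Δ k (1 : H)) * j12 k (Δ k 1) = idΔ k (Δ k 1) := by
    rw [← Δid_tmul_one, ← Δid_comul, ← Δid_mul, ← Algebra.TensorProduct.one_def, mul_one]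
  simp only [inclL, projL, LinearMap.comp_apply, incl_proj, LinearEquiv.coe_coe,
    act_rTensor_incl, h1, LinearEquiv.apply_symm_apply, Δid_comul]
  rw [← Module.End.mul_apply, ← map_mul, h2]

lemma inclR_projR_inclL (x) : inclR X Y Z (projR X Y Z (inclL X Y Z x)) = inclL X Y Z x := by
  rw [inclR_projR, act_inclL]

lemma inclL_projL_inclR (x) : inclL X Y Z (projL X Y Z (inclR X Y Z x)) = inclR X Y Z x := by
  rw [inclL_projL, act_inclR]

/-- The associativity isomorphism. As subspaces of `X ⊗_k Y ⊗_k Z`, the spaces `(X ⊗ Y) ⊗ Z` and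
`X ⊗ (Y ⊗ Z)` coincide (`inclR_projR_inclL`), and the isomorphism is the identity. -/
def assocIso : tensor (tensor X Y) Z ≅ tensor X (tensor Y Z) where
  hom := ofLin (projR X Y Z ∘ₗ inclL X Y Z) (fun h x => inclR_injective X Y Z (by
    simp only [LinearMap.comp_apply, inclR_ρ, inclR_projR_inclL]
    rw [← inclL_ρ]))
  inv := ofLin (projL X Y Z ∘ₗ inclR X Y Z) (fun h x => inclL_injective X Y Z (by
    simp only [LinearMap.comp_apply, inclL_ρ, inclL_projL_inclR]
    rw [← inclR_ρ]))
  hom_inv_id := hom_ext fun x => by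
    simp [inclR_projR_inclL, projL_inclL]
  inv_hom_id := hom_ext fun x => by
    simp [inclL_projL_inclR, projR_inclR]

lemma inclR_assocIso (x) : inclR X Y Z (lin (assocIso X Y Z).hom x) = inclL X Y Z x :=
  inclR_projR_inclL X Y Z x

lemma inclL_assocIso_inv (x) : inclL X Y Z (lin (assocIso X Y Z).inv x) = inclR X Y Z x :=
  inclL_projL_inclR X Y Z x

/-! ### The unit object -/

variable (k H) in
/-- The unit object `H_t`, with `h · z = ε_t(h z)`. -/
def unit : RepCat k H where
  V := Ht k H
  finiteDimensional := by
    have := QuantumGroupoid.finiteDimensional (k := k) (H := H)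
    infer_instance
  ρ := AlgHom.ofLinearMap
    { toFun := fun h => ((epsT k ∘ₗ LinearMap.mulLeft k h) ∘ₗ (Ht k H).subtype).codRestrict
        (Ht k H) (fun x => epsT_mem k _)
      map_add' := fun a b => by ext x; simp [add_mul]
      map_smul' := fun c a => by ext x; simp }
    (by ext x; simpa using epsT_of_mem k x.2)
    (fun a b => by ext x; simp)

/-- The element `1` of the unit object. -/
def oneT : (unit k H).V := (⟨1, epsT_one k (H := H) ▸ epsT_mem k 1⟩ : Ht k H)

/-- The inclusion `H_t → H`. -/
def coeT : (unit k H).V →ₗ[k] H := (Ht k H).subtype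

@[simp] lemma coeT_oneT : coeT (oneT (k := k) (H := H)) = 1 := rfl
@[simp] lemma coeT_ρ (h : H) (z : (unit k H).V) :
    coeT ((unit k H).ρ h z) = epsT k (h * coeT z) := rfl
lemma coeT_mem (z : (unit k H).V) : coeT z ∈ Ht k H := z.2
lemma coeT_injective : Function.Injective (coeT (k := k) (H := H)) := Subtype.val_injective

/-- `z ⊗ v ↦ z · v` -/
def mulT : (unit k H).V ⊗[k] X.V →ₗ[k] X.V :=
  TensorProduct.lift (X.ρ.toLinearMap ∘ₗ coeT)

@[simp] lemma mulT_tmul (z : (unit k H).V) (v : X.V) : mulT X (z ⊗ₜ v) = X.ρ (coeT z) v := rfl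

lemma mulT_act (h : H) (x) : mulT X (act (unit k H) X (Δ k h) x) = X.ρ h (mulT X x) := by
  induction x with
  | zero => simp
  | add a b ha hb => simp only [map_add, ha, hb]
  | tmul z v =>
    rw [mulT_tmul, ← Module.End.mul_apply, ← map_mul,
      ← counit_contract_of_mem k (coeT_mem z), ← epsT_mul_contract]
    generalize Δ k h = t
    induction t with
    | zero => simp
    | add a b ha hb => simp only [map_add, LinearMap.add_apply, ha, hb]
    | tmul a b => simp

/-- `x ↦ z · x` versus `1`: `Δ(1)(1 ⊗ z v) = Δ(1)(z ⊗ v)`. -/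
lemma act_oneT_mulT (x) :
    act (unit k H) X (Δ k 1) (oneT ⊗ₜ mulT X x) = act (unit k H) X (Δ k 1) x := by
  have hinj : Function.Injective ((coeT (k := k) (H := H)).rTensor X.V) :=
    Module.Flat.rTensor_preserves_injective_linearMap _ coeT_injective
  induction x with
  | zero => simp
  | add a b ha hb => simp only [map_add, TensorProduct.tmul_add, ha, hb]
  | tmul z v =>
    apply hinj
    have h1 := epsT_id_comul k (coeT z)
    rw [comul_of_mem k (coeT_mem z)] at h1
    have h2 := congrArg (LinearMap.lTensor H (LinearMap.applyₗ v ∘ₗ X.ρ.toLinearMap)) h1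
    have e1 : ∀ t : H ⊗[k] H, coeT.rTensor X.V (act (unit k H) X t (z ⊗ₜ v)) =
      (LinearMap.lTensor H (LinearMap.applyₗ v ∘ₗ X.ρ.toLinearMap))
        ((epsT k).rTensor H (t * (coeT z ⊗ₜ 1))) := by
      intro t
      induction t with
      | zero => simp
      | add a b ha hb => simp only [map_add, add_mul, LinearMap.add_apply, ha, hb]
      | tmul a b => simp
    have e2 : ∀ t : H ⊗[k] H,
      coeT.rTensor X.V (act (unit k H) X t (oneT ⊗ₜ X.ρ (coeT z) v)) =
      (LinearMap.lTensor H (LinearMap.applyₗ v ∘ₗ X.ρ.toLinearMap))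
        ((epsT k).rTensor H (t * (1 ⊗ₜ coeT z))) := by
      intro t
      induction t with
      | zero => simp
      | add a b ha hb => simp only [map_add, add_mul, LinearMap.add_apply, ha, hb]
      | tmul a b => simp
    rw [mulT_tmul, e1, e2, h2]

/-- The left unit isomorphism `l(z ⊗ v) = z · v`, with inverse `v ↦ 1₍₁₎ · 1 ⊗ 1₍₂₎ · v`. -/
def leftIso : tensor (unit k H) X ≅ X where
  hom := ofLin (mulT X ∘ₗ incl (unit k H) X) (fun h x => by
    simp only [LinearMap.comp_apply, incl_ρ, mulT_act])
  inv := ofLin (proj (unit k H) X ∘ₗ TensorProduct.mk k _ _ oneT) (fun h x => by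
    apply incl_injective
    have := act_oneT_mulT X (act (unit k H) X (Δ k h) (oneT ⊗ₜ x))
    rw [mulT_act, act_one_act] at this
    simpa [act_act_one] using this)
  hom_inv_id := hom_ext fun x => by
    apply incl_injective
    simp [act_oneT_mulT]
  inv_hom_id := hom_ext fun x => by
    have := mulT_act X 1 (oneT ⊗ₜ x)
    simpa using this

/-- `v ⊗ z ↦ ε(z) v` -/
def counitT : X.V ⊗[k] (unit k H).V →ₗ[k] X.V :=
  (TensorProduct.rid k X.V).toLinearMap ∘ₗ LinearMap.lTensor X.V (counit ∘ₗ coeT)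

@[simp] lemma counitT_tmul (z : (unit k H).V) (v : X.V) :
    counitT X (v ⊗ₜ z) = counit (R := k) (coeT z) • v := rfl

lemma counitT_act_tmul (t : H ⊗[k] H) (v : X.V) (z : (unit k H).V) :
    counitT X (act X (unit k H) t (v ⊗ₜ z)) =
      X.ρ (TensorProduct.rid k H (TensorProduct.map LinearMap.id
      ((counit (R := k)) ∘ₗ LinearMap.mulRight k (coeT z)) t)) v := by
  induction t with
  | zero => simp
  | add a b ha hb => simp only [map_add, LinearMap.add_apply, ha, hb]
  | tmul a b => simp [counit_epsT]

lemma counitT_act (h : H) (x) : counitT X (act X (unit k H) (Δ k h) x) =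
    X.ρ h (counitT X (act X (unit k H) (Δ k 1) x)) := by
  induction x with
  | zero => simp
  | add a b ha hb => simp only [map_add, ha, hb]
  | tmul v z =>
    rw [counitT_act_tmul, counitT_act_tmul, counit_contract_right, map_mul]; rfl

lemma act_counitT_oneT (x) :
    act X (unit k H) (Δ k 1) (counitT X (act X (unit k H) (Δ k 1) x) ⊗ₜ oneT) =
      act X (unit k H) (Δ k 1) x := by
  have hinj : Function.Injective ((coeT (k := k) (H := H)).lTensor X.V) :=
    Module.Flat.lTensor_preserves_injective_linearMap _ coeT_injective
  induction x with
  | zero => simp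
  | add a b ha hb => simp only [map_add, TensorProduct.add_tmul, ha, hb]
  | tmul v z =>
    apply hinj
    rw [counitT_act_tmul]
    set w := TensorProduct.rid k H (TensorProduct.map LinearMap.id
      ((counit (R := k)) ∘ₗ LinearMap.mulRight k (coeT z)) (Δ k 1)) with hw
    have e1 : ∀ (t : H ⊗[k] H) (y : H), coeT.lTensor X.V (act X (unit k H) t (X.ρ y v ⊗ₜ oneT)) =
      (LinearMap.rTensor H (LinearMap.applyₗ v ∘ₗ X.ρ.toLinearMap))
        ((epsT k).lTensor H (t * (y ⊗ₜ 1))) := by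
      intro t y
      induction t with
      | zero => simp
      | add a b ha hb => simp only [map_add, add_mul, LinearMap.add_apply, ha, hb]
      | tmul a b => simp
    have e2 : ∀ t : H ⊗[k] H, coeT.lTensor X.V (act X (unit k H) t (v ⊗ₜ z)) =
      (LinearMap.rTensor H (LinearMap.applyₗ v ∘ₗ X.ρ.toLinearMap))
        ((epsT k ∘ₗ LinearMap.mulRight k (coeT z)).lTensor H t) := by
      intro t
      induction t with
      | zero => simp
      | add a b ha hb => simp only [map_add, LinearMap.add_apply, ha, hb]
      | tmul a b => simp
    rw [e1, e2]
    congr 1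
    rw [← id_epsT_comul, ← LinearMap.comp_apply, ← LinearMap.lTensor_comp,
      show epsT k ∘ₗ epsT k = epsT k (H := H) by ext; simp, hw]
    have e3 : ∀ s : H ⊗[k] H, Δ k (TensorProduct.rid k H (TensorProduct.map LinearMap.id
      ((counit (R := k)) ∘ₗ LinearMap.mulRight k (coeT z)) s)) =
      LinearMap.lTensor H ((TensorProduct.rid k H).toLinearMap ∘ₗ TensorProduct.map LinearMap.id
      ((counit (R := k)) ∘ₗ LinearMap.mulRight k (coeT z))) (Δid k s) := by
      intro s
      induction s with
      | zero => simp
      | add a b ha hb => simp only [map_add, ha, hb]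
      | tmul a b =>
        simp only [Δid_tmul, TensorProduct.map_tmul, TensorProduct.rid_tmul, map_smul,
          LinearMap.id_apply]
        generalize Δ k a = t
        induction t with
        | zero => simp
        | add a b ha hb => simp only [map_add, TensorProduct.add_tmul, smul_add, ha, hb]
        | tmul c d => simp
    rw [e3, Δid_comul, ← LinearMap.comp_apply, ← LinearMap.lTensor_comp, idΔ,
      ← LinearMap.comp_apply, ← LinearMap.lTensor_comp]
    congr 2
    ext x
    have := epsT_counit_contract k x (coeT z)
    simp only [LinearMap.comp_apply, LinearMap.mulRight_apply, ← this, LinearEquiv.coe_coe]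
    generalize Δ k x = t
    induction t with
    | zero => simp
    | add a b ha hb => simp only [map_add, ha, hb]
    | tmul c d => simp

/-- The right unit isomorphism, inverse to `v ↦ 1₍₁₎ · v ⊗ 1₍₂₎ · 1`. -/
def rightIso : tensor X (unit k H) ≅ X where
  hom := ofLin (counitT X ∘ₗ incl X (unit k H)) (fun h x => by
    simp only [LinearMap.comp_apply, incl_ρ]
    rw [counitT_act, act_incl])
  inv := ofLin (proj X (unit k H) ∘ₗ (TensorProduct.mk k _ _).flip oneT) (fun h x => by
    apply incl_injective
    have hc : counitT X (act X (unit k H) (Δ k 1) (x ⊗ₜ oneT)) = x := by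
      rw [counitT_act_tmul]
      simp only [coeT_oneT]
      have : LinearMap.mulRight k (1 : H) = LinearMap.id := by ext; simp
      rw [this, LinearMap.comp_id]
      change X.ρ (TensorProduct.rid k H ((counit (R := k)).lTensor H (comul 1))) x = x
      simp [Coalgebra.lTensor_counit_comul]
    have := act_counitT_oneT X (act X (unit k H) (Δ k h) (x ⊗ₜ oneT))
    rw [act_one_act, counitT_act, hc] at this
    simpa [act_act_one] using this)
  hom_inv_id := hom_ext fun x => by
    apply incl_injective
    have := act_counitT_oneT X (incl X (unit k H) x)
    simpa using this
  inv_hom_id := hom_ext fun x => by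
    simp only [lin_comp, lin_ofLin, LinearMap.comp_apply, incl_proj, lin_id, LinearMap.id_apply]
    change counitT X (act X (unit k H) (Δ k 1) (x ⊗ₜ oneT)) = x
    rw [counitT_act_tmul]
    simp only [coeT_oneT]
    have : LinearMap.mulRight k (1 : H) = LinearMap.id := by ext; simp
    rw [this, LinearMap.comp_id]
    change X.ρ (TensorProduct.rid k H ((counit (R := k)).lTensor H (comul 1))) x = x
    simp [Coalgebra.lTensor_counit_comul]

end RepCat
end QG

namespace QG
open Coalgebra QuantumGroupoid
namespace RepCat
variable {k H : Type u} [Field k] [Ring H] [Algebra k H] [QuantumGroupoid k H]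

instance : MonoidalCategoryStruct (RepCat k H) where
  tensorObj := tensor
  tensorHom := tensorMap
  whiskerLeft X _ _ f := tensorMap (𝟙 X) f
  whiskerRight f Y := tensorMap f (𝟙 Y)
  tensorUnit := unit k H
  associator := assocIso
  leftUnitor := leftIso
  rightUnitor := rightIso

open MonoidalCategory

lemma incl_whiskerLeft (X : RepCat k H) {Y Y' : RepCat k H} (f : Y ⟶ Y') (x : (X ⊗ Y).V) :
    incl X Y' (lin (X ◁ f) x) = (lin f).lTensor X.V (incl X Y x) := rfl

lemma incl_whiskerRight {X X' : RepCat k H} (f : X ⟶ X') (Y : RepCat k H) (x : (X ⊗ Y).V) :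
    incl X' Y (lin (f ▷ Y) x) = (lin f).rTensor Y.V (incl X Y x) := rfl

lemma inclR_assoc (X Y Z : RepCat k H) (x) :
    inclR X Y Z (lin (α_ X Y Z).hom x) = inclL X Y Z x := inclR_assocIso X Y Z x

lemma inclL_assoc_inv (X Y Z : RepCat k H) (x) :
    inclL X Y Z (lin (α_ X Y Z).inv x) = inclR X Y Z x := inclL_assocIso_inv X Y Z x

lemma lTensor_lTensor_injective {A B : Type u} [AddCommGroup A] [Module k A] [AddCommGroup B]
    [Module k B] (V : Type u) [AddCommGroup V] [Module k V] {f : A →ₗ[k] B}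
    (hf : Function.Injective f) :
    Function.Injective (f.lTensor V) := Module.Flat.lTensor_preserves_injective_linearMap _ hf

lemma pentagon_aux (W X Y Z : RepCat k H) (x : (((W ⊗ X) ⊗ Y) ⊗ Z).V) :
    lin ((α_ W X Y).hom ▷ Z ≫ (α_ W (X ⊗ Y) Z).hom ≫ W ◁ (α_ X Y Z).hom) x =
      lin ((α_ (W ⊗ X) Y Z).hom ≫ (α_ W X (Y ⊗ Z)).hom) x := by
  apply incl_injective W (tensor X (tensor Y Z))
  apply lTensor_lTensor_injective W.V (inclR_injective X Y Z)
  simp only [lin_comp, LinearMap.comp_apply]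
  have e1 : inclR X Y Z ∘ₗ lin (α_ X Y Z).hom = inclL X Y Z :=
    LinearMap.ext fun x => inclR_assoc X Y Z x
  have e2 : inclR W X Y ∘ₗ lin (α_ W X Y).hom = inclL W X Y :=
    LinearMap.ext fun x => inclR_assoc W X Y x
  rw [incl_whiskerLeft, ← LinearMap.comp_apply ((inclR X Y Z).lTensor W.V),
    ← LinearMap.lTensor_comp, e1]
  have l1 : ∀ b, (inclL X Y Z).lTensor W.V (incl W (tensor (X ⊗ Y) Z) b) =
      ((TensorProduct.assoc k X.V Y.V Z.V).toLinearMap ∘ₗ (incl X Y).rTensor Z.V).lTensor W.V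
        (inclR W (X ⊗ Y) Z b) := by
    intro b
    simp only [inclL, inclR, LinearMap.lTensor_comp, LinearMap.comp_apply]
    rfl
  have l2 : ∀ b, (inclR X Y Z).lTensor W.V (incl W (tensor X (tensor Y Z)) b) =
      ((incl Y Z).lTensor X.V).lTensor W.V (inclR W X (Y ⊗ Z) b) := by
    intro b
    simp only [inclR, LinearMap.lTensor_comp, LinearMap.comp_apply]
    rfl
  erw [l1, l2]
  rw [inclR_assoc, inclR_assoc]
  have l3 : inclL W (X ⊗ Y) Z (lin ((α_ W X Y).hom ▷ Z) x) =
      (TensorProduct.assoc k W.V (X ⊗ Y).V Z.V) ((incl W (X ⊗ Y)).rTensor Z.V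
        ((lin (α_ W X Y).hom).rTensor Z.V (incl (tensor (W ⊗ X) Y) Z x))) := rfl
  rw [l3]
  have l4 : ∀ y, ((TensorProduct.assoc k X.V Y.V Z.V).toLinearMap ∘ₗ
        (incl X Y).rTensor Z.V).lTensor W.V (TensorProduct.assoc k W.V (X ⊗ Y).V Z.V y) =
      ((TensorProduct.assoc k X.V Y.V Z.V).toLinearMap.lTensor W.V)
      (TensorProduct.assoc k W.V (X.V ⊗[k] Y.V) Z.V (((incl X Y).lTensor W.V).rTensor Z.V y)) := by
    intro y
    induction y with
    | zero => simp
    | add a b ha hb => simp only [map_add, ha, hb]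
    | tmul p z =>
      induction p with
      | zero => simp
      | add a b ha hb => simp only [map_add, TensorProduct.add_tmul, ha, hb]
      | tmul w q => rfl
  have l5 : ∀ y, ((incl X Y).lTensor W.V).rTensor Z.V ((incl W (X ⊗ Y)).rTensor Z.V
        ((lin (α_ W X Y).hom).rTensor Z.V y)) = (inclL W X Y).rTensor Z.V y := by
    intro y
    rw [← e2]
    simp only [inclR, LinearMap.rTensor_comp, LinearMap.comp_apply]
    rfl
  rw [l4, l5]
  have l6 : inclL W X (Y ⊗ Z) (lin (α_ (W ⊗ X) Y Z).hom x) =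
      (TensorProduct.assoc k W.V X.V (tensor Y Z).V)
        ((incl W X).rTensor (tensor Y Z).V (incl (W ⊗ X) (tensor Y Z)
          (lin (α_ (W ⊗ X) Y Z).hom x))) := rfl
  rw [l6]
  have l7 : ∀ y, ((incl Y Z).lTensor X.V).lTensor W.V
      (TensorProduct.assoc k W.V X.V (tensor Y Z).V ((incl W X).rTensor (tensor Y Z).V y)) =
      TensorProduct.assoc k W.V X.V (Y.V ⊗[k] Z.V) ((incl W X).rTensor (Y.V ⊗[k] Z.V)
        ((incl Y Z).lTensor (W ⊗ X).V y)) := by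
    intro y
    induction y with
    | zero => simp
    | add a b ha hb => simp only [map_add, ha, hb]
    | tmul p z =>
      simp only [LinearMap.rTensor_tmul, LinearMap.lTensor_tmul]
      generalize incl W X p = q
      induction q with
      | zero => simp
      | add a b ha hb => simp only [map_add, TensorProduct.add_tmul, ha, hb]
      | tmul w q => rfl
  erw [l7]
  have l8 := inclR_assoc (W ⊗ X) Y Z x
  simp only [inclR, LinearMap.comp_apply] at l8
  erw [l8]
  simp only [inclL, LinearMap.comp_apply, LinearEquiv.coe_coe]
  generalize incl (tensor (tensor W X) Y) Z x = y
  induction y with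
  | zero => simp
  | add a b ha hb => simp only [map_add, ha, hb]
  | tmul p z =>
    simp only [LinearMap.rTensor_tmul, LinearMap.comp_apply, LinearEquiv.coe_coe]
    generalize incl (tensor W X) Y p = q
    induction q with
    | zero => simp
    | add a b ha hb => simp only [map_add, TensorProduct.add_tmul, ha, hb]
    | tmul r y =>
      simp only [LinearMap.rTensor_tmul, TensorProduct.assoc_tmul]
      generalize incl W X r = q
      induction q with
      | zero => simp
      | add a b ha hb => simp only [map_add, TensorProduct.add_tmul, ha, hb]
      | tmul r y => rfl

lemma triangle_aux (X Y : RepCat k H) (x) :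
    lin ((α_ X (𝟙_ _) Y).hom ≫ X ◁ (λ_ Y).hom) x = lin ((ρ_ X).hom ▷ Y) x := by
  apply incl_injective X Y
  simp only [lin_comp, LinearMap.comp_apply]
  rw [incl_whiskerLeft, incl_whiskerRight]
  have l1 : ∀ b, (lin (λ_ Y).hom).lTensor X.V (incl X (𝟙_ _ ⊗ Y) b) =
      (mulT Y).lTensor X.V (inclR X (unit k H) Y b) := by
    intro b
    rw [show lin (λ_ Y).hom = mulT Y ∘ₗ incl (unit k H) Y from rfl]
    simp only [inclR, LinearMap.lTensor_comp, LinearMap.comp_apply]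
    rfl
  have l2 : ∀ b, (lin (ρ_ X).hom).rTensor Y.V (incl (X ⊗ 𝟙_ _) Y b) =
      (counitT X).rTensor Y.V ((TensorProduct.assoc k X.V (unit k H).V Y.V).symm
        (inclL X (unit k H) Y b)) := by
    intro b
    rw [show lin (ρ_ X).hom = counitT X ∘ₗ incl X (unit k H) from rfl]
    simp only [inclL, LinearMap.rTensor_comp, LinearMap.comp_apply, LinearEquiv.coe_coe,
      LinearEquiv.symm_apply_apply]
    rfl
  have l3 := inclR_assoc X (𝟙_ _) Y x
  erw [l1, l2]
  erw [l3]
  suffices main : ∀ y, (mulT Y).lTensor X.V (act3 X (unit k H) Y (idΔ k (Δ k 1)) y) =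
      (counitT X).rTensor Y.V ((TensorProduct.assoc k X.V (unit k H).V Y.V).symm
        (act3 X (unit k H) Y (idΔ k (Δ k 1)) y)) by
    have := main (inclL X (unit k H) Y x)
    rw [act_inclL] at this
    exact this
  intro y
  induction y with
  | zero => simp
  | add a b ha hb => simp only [map_add, ha, hb]
  | tmul v q =>
    induction q with
    | zero => simp
    | add a b ha hb => simp only [map_add, TensorProduct.tmul_add, ha, hb]
    | tmul z w =>
      have key : ∀ (h : H), mulT Y (act (unit k H) Y (Δ k h) (z ⊗ₜ w)) =
          TensorProduct.lid k Y.V (((counit (R := k)) ∘ₗ coeT).rTensor Y.V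
            (act (unit k H) Y (Δ k h) (z ⊗ₜ w))) := by
        intro h
        rw [mulT_act, mulT_tmul, ← Module.End.mul_apply, ← map_mul,
          ← counit_contract_of_mem k (coeT_mem z)]
        generalize Δ k h = t
        induction t with
        | zero => simp
        | add a b ha hb => simp only [map_add, LinearMap.add_apply, ha, hb]
        | tmul a b => simp [counit_epsT]
      generalize Δ k (1 : H) = s
      induction s with
      | zero => simp
      | add a b ha hb => simp only [map_add, LinearMap.add_apply, ha, hb]
      | tmul a b =>
        rw [idΔ_tmul]
        change X.ρ a v ⊗ₜ mulT Y (act (unit k H) Y (Δ k b) (z ⊗ₜ w)) =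
          (counitT X).rTensor Y.V ((TensorProduct.assoc k X.V (unit k H).V Y.V).symm
            (X.ρ a v ⊗ₜ (act (unit k H) Y (Δ k b) (z ⊗ₜ w))))
        rw [key]
        generalize act (unit k H) Y (Δ k b) (z ⊗ₜ w) = q
        induction q with
        | zero => simp
        | add a b ha hb => simp only [map_add, TensorProduct.tmul_add, ha, hb]
        | tmul z w => simp [TensorProduct.smul_tmul']

lemma assoc_naturality_aux {X X' Y Y' Z Z' : RepCat k H} (f : X ⟶ X') (g : Y ⟶ Y') (h : Z ⟶ Z')
    (x) : lin (((f ⊗ₘ g) ⊗ₘ h) ≫ (α_ X' Y' Z').hom) x =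
      lin ((α_ X Y Z).hom ≫ (f ⊗ₘ (g ⊗ₘ h))) x := by
  apply inclR_injective
  simp only [lin_comp, LinearMap.comp_apply]
  erw [inclR_assoc]
  have l1 : ∀ y, inclR X' Y' Z' (lin (f ⊗ₘ (g ⊗ₘ h)) y) =
      TensorProduct.map (lin f) (TensorProduct.map (lin g) (lin h)) (inclR X Y Z y) := by
    intro y
    change (incl Y' Z').lTensor X'.V (TensorProduct.map (lin f) (lin (tensorMap g h))
      (incl X (tensor Y Z) y)) = TensorProduct.map (lin f) (TensorProduct.map (lin g) (lin h))
        ((incl Y Z).lTensor X.V (incl X (tensor Y Z) y))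
    generalize incl X (tensor Y Z) y = q
    induction q with
    | zero => simp
    | add a b ha hb => simp only [map_add, ha, hb]
    | tmul z w => rfl
  have l2 : ∀ y, inclL X' Y' Z' (lin ((f ⊗ₘ g) ⊗ₘ h) y) =
      TensorProduct.map (lin f) (TensorProduct.map (lin g) (lin h)) (inclL X Y Z y) := by
    intro y
    change TensorProduct.assoc k _ _ _ ((incl X' Y').rTensor Z'.V
      (TensorProduct.map (lin (tensorMap f g)) (lin h)
      (incl (tensor X Y) Z y))) = TensorProduct.map (lin f) (TensorProduct.map (lin g) (lin h))
        (TensorProduct.assoc k _ _ _ ((incl X Y).rTensor Z.V (incl (tensor X Y) Z y)))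
    generalize incl (tensor X Y) Z y = q
    induction q with
    | zero => simp
    | add a b ha hb => simp only [map_add, ha, hb]
    | tmul z w =>
      simp only [TensorProduct.map_tmul, LinearMap.rTensor_tmul, incl_tensorMap]
      generalize incl X Y z = q
      induction q with
      | zero => simp
      | add a b ha hb => simp only [map_add, TensorProduct.add_tmul, ha, hb]
      | tmul z w => rfl
  erw [l1, l2, inclR_assoc]

instance : MonoidalCategory (RepCat k H) where
  tensorHom_def {X₁ Y₁ X₂ Y₂} f g := hom_ext fun x => incl_injective _ _ (by
    change TensorProduct.map (lin f) (lin g) (incl X₁ X₂ x) =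
      TensorProduct.map (LinearMap.id) (lin g) (TensorProduct.map (lin f) LinearMap.id
        (incl X₁ X₂ x))
    generalize incl X₁ X₂ x = q
    induction q with
    | zero => simp
    | add a b ha hb => simp only [map_add, ha, hb]
    | tmul z w => simp)
  id_tensorHom_id X Y := hom_ext fun x => incl_injective _ _ (by
    change TensorProduct.map LinearMap.id LinearMap.id (incl X Y x) = incl X Y x
    simp)
  tensorHom_comp_tensorHom f₁ f₂ g₁ g₂ := hom_ext fun x => incl_injective _ _ (by
    change TensorProduct.map (lin g₁) (lin g₂) (TensorProduct.map (lin f₁) (lin f₂)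
      (incl _ _ x)) = TensorProduct.map (lin g₁ ∘ₗ lin f₁) (lin g₂ ∘ₗ lin f₂) (incl _ _ x)
    rw [TensorProduct.map_comp]; rfl)
  whiskerLeft_id X Y := hom_ext fun x => incl_injective _ _ (by
    change TensorProduct.map LinearMap.id LinearMap.id (incl X Y x) = incl X Y x
    simp)
  id_whiskerRight X Y := hom_ext fun x => incl_injective _ _ (by
    change TensorProduct.map LinearMap.id LinearMap.id (incl X Y x) = incl X Y x
    simp)
  associator_naturality f g h := hom_ext fun x => assoc_naturality_aux f g h x
  leftUnitor_naturality {X Y} f := hom_ext fun x => by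
    change mulT Y (TensorProduct.map LinearMap.id (lin f) (incl (unit k H) X x)) =
      lin f (mulT X (incl (unit k H) X x))
    generalize incl (unit k H) X x = q
    induction q with
    | zero => simp
    | add a b ha hb => simp only [map_add, ha, hb]
    | tmul z w => simp [lin_ρ]
  rightUnitor_naturality {X Y} f := hom_ext fun x => by
    change counitT Y (TensorProduct.map (lin f) LinearMap.id (incl X (unit k H) x)) =
      lin f (counitT X (incl X (unit k H) x))
    generalize incl X (unit k H) x = q
    induction q with
    | zero => simp
    | add a b ha hb => simp only [map_add, ha, hb]
    | tmul z w => simp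
  pentagon W X Y Z := hom_ext fun x => pentagon_aux W X Y Z x
  triangle X Y := hom_ext fun x => triangle_aux X Y x

instance : MonoidalPreadditive (RepCat k H) where
  whiskerLeft_zero {X Y Z} := hom_ext fun x => incl_injective _ _ (by
    rw [incl_whiskerLeft]; simp)
  zero_whiskerRight {X Y Z} := hom_ext fun x => incl_injective _ _ (by
    rw [incl_whiskerRight]; simp)
  whiskerLeft_add f g := hom_ext fun x => incl_injective _ _ (by
    rw [lin_add, LinearMap.add_apply, map_add]
    simp only [incl_whiskerLeft, lin_add, LinearMap.lTensor_add, LinearMap.add_apply])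
  add_whiskerRight f g := hom_ext fun x => incl_injective _ _ (by
    rw [lin_add, LinearMap.add_apply, map_add]
    simp only [incl_whiskerRight, lin_add, LinearMap.rTensor_add, LinearMap.add_apply])

instance : MonoidalLinear k (RepCat k H) where
  whiskerLeft_smul X _ _ c f := hom_ext fun x => incl_injective _ _ (by
    rw [lin_smul, LinearMap.smul_apply, map_smul]
    simp only [incl_whiskerLeft, lin_smul, LinearMap.lTensor_smul, LinearMap.smul_apply])
  smul_whiskerRight c _ _ f X := hom_ext fun x => incl_injective _ _ (by
    rw [lin_smul, LinearMap.smul_apply, map_smul]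
    simp only [incl_whiskerRight, lin_smul, LinearMap.rTensor_smul, LinearMap.smul_apply])

end RepCat
end QG

namespace QG
open Coalgebra QuantumGroupoid

/-- The flip `x ⊗ y ↦ y ⊗ x` on `H ⊗ H`, an algebra automorphism; for `t ∈ H ⊗ H` this is `t₂₁`. -/
def flip (k : Type u) {H : Type u} [Field k] [Ring H] [Algebra k H] :
    H ⊗[k] H →ₐ[k] H ⊗[k] H := (Algebra.TensorProduct.comm k H H).toAlgHom

/-- A quasitriangular quantum groupoid. -/
class Quasitriangular (k H : Type u) [Field k] [Ring H] [Algebra k H]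
    extends QuantumGroupoid k H where
  /-- The `R`-matrix. -/
  R : H ⊗[k] H
  /-- `R ∈ Δᵒᵖ(1)(H ⊗ H)Δ(1)`. -/
  R_mem : ∃ x : H ⊗[k] H, R = flip k (Δ k 1) * x * Δ k 1
  /-- `Δᵒᵖ(h) R = R Δ(h)`. -/
  R_comul : ∀ h : H, flip k (Δ k h) * R = R * Δ k h
  /-- `(id ⊗ Δ) R = R₁₃ R₁₂`. -/
  idΔ_R : idΔ k R = j13 k R * j12 k R
  /-- `(Δ ⊗ id) R = R₁₃ R₂₃`. -/
  Δid_R : Δid k R = j13 k R * j23 k R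
  /-- There is `R̄ ∈ Δ(1)(H ⊗ H)Δᵒᵖ(1)` with `R R̄ = Δᵒᵖ(1)` and `R̄ R = Δ(1)`. -/
  exists_Rbar : ∃ Rbar : H ⊗[k] H, (∃ x : H ⊗[k] H, Rbar = Δ k 1 * x * flip k (Δ k 1)) ∧
    R * Rbar = flip k (Δ k 1) ∧ Rbar * R = Δ k 1

/-- A ribbon quantum groupoid: a quasitriangular quantum groupoid with an invertible central
element `ν` such that `Δ(ν) = R₂₁ R (ν ⊗ ν)` and `S(ν) = ν`. -/
class RibbonQuantumGroupoid (k H : Type u) [Field k] [Ring H] [Algebra k H]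
    extends Quasitriangular k H where
  ν : H
  isUnit_ν : IsUnit ν
  ν_central : ν ∈ Set.center H
  comul_ν : Δ k ν = flip k R * R * (ν ⊗ₜ[k] ν)
  antipode_ν : S k ν = ν

open Quasitriangular RibbonQuantumGroupoid

section
variable {k H : Type u} [Field k] [Ring H] [Algebra k H]

@[simp] lemma flip_tmul (x y : H) : flip k (x ⊗ₜ[k] y) = y ⊗ₜ x := rfl
@[simp] lemma flip_flip (t : H ⊗[k] H) : flip k (flip k t) = t :=
  (Algebra.TensorProduct.comm k H H).left_inv t

variable [Quasitriangular k H]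

lemma R_mul_one : (R : H ⊗[k] H) * Δ k 1 = R := by
  obtain ⟨x, hx⟩ := R_mem (k := k) (H := H)
  rw [hx, mul_assoc, one_comul]

lemma one_mul_R : flip k (Δ k 1) * (R : H ⊗[k] H) = R := by
  rw [R_comul, R_mul_one]

variable (k H) in
/-- The quasi-inverse `R̄` of the `R`-matrix (it is unique). -/
def Rbar : H ⊗[k] H := (exists_Rbar (k := k) (H := H)).choose

lemma R_mul_Rbar : R * Rbar k H = flip k (Δ k 1) :=
  (exists_Rbar (k := k) (H := H)).choose_spec.2.1
lemma Rbar_mul_R : Rbar k H * R = Δ k 1 :=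
  (exists_Rbar (k := k) (H := H)).choose_spec.2.2

lemma one_mul_Rbar : Δ k 1 * Rbar k H = Rbar k H := by
  obtain ⟨x, hx⟩ := (exists_Rbar (k := k) (H := H)).choose_spec.1
  rw [Rbar, hx, ← mul_assoc, ← mul_assoc, one_comul]

end

namespace RepCat
open MonoidalCategory

section Braiding
variable {k H : Type u} [Field k] [Ring H] [Algebra k H]

lemma comm_act (X Y : RepCat k H) (t : H ⊗[k] H) (x : X.V ⊗[k] Y.V) :
    TensorProduct.comm k X.V Y.V (act X Y t x) =
      act Y X (flip k t) (TensorProduct.comm k X.V Y.V x) := by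
  induction t with
  | zero => simp
  | add a b ha hb => simp only [map_add, LinearMap.add_apply, ha, hb]
  | tmul a b =>
    induction x with
    | zero => simp
    | add a b ha hb => simp only [map_add, ha, hb]
    | tmul v w => simp

variable [Quasitriangular k H]

/-- `x ↦ R⁽²⁾ x⁽²⁾ ⊗ R⁽¹⁾ x⁽¹⁾` -/
def braidLin (X Y : RepCat k H) : X.V ⊗[k] Y.V →ₗ[k] Y.V ⊗[k] X.V :=
  (TensorProduct.comm k X.V Y.V).toLinearMap ∘ₗ act X Y R

lemma act_braidLin (X Y : RepCat k H) (h : H) (x) :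
    act Y X (Δ k h) (braidLin X Y x) = braidLin X Y (act X Y (Δ k h) x) := by
  simp only [braidLin, LinearMap.comp_apply, LinearEquiv.coe_coe]
  rw [← Module.End.mul_apply, ← map_mul, ← R_comul, map_mul, Module.End.mul_apply, comm_act,
    comm_act, flip_flip, comm_act]

/-- The braiding `c(x) = R⁽²⁾ x⁽²⁾ ⊗ R⁽¹⁾ x⁽¹⁾`. -/
def braid (X Y : RepCat k H) : X ⊗ Y ≅ Y ⊗ X where
  hom := ofLin ((braidLin X Y).restrict (p := carrier X Y) (q := carrier Y X)
    (fun x hx => by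
      change act Y X (Δ k 1) _ = _
      rw [act_braidLin, show act X Y (Δ k 1) x = x from hx]))
    (fun h x => incl_injective Y X (act_braidLin X Y h (incl X Y x)).symm)
  inv := ofLin ((act X Y (Rbar k H) ∘ₗ (TensorProduct.comm k Y.V X.V).toLinearMap).restrict
      (p := carrier Y X) (q := carrier X Y) (fun x _ => by
      change act X Y (Δ k 1) _ = _
      rw [LinearMap.comp_apply, ← Module.End.mul_apply, ← map_mul, one_mul_Rbar]))
    (fun h x => incl_injective X Y (by
      change act X Y (Rbar k H) (TensorProduct.comm k Y.V X.V (act Y X (Δ k h) (incl Y X x))) =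
        act X Y (Δ k h) (act X Y (Rbar k H) (TensorProduct.comm k Y.V X.V (incl Y X x)))
      have hx := act_incl Y X x
      have h1 : Rbar k H * flip k (Δ k h) * flip k (Δ k 1) = Δ k h * Rbar k H := by
        rw [← R_mul_Rbar, ← mul_assoc, mul_assoc (Rbar k H), R_comul, ← mul_assoc, Rbar_mul_R,
          one_comul]
      rw [← hx, comm_act, comm_act]
      simp only [← Module.End.mul_apply, ← map_mul]
      have h2 : Δ k h * Rbar k H * flip k (Δ k 1) = Δ k h * Rbar k H := by
        rw [← h1, mul_assoc, ← map_mul, one_comul]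
      rw [map_mul (flip k), ← mul_assoc, h1, ← mul_assoc, h2]))
  hom_inv_id := hom_ext fun x => incl_injective X Y (by
    change act X Y (Rbar k H) (TensorProduct.comm k Y.V X.V (TensorProduct.comm k X.V Y.V
      (act X Y R (incl X Y x)))) = incl X Y x
    rw [TensorProduct.comm_comm, ← Module.End.mul_apply, ← map_mul, Rbar_mul_R, act_incl])
  inv_hom_id := hom_ext fun x => incl_injective Y X (by
    change TensorProduct.comm k X.V Y.V (act X Y R (act X Y (Rbar k H)
      (TensorProduct.comm k Y.V X.V (incl Y X x)))) = incl Y X x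
    rw [← Module.End.mul_apply, ← map_mul, R_mul_Rbar, comm_act, flip_flip,
      TensorProduct.comm_comm, act_incl])

lemma incl_braid (X Y : RepCat k H) (x) :
    incl Y X (lin (braid X Y).hom x) = braidLin X Y (incl X Y x) := rfl

lemma hexagon_forward_key (X Y Z : RepCat k H) (s t : H ⊗[k] H) (y : (X.V ⊗[k] Y.V) ⊗[k] Z.V) :
    TensorProduct.assoc k Y.V Z.V X.V
      (TensorProduct.comm k X.V (Y.V ⊗[k] Z.V)
        (act3 X Y Z (j13 k t * j12 k s) (TensorProduct.assoc k X.V Y.V Z.V y))) =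
      ((TensorProduct.comm k X.V Z.V).toLinearMap ∘ₗ act X Z t).lTensor Y.V
      (TensorProduct.assoc k Y.V X.V Z.V
      (((TensorProduct.comm k X.V Y.V).toLinearMap ∘ₗ act X Y s).rTensor Z.V y)) := by
  induction s with
  | zero => simp
  | add a b ha hb =>
    simp only [map_add, mul_add, LinearMap.add_apply, LinearMap.comp_add,
      LinearMap.rTensor_add, ha, hb]
  | tmul a b =>
    induction t with
    | zero => simp
    | add a b ha hb =>
      simp only [map_add, add_mul, LinearMap.add_apply, LinearMap.comp_add,
        LinearMap.lTensor_add, ha, hb]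
    | tmul c d =>
      induction y with
      | zero => simp
      | add a b ha hb => simp only [map_add, ha, hb]
      | tmul p z =>
        induction p with
        | zero => simp
        | add a b ha hb => simp only [map_add, TensorProduct.add_tmul, ha, hb]
        | tmul x y => simp

lemma hexagon_forward_aux (X Y Z : RepCat k H) (x) :
    lin ((α_ X Y Z).hom ≫ (braid X (Y ⊗ Z)).hom ≫ (α_ Y Z X).hom) x =
      lin (((braid X Y).hom ▷ Z) ≫ (α_ Y X Z).hom ≫ (Y ◁ (braid X Z).hom)) x := by
  apply inclR_injective Y Z X
  simp only [lin_comp, LinearMap.comp_apply]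
  erw [inclR_assoc]
  have l1 : ∀ a, inclL Y Z X (lin (braid X (Y ⊗ Z)).hom a) =
      TensorProduct.assoc k Y.V Z.V X.V (TensorProduct.comm k X.V (Y.V ⊗[k] Z.V)
        (act3 X Y Z (idΔ k R) (inclR X Y Z a))) := by
    intro a
    change TensorProduct.assoc k Y.V Z.V X.V ((incl Y Z).rTensor X.V
      (TensorProduct.comm k X.V (tensor Y Z).V (act X (tensor Y Z) R (incl X (tensor Y Z) a))))
       = _
    rw [inclR, LinearMap.comp_apply, ← act_lTensor_incl]
    generalize act X (tensor Y Z) R (incl X (tensor Y Z) a) = q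
    induction q with
    | zero => simp
    | add a b ha hb => simp only [map_add, ha, hb]
    | tmul z w => rfl
  have l2 : ∀ b, inclR Y Z X (lin (Y ◁ (braid X Z).hom) b) =
      (braidLin X Z).lTensor Y.V (inclR Y X Z b) := by
    intro b
    change (incl Z X).lTensor Y.V ((lin (braid X Z).hom).lTensor Y.V (incl Y (tensor X Z) b)) = _
    rw [inclR, LinearMap.comp_apply]
    generalize incl Y (tensor X Z) b = q
    induction q with
    | zero => simp
    | add a b ha hb => simp only [map_add, ha, hb]
    | tmul z w => rfl
  have l3 : inclL Y X Z (lin ((braid X Y).hom ▷ Z) x) =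
      TensorProduct.assoc k Y.V X.V Z.V ((braidLin X Y).rTensor Z.V
        ((incl X Y).rTensor Z.V (incl (tensor X Y) Z x))) := by
    change TensorProduct.assoc k Y.V X.V Z.V ((incl Y X).rTensor Z.V
      ((lin (braid X Y).hom).rTensor Z.V (incl (tensor X Y) Z x))) = _
    generalize incl (tensor X Y) Z x = q
    induction q with
    | zero => simp
    | add a b ha hb => simp only [map_add, ha, hb]
    | tmul z w => rfl
  erw [l1, inclR_assoc, l2]
  rw [inclR_assoc, l3]
  simp only [inclL, LinearMap.comp_apply, LinearEquiv.coe_coe]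
  generalize (incl X Y).rTensor Z.V (incl (tensor X Y) Z x) = y
  rw [idΔ_R, braidLin, braidLin]
  exact hexagon_forward_key X Y Z R R y

lemma hexagon_reverse_key (X Y Z : RepCat k H) (s t : H ⊗[k] H) (y : X.V ⊗[k] (Y.V ⊗[k] Z.V)) :
    TensorProduct.comm k (X.V ⊗[k] Y.V) Z.V
      ((TensorProduct.assoc k X.V Y.V Z.V).symm (act3 X Y Z (j13 k t * j23 k s) y)) =
      TensorProduct.assoc k Z.V X.V Y.V
      (((TensorProduct.comm k X.V Z.V).toLinearMap ∘ₗ act X Z t).rTensor Y.V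
        ((TensorProduct.assoc k X.V Z.V Y.V).symm
      (((TensorProduct.comm k Y.V Z.V).toLinearMap ∘ₗ act Y Z s).lTensor X.V y))) := by
  induction s with
  | zero => simp
  | add a b ha hb =>
    simp only [map_add, mul_add, LinearMap.add_apply, LinearMap.comp_add,
      LinearMap.lTensor_add, ha, hb]
  | tmul a b =>
    induction t with
    | zero => simp
    | add a b ha hb =>
      simp only [map_add, add_mul, LinearMap.add_apply, LinearMap.comp_add,
        LinearMap.rTensor_add, ha, hb]
    | tmul c d =>
      induction y with
      | zero => simp
      | add a b ha hb => simp only [map_add, ha, hb]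
      | tmul p z =>
        induction z with
        | zero => simp
        | add a b ha hb => simp only [map_add, TensorProduct.tmul_add, ha, hb]
        | tmul x y => simp

lemma hexagon_reverse_aux (X Y Z : RepCat k H) (x) :
    lin ((α_ X Y Z).inv ≫ (braid (X ⊗ Y) Z).hom ≫ (α_ Z X Y).inv) x =
      lin ((X ◁ (braid Y Z).hom) ≫ (α_ X Z Y).inv ≫ ((braid X Z).hom ▷ Y)) x := by
  apply inclL_injective Z X Y
  simp only [lin_comp, LinearMap.comp_apply]
  erw [inclL_assoc_inv]
  have l1 : ∀ a, inclR Z X Y (lin (braid (X ⊗ Y) Z).hom a) =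
      TensorProduct.comm k (X.V ⊗[k] Y.V) Z.V ((TensorProduct.assoc k X.V Y.V Z.V).symm
        (act3 X Y Z (Δid k R) (inclL X Y Z a))) := by
    intro a
    change (incl X Y).lTensor Z.V
      (TensorProduct.comm k (tensor X Y).V Z.V (act (tensor X Y) Z R (incl (tensor X Y) Z a)))
       = _
    rw [inclL, LinearMap.comp_apply, LinearMap.comp_apply, LinearEquiv.coe_coe,
      ← act_rTensor_incl, LinearEquiv.symm_apply_apply]
    generalize act (tensor X Y) Z R (incl (tensor X Y) Z a) = q
    induction q with
    | zero => simp
    | add a b ha hb => simp only [map_add, ha, hb]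
    | tmul z w => rfl
  have l2 : ∀ b, inclL Z X Y (lin ((braid X Z).hom ▷ Y) b) =
      TensorProduct.assoc k Z.V X.V Y.V ((braidLin X Z).rTensor Y.V
        ((TensorProduct.assoc k X.V Z.V Y.V).symm (inclL X Z Y b))) := by
    intro b
    change TensorProduct.assoc k Z.V X.V Y.V ((incl Z X).rTensor Y.V
      ((lin (braid X Z).hom).rTensor Y.V (incl (tensor X Z) Y b))) = _
    rw [inclL, LinearMap.comp_apply, LinearMap.comp_apply, LinearEquiv.coe_coe,
      LinearEquiv.symm_apply_apply]
    generalize incl (tensor X Z) Y b = q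
    induction q with
    | zero => simp
    | add a b ha hb => simp only [map_add, ha, hb]
    | tmul z w => rfl
  have l3 : inclR X Z Y (lin (X ◁ (braid Y Z).hom) x) =
      (braidLin Y Z).lTensor X.V (inclR X Y Z x) := by
    change (incl Z Y).lTensor X.V
      ((lin (braid Y Z).hom).lTensor X.V (incl X (tensor Y Z) x)) = _
    rw [inclR, LinearMap.comp_apply]
    generalize incl X (tensor Y Z) x = q
    induction q with
    | zero => simp
    | add a b ha hb => simp only [map_add, ha, hb]
    | tmul z w => rfl
  erw [l1, inclL_assoc_inv, l2]
  rw [inclL_assoc_inv, l3]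
  generalize inclR X Y Z x = y
  rw [Δid_R, braidLin, braidLin]
  exact hexagon_reverse_key X Y Z R R y

lemma braidLin_map {X Y X' Y' : RepCat k H} (f : X ⟶ X') (g : Y ⟶ Y') (x : X.V ⊗[k] Y.V) :
    braidLin X' Y' (TensorProduct.map (lin f) (lin g) x) =
      TensorProduct.map (lin g) (lin f) (braidLin X Y x) := by
  simp only [braidLin, LinearMap.comp_apply, LinearEquiv.coe_coe, ← act_map]
  generalize act X Y R x = q
  induction q with
  | zero => simp
  | add a b ha hb => simp only [map_add, ha, hb]
  | tmul z w => rfl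

instance : BraidedCategory (RepCat k H) where
  braiding := braid
  braiding_naturality_right X _ _ f := hom_ext fun x => incl_injective _ _
    (braidLin_map (𝟙 X) f (incl _ _ x))
  braiding_naturality_left f Z := hom_ext fun x => incl_injective _ _
    (braidLin_map f (𝟙 Z) (incl _ _ x))
  hexagon_forward X Y Z := hom_ext fun x => hexagon_forward_aux X Y Z x
  hexagon_reverse X Y Z := hom_ext fun x => hexagon_reverse_aux X Y Z x

end Braiding
end RepCat
end QG

namespace QG
open Coalgebra QuantumGroupoid Quasitriangular RibbonQuantumGroupoid

section
variable (k : Type u) {H : Type u} [Field k] [Ring H] [Algebra k H] [QuantumGroupoid k H]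

/-- `ε_s(1₍₁₎ h) ⊗ 1₍₂₎ = 1₍₁₎ ⊗ ε_t(h 1₍₂₎)` -/
lemma epsS_id (h : H) : (epsS k).rTensor H (Δ k 1 * (h ⊗ₜ 1)) =
    (epsT k ∘ₗ LinearMap.mulLeft k h).lTensor H (Δ k 1) := by
  have hS : epsS k (H := H) = (TensorProduct.rid k H).toLinearMap ∘ₗ
      (counit (R := k)).lTensor H ∘ₗ LinearMap.mulRight k (Δ k 1) ∘ₗ
      TensorProduct.mk k H H 1 := by
    ext x; simp [epsS_apply]
  have hT : epsT k (H := H) = (TensorProduct.lid k H).toLinearMap ∘ₗ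
      (counit (R := k)).rTensor H ∘ₗ LinearMap.mulLeft k (Δ k 1) ∘ₗ
      (TensorProduct.mk k H H).flip 1 := by
    ext x; simp [epsT_apply]
  rw [hS, hT]
  have key : ∀ s t : H ⊗[k] H, ((TensorProduct.rid k H).toLinearMap ∘ₗ
      (counit (R := k)).lTensor H ∘ₗ LinearMap.mulRight k t ∘ₗ
      TensorProduct.mk k H H 1).rTensor H (s * (h ⊗ₜ 1)) =
      (((TensorProduct.lid k H).toLinearMap ∘ₗ
      (counit (R := k)).rTensor H ∘ₗ LinearMap.mulLeft k s ∘ₗ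
      (TensorProduct.mk k H H).flip 1) ∘ₗ LinearMap.mulLeft k h).lTensor H t := by
    intro s t
    induction s with
    | zero => simp
    | add a b ha hb =>
      have : LinearMap.mulLeft k (a + b) = LinearMap.mulLeft k a + LinearMap.mulLeft k b := by
        ext; simp [add_mul]
      simp only [map_add, add_mul, ha, hb, this, LinearMap.add_comp, LinearMap.comp_add,
        LinearMap.lTensor_add, LinearMap.add_apply]
    | tmul a b =>
      induction t with
      | zero => simp
      | add c d ha hb =>
        have : LinearMap.mulRight k (c + d) =
            LinearMap.mulRight k c + LinearMap.mulRight k d := by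
          ext; simp [mul_add]
        simp only [map_add, ha, hb, this, LinearMap.add_comp, LinearMap.comp_add,
          LinearMap.rTensor_add, LinearMap.add_apply]
      | tmul c d => simp [mul_assoc, TensorProduct.smul_tmul]
  exact key _ _

/-- `a ⊗ b ⊗ c ↦ f(a) b ⊗ c` -/
def mulFst (f : H →ₗ[k] H) : H ⊗[k] (H ⊗[k] H) →ₗ[k] H ⊗[k] H :=
  (LinearMap.mul' k H ∘ₗ f.rTensor H).rTensor H ∘ₗ (TensorProduct.assoc k H H H).symm.toLinearMap

@[simp] lemma mulFst_tmul (f : H →ₗ[k] H) (a b c : H) :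
    mulFst k f (a ⊗ₜ (b ⊗ₜ c)) = (f a * b) ⊗ₜ c := rfl

lemma mulFst_Δid (t : H ⊗[k] H) : mulFst k (S k) (Δid k t) = (epsS k).rTensor H t := by
  induction t with
  | zero => simp
  | add a b ha hb => simp only [map_add, ha, hb]
  | tmul a b => simp [mulFst, Δid_tmul, epsS]

/-- `S(h₍₁₎) 1₍₁₎ h₍₂₎ ⊗ 1₍₂₎ = 1₍₁₎ ⊗ ε_t(h 1₍₂₎)` -/
lemma antipode_contract (h : H) :
    mulFst k (S k) (j23 k (Δ k 1) * j12 k (Δ k h)) =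
      (epsT k ∘ₗ LinearMap.mulLeft k h).lTensor H (Δ k 1) := by
  rw [B3, mulFst_Δid, epsS_id]

lemma mulFst_j12_j23 (f : H →ₗ[k] H) (s t : H ⊗[k] H) :
    mulFst k f (j12 k s * j23 k t) = (LinearMap.mul' k H (f.rTensor H s) ⊗ₜ 1) * t := by
  induction s with
  | zero => simp
  | add a b ha hb => simp only [map_add, add_mul, TensorProduct.add_tmul, ha, hb]
  | tmul a b =>
    induction t with
    | zero => simp
    | add c d ha hb => simp only [map_add, mul_add, ha, hb]
    | tmul c d => simp [mul_assoc]

/-- `ε_t(1₍₁₎) 1'₍₁₎ 1₍₂₎ ⊗ 1'₍₂₎ = Δ(1)` -/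
lemma snake_one : mulFst k (epsT k) (j23 k (Δ k 1) * j12 k (Δ k 1)) = Δ k (1 : H) := by
  rw [j23_mul_j12, ← j12_mul_j23, mulFst_j12_j23]
  have h1 := epsT_mul_contract k 1 (1 : H)
  have : LinearMap.mulRight k (1 : H) = LinearMap.id := by ext; simp
  rw [this, LinearMap.comp_id, LinearMap.comp_id] at h1
  change LinearMap.mul' k H ((epsT k).rTensor H (Δ k 1)) =
    TensorProduct.lid k H ((counit (R := k)).rTensor H (comul 1)) at h1
  rw [h1, Coalgebra.rTensor_counit_comul, TensorProduct.lid_tmul, one_smul,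
    ← Algebra.TensorProduct.one_def, one_mul]

/-- `S(1₍₁₎) 1'₍₁₎ 1₍₂₎ ⊗ 1'₍₂₎ = Δ(1)` -/
lemma snake_two : mulFst k (S k) (j23 k (Δ k 1) * j12 k (Δ k 1)) = Δ k (1 : H) := by
  rw [j23_mul_j12, ← j12_mul_j23, mulFst_j12_j23]
  have : LinearMap.mul' k H ((S k).rTensor H (Δ k 1)) = epsS k 1 := rfl
  rw [this, epsS_one, ← Algebra.TensorProduct.one_def, one_mul]

/-- `ε_t(1₍₁₎) ⊗ 1₍₂₎ = S(1₍₁₎) ⊗ 1₍₂₎` -/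
lemma epsT_one_left : (epsT k).rTensor H (Δ k 1) = (S k).rTensor H (Δ k (1 : H)) := by
  let m : H ⊗[k] (H ⊗[k] H) →ₗ[k] H ⊗[k] H :=
    (LinearMap.mul' k H ∘ₗ (S k).lTensor H).rTensor H ∘ₗ
      (TensorProduct.assoc k H H H).symm.toLinearMap
  have h1 : ∀ t : H ⊗[k] H, m (Δid k t) = (epsT k).rTensor H t := by
    intro t
    induction t with
    | zero => simp
    | add a b ha hb => simp only [map_add, ha, hb]
    | tmul a b => simp [m, Δid_tmul, epsT]
  have h2 : ∀ s t : H ⊗[k] H, m (j23 k s * j12 k t) =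
      (LinearMap.mul' k H ((S k).lTensor H t) ⊗ₜ 1) * (S k).rTensor H s := by
    intro s t
    induction s with
    | zero => simp
    | add a b ha hb => simp only [map_add, add_mul, mul_add, ha, hb]
    | tmul a b =>
      induction t with
      | zero => simp
      | add c d ha hb => simp only [map_add, mul_add, add_mul, TensorProduct.add_tmul, ha, hb]
      | tmul c d => simp [m, S, antipode_mul, mul_assoc]
  have : LinearMap.mul' k H ((S k).lTensor H (Δ k 1)) = epsT k 1 := rfl
  rw [← h1, Δid_comul, ← j23_mul_j12, h2, this, epsT_one, ← Algebra.TensorProduct.one_def,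
    one_mul]

/-- `S(1₍₂₎) ⊗ ε_t(1₍₁₎) = Δ(1)` -/
lemma snake_two' : TensorProduct.comm k H H ((S k).lTensor H ((epsT k).rTensor H (Δ k 1))) =
    Δ k (1 : H) := by
  rw [epsT_one_left]
  have h1 := comul_antipode (k := k) (1 : H)
  rw [antipode_one] at h1
  conv_rhs => rw [Δ, h1]
  congr 1
  generalize (comul (1 : H) : H ⊗[k] H) = t
  induction t with
  | zero => simp
  | add c d ha hb => simp only [map_add, ha, hb]
  | tmul c d => simp

end

namespace RepCat
open MonoidalCategory
variable {k H : Type u} [Field k] [Ring H] [Algebra k H] [QuantumGroupoid k H]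

/-- The dual representation `(h · φ)(v) = φ(S(h) · v)`. -/
def dual (X : RepCat k H) : RepCat k H where
  V := Module.Dual k X.V
  ρ := AlgHom.ofLinearMap
    { toFun := fun h => Module.Dual.transpose (R := k) (X.ρ (S k h))
      map_add' := fun a b => by ext; simp
      map_smul' := fun c a => by ext; simp }
    (by ext; simp [S, antipode_one, Module.Dual.transpose_apply])
    (fun a b => by ext; simp [S, antipode_mul, Module.Dual.transpose_apply])

/-- The elements of the dual representation are the linear forms on `X`. -/
def form (X : RepCat k H) : (dual X).V ≃ₗ[k] Module.Dual k X.V :=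
  LinearEquiv.refl k (Module.Dual k X.V)

@[simp] lemma form_ρ (X : RepCat k H) (h : H) (φ : (dual X).V) (v : X.V) :
    form X ((dual X).ρ h φ) v = form X φ (X.ρ (S k h) v) := rfl

/-- `φ ⊗ v ↦ φ(1₍₁₎ · v) 1₍₂₎`, as a map to `H`. -/
def evalH (X : RepCat k H) : (dual X).V ⊗[k] X.V →ₗ[k] H :=
  TensorProduct.lift (LinearMap.mk₂ k
    (fun φ v => TensorProduct.lid k H
      ((form X φ ∘ₗ LinearMap.applyₗ v ∘ₗ X.ρ.toLinearMap).rTensor H (Δ k 1)))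
    (fun a b v => by
      simp only [map_add, LinearMap.add_comp, LinearMap.rTensor_add, LinearMap.add_apply])
    (fun c a v => by
      simp only [map_smul, LinearMap.smul_comp, LinearMap.rTensor_smul, LinearMap.smul_apply])
    (fun φ v w => by
      simp only [map_add, LinearMap.add_comp, LinearMap.comp_add, LinearMap.rTensor_add,
        LinearMap.add_apply])
    (fun c φ v => by
      simp only [map_smul, LinearMap.smul_comp, LinearMap.comp_smul, LinearMap.rTensor_smul,
        LinearMap.smul_apply]))

lemma evalH_tmul (X : RepCat k H) (φ : (dual X).V) (v : X.V) :
    evalH X (φ ⊗ₜ[k] v) = TensorProduct.lid k H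
      ((form X φ ∘ₗ LinearMap.applyₗ v ∘ₗ X.ρ.toLinearMap).rTensor H (Δ k 1)) := rfl

lemma evalH_mem (X : RepCat k H) (x) : evalH X x ∈ Ht k H := by
  induction x with
  | zero => simp
  | add a b ha hb => rw [map_add]; exact Submodule.add_mem _ ha hb
  | tmul φ v =>
    rw [evalH_tmul, ← id_epsT_comul_one]
    generalize Δ k (1 : H) = t
    induction t with
    | zero => simp
    | add c d ha hb => simp only [map_add]; exact Submodule.add_mem _ ha hb
    | tmul c d =>
      simp only [LinearMap.lTensor_tmul, LinearMap.rTensor_tmul, TensorProduct.lid_tmul]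
      exact Submodule.smul_mem _ _ (epsT_mem k d)

/-- `φ ⊗ v ↦ φ(1₍₁₎ · v) 1₍₂₎`, as a map to `H_t`. -/
def evalT (X : RepCat k H) : (dual X).V ⊗[k] X.V →ₗ[k] (unit k H).V :=
  (evalH X).codRestrict (Ht k H) (evalH_mem X)

@[simp] lemma coeT_evalT (X : RepCat k H) (x) : coeT (evalT X x) = evalH X x := rfl

lemma evalH_act (X : RepCat k H) (h : H) (x) :
    evalH X (act (dual X) X (Δ k h) x) = epsT k (h * evalH X x) := by
  induction x with
  | zero => simp
  | add a b ha hb => simp only [map_add, mul_add, ha, hb]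
  | tmul φ v =>
    let P : H ⊗[k] H →ₗ[k] H := (TensorProduct.lid k H).toLinearMap ∘ₗ
      (form X φ ∘ₗ LinearMap.applyₗ v ∘ₗ X.ρ.toLinearMap).rTensor H
    have h1 := congrArg P (antipode_contract k h)
    have e1 : ∀ t : H ⊗[k] H, evalH X (act (dual X) X t (φ ⊗ₜ v)) =
        P (mulFst k (S k) (j23 k (Δ k 1) * j12 k t)) := by
      intro t
      induction t with
      | zero => simp
      | add c d ha hb => simp only [map_add, mul_add, LinearMap.add_apply, ha, hb]
      | tmul c d =>
        rw [act2_tmul, evalH_tmul]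
        generalize Δ k (1 : H) = s
        induction s with
        | zero => simp
        | add c d ha hb => simp only [map_add, add_mul, ha, hb]
        | tmul a b => simp [P]
    rw [e1, h1]
    rw [evalH_tmul]
    generalize Δ k (1 : H) = s
    induction s with
    | zero => simp
    | add c d ha hb => simp only [map_add, mul_add, ha, hb]
    | tmul a b => simp [P]

/-- The evaluation `d_X(φ ⊗ v) = φ(1₍₁₎ · v) 1₍₂₎`. -/
def ev (X : RepCat k H) : dual X ⊗ X ⟶ 𝟙_ (RepCat k H) :=
  ofLin (evalT X ∘ₗ incl (dual X) X) (fun h x => coeT_injective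
    (evalH_act X h (incl (dual X) X x)))

/-- The canonical element `∑ fᵢ ⊗ ξⁱ` of `X ⊗ X*`. -/
def coevElt (X : RepCat k H) : X.V ⊗[k] (dual X).V :=
  (form X).symm.toLinearMap.lTensor X.V (coevaluation k X.V 1)

/-- The identification `X ⊗ X* ≅ End_k(X)`. -/
def toEnd (X : RepCat k H) : X.V ⊗[k] (dual X).V →ₗ[k] Module.End k X.V :=
  dualTensorHom k X.V X.V ∘ₗ (TensorProduct.comm k X.V (Module.Dual k X.V)).toLinearMap ∘ₗ
    (form X).toLinearMap.lTensor X.V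

@[simp] lemma toEnd_tmul (X : RepCat k H) (v w : X.V) (φ : (dual X).V) :
    toEnd X (v ⊗ₜ[k] φ) w = form X φ w • v := rfl

lemma toEnd_injective (X : RepCat k H) : Function.Injective (toEnd X) := by
  have h1 := (dualTensorHomEquiv k X.V X.V).injective
  have h2 := (TensorProduct.comm k X.V (Module.Dual k X.V)).injective
  have h3 := Module.Flat.lTensor_preserves_injective_linearMap (M := X.V)
    (form X).toLinearMap (form X).injective
  exact (h1.comp h2).comp h3

lemma toEnd_coevElt (X : RepCat k H) : toEnd X (coevElt X) = 1 := by
  ext w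
  rw [coevElt, coevaluation_apply_one]
  simp only [map_sum, LinearMap.lTensor_tmul, LinearMap.sum_apply, toEnd_tmul]
  exact (Module.Basis.ofVectorSpace k X.V).sum_repr w

lemma toEnd_act (X : RepCat k H) (t : H ⊗[k] H) :
    toEnd X (act X (dual X) t (coevElt X)) =
      X.ρ (LinearMap.mul' k H ((S k).lTensor H t)) := by
  have key : ∀ (a b : H) (x : X.V ⊗[k] (dual X).V), toEnd X (act X (dual X) (a ⊗ₜ b) x) =
      X.ρ a * toEnd X x * X.ρ (S k b) := by
    intro a b x
    induction x with
    | zero => simp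
    | add c d ha hb => simp only [map_add, mul_add, add_mul, ha, hb]
    | tmul v φ =>
      ext w
      simp
  induction t with
  | zero => simp
  | add c d ha hb => simp only [map_add, LinearMap.add_apply, ha, hb]
  | tmul a b => rw [key, toEnd_coevElt]; simp

lemma toEnd_act_comul (X : RepCat k H) (h : H) :
    toEnd X (act X (dual X) (Δ k h) (coevElt X)) = X.ρ (epsT k h) := toEnd_act X _

/-- `h ↦ h · ∑ fᵢ ⊗ ξⁱ` -/
def coevLin (X : RepCat k H) : H →ₗ[k] X.V ⊗[k] (dual X).V :=
  LinearMap.applyₗ (coevElt X) ∘ₗ (act X (dual X)).toLinearMap ∘ₗ Δ k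

lemma coevLin_apply (X : RepCat k H) (h : H) :
    coevLin X h = act X (dual X) (Δ k h) (coevElt X) := rfl

lemma act_coevLin (X : RepCat k H) (h x : H) :
    act X (dual X) (Δ k h) (coevLin X x) = coevLin X (epsT k (h * x)) := by
  rw [coevLin_apply, coevLin_apply, ← Module.End.mul_apply, ← map_mul]
  apply toEnd_injective
  have : Δ k h * Δ k x = Δ k (h * x) := (comul_mul h x).symm
  rw [this, toEnd_act_comul, toEnd_act_comul, epsT_epsT]

/-- The coevaluation `b_X(z) = z · (∑ fᵢ ⊗ ξⁱ)`. -/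
def coev (X : RepCat k H) : 𝟙_ (RepCat k H) ⟶ X ⊗ dual X :=
  ofLin ((coevLin X ∘ₗ coeT).codRestrict (carrier X (dual X))
      (fun z => act_one_act X (dual X) (coeT z) (coevElt X)))
    (fun h z => incl_injective X (dual X) (act_coevLin X h (coeT z)).symm)

lemma incl_coev (X : RepCat k H) (z) : incl X (dual X) (lin (coev X) z) = coevLin X (coeT z) := rfl

lemma evalH_toEnd (X : RepCat k H) (P : X.V ⊗[k] (dual X).V) (x : X.V) :
    (evalH X).lTensor X.V (TensorProduct.assoc k X.V (dual X).V X.V (P ⊗ₜ x)) =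
      (toEnd X P ∘ₗ LinearMap.applyₗ x ∘ₗ X.ρ.toLinearMap).rTensor H (Δ k 1) := by
  induction P with
  | zero => simp
  | add c d ha hb =>
    simp only [map_add, TensorProduct.add_tmul, LinearMap.add_comp, LinearMap.rTensor_add,
      LinearMap.add_apply, ha, hb]
  | tmul v φ =>
    rw [TensorProduct.assoc_tmul, LinearMap.lTensor_tmul]
    rw [evalH_tmul]
    generalize Δ k (1 : H) = t
    induction t with
    | zero => simp
    | add c d ha hb => simp only [map_add, TensorProduct.tmul_add, ha, hb]
    | tmul a b =>
      simp [TensorProduct.smul_tmul]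

lemma zigzag_one (X : RepCat k H) (x : X.V) :
    (evalH X).lTensor X.V (TensorProduct.assoc k X.V (dual X).V X.V
      ((coevLin X ∘ₗ coeT).rTensor X.V (act (unit k H) X (Δ k 1) (oneT ⊗ₜ x)))) =
    (coeT (k := k) (H := H)).lTensor X.V (act X (unit k H) (Δ k 1) (x ⊗ₜ oneT)) := by
  let P : H ⊗[k] H →ₗ[k] X.V ⊗[k] H := (LinearMap.applyₗ x ∘ₗ X.ρ.toLinearMap).rTensor H
  have e1 : ∀ t : H ⊗[k] H, (evalH X).lTensor X.V (TensorProduct.assoc k X.V (dual X).V X.V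
      ((coevLin X ∘ₗ coeT).rTensor X.V (act (unit k H) X t (oneT ⊗ₜ x)))) =
      P (mulFst k (epsT k) (j23 k (Δ k 1) * j12 k t)) := by
    intro t
    induction t with
    | zero => simp
    | add c d ha hb => simp only [map_add, mul_add, LinearMap.add_apply, ha, hb]
    | tmul a b =>
      rw [act2_tmul, LinearMap.rTensor_tmul, evalH_toEnd, LinearMap.comp_apply, coevLin_apply,
        toEnd_act_comul]
      simp only [coeT_ρ, coeT_oneT, mul_one, epsT_epsT]
      generalize Δ k (1 : H) = s
      induction s with
      | zero => simp
      | add c d ha hb => simp only [map_add, add_mul, ha, hb]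
      | tmul c d => simp [P]
  have e2 : ∀ t : H ⊗[k] H, (coeT (k := k) (H := H)).lTensor X.V
      (act X (unit k H) t (x ⊗ₜ oneT)) = P ((epsT k).lTensor H t) := by
    intro t
    induction t with
    | zero => simp
    | add c d ha hb => simp only [map_add, LinearMap.add_apply, ha, hb]
    | tmul a b => simp [P]
  rw [e1, e2, snake_one, id_epsT_comul_one]

/-- Evaluation of the second factor. -/
def evalSnd (X : RepCat k H) (v : X.V) : H ⊗[k] (dual X).V →ₗ[k] H :=
  (TensorProduct.rid k H).toLinearMap ∘ₗ
    LinearMap.lTensor H (LinearMap.applyₗ v ∘ₗ (form X).toLinearMap)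

@[simp] lemma evalSnd_tmul (X : RepCat k H) (v : X.V) (h : H) (φ : (dual X).V) :
    evalSnd X v (h ⊗ₜ[k] φ) = form X φ v • h := rfl

lemma ext_evalSnd (X : RepCat k H) {x y : H ⊗[k] (dual X).V}
    (h : ∀ v, evalSnd X v x = evalSnd X v y) : x = y := by
  let f : H ⊗[k] (dual X).V →ₗ[k] X.V →ₗ[k] H := dualTensorHom k X.V H ∘ₗ
      (TensorProduct.comm k H (Module.Dual k X.V)).toLinearMap ∘ₗ (form X).toLinearMap.lTensor H
  have h1 : Function.Injective f :=
    ((dualTensorHomEquiv k X.V H).injective.comp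
      (TensorProduct.comm k H (Module.Dual k X.V)).injective).comp
      (Module.Flat.lTensor_preserves_injective_linearMap (M := H)
      (form X).toLinearMap (form X).injective)
  have h2 : ∀ (z : H ⊗[k] (dual X).V) (v : X.V), f z v = evalSnd X v z := by
    intro z v
    induction z with
    | zero => simp
    | add c d ha hb => simp only [map_add, LinearMap.add_apply, ha, hb]
    | tmul a b => rfl
  apply h1
  ext v
  rw [h2, h2, h]

lemma evalSnd_evalH (X : RepCat k H) (ψ : (dual X).V) (P : X.V ⊗[k] (dual X).V) (v : X.V) :
    evalSnd X v ((evalH X).rTensor (dual X).V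
      ((TensorProduct.assoc k (dual X).V X.V (dual X).V).symm (ψ ⊗ₜ[k] P))) =
      evalH X (ψ ⊗ₜ[k] toEnd X P v) := by
  induction P with
  | zero => simp
  | add c d ha hb =>
    rw [TensorProduct.tmul_add, map_add, map_add, map_add, ha, hb, map_add, LinearMap.add_apply,
      TensorProduct.tmul_add, map_add]
  | tmul w φ =>
    rw [TensorProduct.assoc_symm_tmul, LinearMap.rTensor_tmul, evalSnd_tmul, toEnd_tmul,
      TensorProduct.tmul_smul, map_smul]

lemma zigzag_two (X : RepCat k H) (φ : (dual X).V) :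
    (evalH X).rTensor (dual X).V ((TensorProduct.assoc k (dual X).V X.V (dual X).V).symm
      ((coevLin X ∘ₗ coeT).lTensor (dual X).V
        (act (dual X) (unit k H) (Δ k 1) (φ ⊗ₜ[k] oneT)))) =
    (coeT (k := k) (H := H)).rTensor (dual X).V
      (act (unit k H) (dual X) (Δ k 1) (oneT ⊗ₜ[k] φ)) := by
  apply ext_evalSnd
  intro v
  let P : H ⊗[k] H →ₗ[k] H := (TensorProduct.lid k H).toLinearMap ∘ₗ
    (form X φ ∘ₗ LinearMap.applyₗ v ∘ₗ X.ρ.toLinearMap).rTensor H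
  have e1 : ∀ t : H ⊗[k] H, evalSnd X v ((evalH X).rTensor (dual X).V
      ((TensorProduct.assoc k (dual X).V X.V (dual X).V).symm
      ((coevLin X ∘ₗ coeT).lTensor (dual X).V
        (act (dual X) (unit k H) t (φ ⊗ₜ[k] oneT))))) =
      P (mulFst k (S k) (j23 k (Δ k 1) * j12 k ((epsT k).lTensor H t))) := by
    intro t
    induction t with
    | zero => simp
    | add c d ha hb => simp only [map_add, mul_add, LinearMap.add_apply, ha, hb]
    | tmul a b =>
      rw [act2_tmul, LinearMap.lTensor_tmul, evalSnd_evalH, LinearMap.comp_apply, coevLin_apply,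
        toEnd_act_comul, evalH_tmul]
      simp only [coeT_ρ, coeT_oneT, mul_one, epsT_epsT]
      generalize Δ k (1 : H) = s
      induction s with
      | zero => simp
      | add c d ha hb => simp only [map_add, add_mul, ha, hb]
      | tmul c d => simp [P]
  have e2 : ∀ t : H ⊗[k] H, evalSnd X v ((coeT (k := k) (H := H)).rTensor (dual X).V
      (act (unit k H) (dual X) t (oneT ⊗ₜ[k] φ))) =
      P (TensorProduct.comm k H H ((S k).lTensor H ((epsT k).rTensor H t))) := by
    intro t
    induction t with
    | zero => simp
    | add c d ha hb => simp only [map_add, LinearMap.add_apply, ha, hb]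
    | tmul a b => simp [P]
  rw [e1, e2, snake_two', id_epsT_comul_one, snake_two]

instance (X : RepCat k H) : ExactPairing X (dual X) where
  coevaluation' := coev X
  evaluation' := ev X
  evaluation_coevaluation' := by
    rw [← Iso.inv_comp_eq]
    refine hom_ext fun x => incl_injective X (unit k H) ?_
    apply Module.Flat.lTensor_preserves_injective_linearMap (M := X.V) _
      (coeT_injective (k := k) (H := H))
    simp only [lin_comp, LinearMap.comp_apply]
    have l1 : ∀ c, (coeT (k := k) (H := H)).lTensor X.V (incl X (unit k H) (lin (X ◁ ev X) c)) =
        (evalH X).lTensor X.V (inclR X (dual X) X c) := by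
      intro c
      change coeT.lTensor X.V ((lin (ev X)).lTensor X.V (incl X (tensor (dual X) X) c)) = _
      rw [inclR, LinearMap.comp_apply]
      generalize incl X (tensor (dual X) X) c = q
      induction q with
      | zero => simp
      | add a b ha hb => simp only [map_add, ha, hb]
      | tmul z w => rfl
    have l2 : ∀ c, inclL X (dual X) X (lin (coev X ▷ X) c) =
        TensorProduct.assoc k X.V (dual X).V X.V
          ((coevLin X ∘ₗ coeT).rTensor X.V (incl (unit k H) X c)) := by
      intro c
      change TensorProduct.assoc k X.V (dual X).V X.V ((incl X (dual X)).rTensor X.V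
        ((lin (coev X)).rTensor X.V (incl (unit k H) X c))) = _
      generalize incl (unit k H) X c = q
      induction q with
      | zero => simp
      | add a b ha hb => simp only [map_add, ha, hb]
      | tmul z w => rfl
    erw [l1]
    rw [inclR_assoc]
    erw [l2]
    exact zigzag_one X x
  coevaluation_evaluation' := by
    rw [← Iso.inv_comp_eq]
    refine hom_ext fun x => incl_injective (unit k H) (dual X) ?_
    apply Module.Flat.rTensor_preserves_injective_linearMap (M := (dual X).V) _
      (coeT_injective (k := k) (H := H))
    simp only [lin_comp, LinearMap.comp_apply]
    have l1 : ∀ c, (coeT (k := k) (H := H)).rTensor (dual X).V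
        (incl (unit k H) (dual X) (lin (ev X ▷ dual X) c)) =
        (evalH X).rTensor (dual X).V ((TensorProduct.assoc k (dual X).V X.V (dual X).V).symm
          (inclL (dual X) X (dual X) c)) := by
      intro c
      change coeT.rTensor (dual X).V ((lin (ev X)).rTensor (dual X).V
        (incl (tensor (dual X) X) (dual X) c)) = _
      rw [inclL, LinearMap.comp_apply, LinearMap.comp_apply, LinearEquiv.coe_coe,
        LinearEquiv.symm_apply_apply]
      generalize incl (tensor (dual X) X) (dual X) c = q
      induction q with
      | zero => simp
      | add a b ha hb => simp only [map_add, ha, hb]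
      | tmul z w => rfl
    have l2 : ∀ c, inclR (dual X) X (dual X) (lin (dual X ◁ coev X) c) =
          ((coevLin X ∘ₗ coeT).lTensor (dual X).V (incl (dual X) (unit k H) c)) := by
      intro c
      change (incl X (dual X)).lTensor (dual X).V
        ((lin (coev X)).lTensor (dual X).V (incl (dual X) (unit k H) c)) = _
      generalize incl (dual X) (unit k H) c = q
      induction q with
      | zero => simp
      | add a b ha hb => simp only [map_add, ha, hb]
      | tmul z w => rfl
    erw [l1]
    rw [inclL_assoc_inv]
    erw [l2]
    exact zigzag_two X x

instance : RightRigidCategory (RepCat k H) where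
  rightDual X := { rightDual := dual X }

end RepCat
end QG

namespace QG

section General
open MonoidalCategory

universe v₁ u₁

/-- A ribbon category: a braided monoidal category in which each object `X` has a dual `Xᘁ`
(with `b_X : 𝟙 ⟶ X ⊗ Xᘁ` and `d_X : Xᘁ ⊗ X ⟶ 𝟙`), together with a twist `θ`, i.e. a natural
family of automorphisms with `θ_{X ⊗ Y} = c_{Y,X} c_{X,Y} (θ_X ⊗ θ_Y)`, compatible with duality:
`(θ_X ⊗ id) b_X = (id ⊗ θ_{Xᘁ}) b_X`. -/
class RibbonCategory (C : Type u₁) [Category.{v₁} C] [MonoidalCategory C] [BraidedCategory C]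
    [RightRigidCategory C] where
  twist : ∀ X : C, X ≅ X
  twist_naturality : ∀ {X Y : C} (f : X ⟶ Y), f ≫ (twist Y).hom = (twist X).hom ≫ f
  twist_tensor : ∀ X Y : C, (twist (X ⊗ Y)).hom =
    ((twist X).hom ⊗ₘ (twist Y).hom) ≫ (β_ X Y).hom ≫ (β_ Y X).hom
  twist_dual : ∀ X : C, η_ X (Xᘁ) ≫ (twist X).hom ▷ Xᘁ = η_ X (Xᘁ) ≫ X ◁ (twist (Xᘁ)).hom

section
variable {C : Type u₁} [Category.{v₁} C] [MonoidalCategory C] [BraidedCategory C]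
  [RightRigidCategory C] [RibbonCategory C]

/-- The quantum trace `tr_q(f) = d_X c_{X,Xᘁ} (θ_X f ⊗ id) b_X`, an endomorphism of the unit
object. -/
def qtrace {X : C} (f : X ⟶ X) : 𝟙_ C ⟶ 𝟙_ C :=
  η_ X (Xᘁ) ≫ (f ≫ (RibbonCategory.twist X).hom) ▷ Xᘁ ≫ (β_ X (Xᘁ)).hom ≫ ε_ X (Xᘁ)

end

section
variable {C : Type u₁} [Category.{v₁} C] [Preadditive C]

/-- The family `V` dominates `X`: `id_X = ∑ f_r g_r` is a finite sum of morphisms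
that factor through members of the family. -/
def Dominates {I : Type} (V : I → C) (X : C) : Prop :=
  ∃ (n : ℕ) (i : Fin n → I) (f : ∀ r, V (i r) ⟶ X) (g : ∀ r, X ⟶ V (i r)),
    𝟙 X = ∑ r, g r ≫ f r

end

variable (k : Type*) [Field k] {C : Type u₁} [Category.{v₁} C] [Preadditive C] [Linear k C]

/-- `X` is simple in the sense that `k → End(X)`, `c ↦ c · id`, is a bijection. -/
def IsSimpleObj (X : C) : Prop := ∀ f : X ⟶ X, ∃! c : k, f = c • 𝟙 X

/-- The axioms of a modular category for a finite family `V` of objects of the ribbon `k`-linear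
category `C` (in which `∘` and `⊗` are `k`-bilinear). -/
structure IsModularFamily [MonoidalCategory C] [MonoidalPreadditive C] [MonoidalLinear k C]
    [BraidedCategory C] [RightRigidCategory C] [RibbonCategory C]
    {I : Type} [Fintype I] [DecidableEq I] (V : I → C) : Prop where
  simple : ∀ i, IsSimpleObj k (V i)
  exists_unit : ∃ i, V i = 𝟙_ C
  exists_dual : ∀ i, ∃ j, Nonempty (V j ≅ (V i)ᘁ)
  dominates : ∀ X : C, Dominates V X
  /-- the `S`-matrix `S_{ij} = tr_q(c_{V_i,V_j} c_{V_j,V_i})` is invertible over `k` -/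
  sMatrix : ∃ s : Matrix I I k,
    (∀ i j, qtrace ((β_ (V j) (V i)).hom ≫ (β_ (V i) (V j)).hom) = s i j • 𝟙 (𝟙_ C)) ∧ IsUnit s

variable (C) in
/-- The ribbon `k`-linear category `C` is modular: it has a finite family of simple objects
satisfying the axioms of a modular category. -/
def IsModularCategory [MonoidalCategory C] [MonoidalPreadditive C] [MonoidalLinear k C]
    [BraidedCategory C] [RightRigidCategory C] [RibbonCategory C] : Prop :=
  ∃ (I : Type) (_ : Fintype I) (_ : DecidableEq I) (V : I → C), IsModularFamily k V

end General

open Coalgebra QuantumGroupoid Quasitriangular RibbonQuantumGroupoid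

namespace RepCat
open MonoidalCategory
variable {k H : Type u} [Field k] [Ring H] [Algebra k H] [RibbonQuantumGroupoid k H]

/-- The twist `θ_X(v) = ν · v`. -/
def twistIso (X : RepCat k H) : X ≅ X where
  hom := ofLin (X.ρ (ν k)) (fun h x => by
    rw [← Module.End.mul_apply, ← Module.End.mul_apply, ← map_mul, ← map_mul,
      (ν_central (k := k) (H := H)).comm h])
  inv := ofLin (X.ρ ↑(isUnit_ν (k := k) (H := H)).unit⁻¹) (fun h x => by
    rw [← Module.End.mul_apply, ← Module.End.mul_apply, ← map_mul, ← map_mul]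
    have hc : Commute (↑(isUnit_ν (k := k) (H := H)).unit : H) h :=
      (ν_central (k := k) (H := H)).comm h
    rw [hc.units_inv_left.eq])
  hom_inv_id := hom_ext fun x => by
    simp only [lin_comp, lin_ofLin, LinearMap.comp_apply]
    rw [← Module.End.mul_apply, ← map_mul, IsUnit.val_inv_mul, map_one]; rfl
  inv_hom_id := hom_ext fun x => by
    simp only [lin_comp, lin_ofLin, LinearMap.comp_apply]
    rw [← Module.End.mul_apply, ← map_mul, IsUnit.mul_val_inv, map_one]; rfl

lemma lin_twistIso (X : RepCat k H) : lin (twistIso X).hom = X.ρ (ν k) := rfl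

lemma act_ν_one (X Y : RepCat k H) (x : X.V ⊗[k] Y.V) :
    act X Y (ν k ⊗ₜ ν k) x = TensorProduct.map (X.ρ (ν k)) (Y.ρ (ν k)) x := rfl

instance : RibbonCategory (RepCat k H) where
  twist := twistIso
  twist_naturality f := hom_ext fun x => (lin_ρ f (ν k) x).symm
  twist_tensor X Y := hom_ext fun x => incl_injective X Y (by
    change act X Y (Δ k (ν k)) (incl X Y x) = braidLin Y X (braidLin X Y
      (TensorProduct.map (X.ρ (ν k)) (Y.ρ (ν k)) (incl X Y x)))
    rw [comul_ν, map_mul, map_mul, Module.End.mul_apply, Module.End.mul_apply, act_ν_one]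
    simp only [braidLin, LinearMap.comp_apply, LinearEquiv.coe_coe]
    rw [comm_act Y X, TensorProduct.comm_comm])
  twist_dual X := hom_ext fun z => incl_injective X (dual X) (by
    change TensorProduct.map (X.ρ (ν k)) LinearMap.id (coevLin X (coeT z)) =
      TensorProduct.map LinearMap.id ((dual X).ρ (ν k)) (coevLin X (coeT z))
    apply toEnd_injective
    have h1 : ∀ x, toEnd X (TensorProduct.map (X.ρ (ν k)) LinearMap.id x) =
        X.ρ (ν k) * toEnd X x := by
      intro x
      induction x with
      | zero => simp
      | add c d ha hb => simp only [map_add, mul_add, ha, hb]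
      | tmul v φ => ext w; simp
    have h2 : ∀ x, toEnd X (TensorProduct.map LinearMap.id ((dual X).ρ (ν k)) x) =
        toEnd X x * X.ρ (ν k) := by
      intro x
      induction x with
      | zero => simp
      | add c d ha hb => simp only [map_add, add_mul, ha, hb]
      | tmul v φ => ext w; simp [antipode_ν]
    rw [h1, h2, coevLin_apply, toEnd_act_comul, ← map_mul, ← map_mul,
      (ν_central (k := k) (H := H)).comm])

end RepCat

section
variable (k H : Type u) [Field k] [Ring H] [Algebra k H]

/-- `H` is connected: `H_s ∩ Z(H) = k` (in particular `H ≠ 0`). -/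
def IsConnected [QuantumGroupoid k H] : Prop :=
  Nontrivial H ∧ (Hs k H : Set H) ∩ Set.center H = Set.range (algebraMap k H)

/-- The map `F(φ) = (φ ⊗ id)(R₂₁ R)` from the dual of `H` to `H`. -/
def factorMap [Quasitriangular k H] (φ : Module.Dual k H) : H :=
  TensorProduct.lid k H (φ.rTensor H (flip k R * R))

/-- `H` is factorizable: `F` maps onto the centralizer of `H_s`. -/
def IsFactorizable [Quasitriangular k H] : Prop :=
  ∀ x ∈ Set.centralizer (Hs k H : Set H), ∃ φ : Module.Dual k H, factorMap k H φ = x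

variable {H} in
/-- `h` is a Haar integral: a two-sided integral with `ε_t(h) = ε_s(h) = 1`. -/
structure IsHaarIntegral [QuantumGroupoid k H] (h : H) : Prop where
  left : ∀ x : H, x * h = epsT k x * h
  right : ∀ x : H, h * x = h * epsS k x
  epsT_eq_one : epsT k h = 1
  epsS_eq_one : epsS k h = 1

end
end QG

end

/-!
Write `g = u ν`, where `u = S(R⁽²⁾) R⁽¹⁾` is the Drinfeld element, `Q = R₂₁ R`, and let `h` be a
Haar integral.

*Semisimplicity.* `h₍₁₎ ⊗ S(h₍₂₎)` is a separability idempotent (`sepElt_comm`, `mul'_sepElt`), so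
Maschke's theorem holds (`isSemisimpleRing_of_isHaarIntegral`), and the simple modules `V_i` of the
semisimple algebra `H` dominate every object. Connectedness of `H` makes the unit object
simple (`isSimpleObj_unit`), so one of the `V_i` may be taken to be `𝟙`; as `S` is bijective, duals
of simple objects are simple (`isSimpleObj_dual`), so each `V_i*` is isomorphic to some `V_j`.

*Traces.* The element `g` satisfies `S²(x) g = g x` and `Δ(g) = (g ⊗ g) Δ(1)` (`comul_pivot`,
which rests on a computation of `Δ(u)` with the Yang–Baxter equation). The counit of `tr_q(f)(1)`
is `tr(g f)` (`counit_qtrace`), so with the quantum characters `χ_i(x) = tr(g x | V_i)` one gets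
`ε(1) S_{ij} = χ_j((id ⊗ χ_i)(Q))` (`counit_qtrace_doubleBraiding`). Averaging operators with `h`
shows that `χ_i(1) ≠ 0` (`qchar_one_ne_zero`).

*Invertibility of the `S`-matrix.* Since `χ_i(1) ≠ 0`, the `χ_i` form a basis of the linear forms
on the center of `H` (`eq_sum_qchar_smul`). By factorizability and `(S ⊗ S)(Q) = Q₂₁`, a central
element `z` has the form `(id ⊗ ψ)(Q)`. Because `Q` commutes with `Δ(H)`, averaging `ψ` with `h`
does not change this element (`adjoint_snd_eq_adjoint_fst`), and the averaged form factors through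
the projection to the center, so it is a linear combination of the `χ_i`. Thus the elements
`(id ⊗ χ_i)(Q)` span the center (`exists_eq_sum_partialTrace`), and the matrix of the pairing with
the `χ_j` is invertible (`exists_sMatrix`).
-/

/-! ### Counital subalgebras -/

namespace QG
open Coalgebra QuantumGroupoid

section
variable (k : Type u) {H : Type u} [Field k] [Ring H] [Algebra k H] [QuantumGroupoid k H]

lemma epsS_id_comul_one : (epsS k).rTensor H (Δ k (1 : H)) = Δ k 1 := by
  have h := epsS_id k (1 : H)
  rw [← Algebra.TensorProduct.one_def, mul_one] at h
  rw [h, show epsT k ∘ₗ LinearMap.mulLeft k (1 : H) = epsT k by ext; simp, id_epsT_comul_one]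

/-- A functional form of the formula `ε_s(h) = 1₍₁₎ ε(h 1₍₂₎)`. -/
lemma epsS_apply' {M : Type*} [AddCommGroup M] [Module k M] (f : H →ₗ[k] M) (h : H) :
    f (epsS k h) = TensorProduct.rid k M (TensorProduct.map f
      ((counit (R := k)) ∘ₗ LinearMap.mulLeft k h) (Δ k 1)) := by
  rw [epsS_apply]
  generalize Δ k (1 : H) = s
  induction s with
  | zero => simp
  | add a b ha hb => simp only [mul_add, map_add, ha, hb]
  | tmul a b => simp

lemma epsS_mem (x : H) : epsS k x ∈ Hs k H := ⟨x, rfl⟩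

/-- `H_t` satisfies `Δ(z) = (z ⊗ 1) Δ(1)` in addition to `Δ(z) = Δ(1) (z ⊗ 1)`. -/
lemma comul_of_mem_Ht_left {z : H} (hz : z ∈ Ht k H) : Δ k z = (z ⊗ₜ 1) * Δ k 1 := by
  obtain ⟨h, rfl⟩ := hz
  rw [epsT_apply' k (Δ k) h]
  have key : ∀ s t : H ⊗[k] H, TensorProduct.lid k _ (TensorProduct.map
      ((counit (R := k)) ∘ₗ LinearMap.mulRight k h) LinearMap.id (j12 k t * j23 k s)) =
      ((TensorProduct.lid k _ (TensorProduct.map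
      ((counit (R := k)) ∘ₗ LinearMap.mulRight k h) LinearMap.id t)) ⊗ₜ 1) * s := by
    intro s t
    induction s with
    | zero => simp
    | add a b ha hb => simp only [mul_add, map_add, ha, hb]
    | tmul a b =>
      induction t with
      | zero => simp
      | add a b ha hb => simp only [add_mul, map_add, ha, hb, TensorProduct.add_tmul]
      | tmul c d => simp [TensorProduct.smul_tmul']
  have h1 := epsT_apply' k LinearMap.id h
  rw [LinearMap.id_apply] at h1
  rw [h1, ← key, j12_mul_j23]
  generalize Δ k (1 : H) = s
  induction s with
  | zero => simp
  | add a b ha hb => simp only [map_add, ha, hb]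
  | tmul a b => simp

/-- Contracting the third factor of `s₁₂ t₂₃` and of `t₂₃ s₁₂` with `x ↦ ε(h x)`. -/
lemma rid_counit_mulLeft_j12_j23 (h : H) (s t : H ⊗[k] H) :
    (TensorProduct.rid k _ ((counit (R := k) ∘ₗ LinearMap.mulLeft k h).lTensor _
      ((TensorProduct.assoc k H H H).symm (j12 k s * j23 k t))) =
      s * (1 ⊗ₜ TensorProduct.rid k _ ((counit (R := k) ∘ₗ LinearMap.mulLeft k h).lTensor _ t))) ∧
    (TensorProduct.rid k _ ((counit (R := k) ∘ₗ LinearMap.mulLeft k h).lTensor _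
      ((TensorProduct.assoc k H H H).symm (j23 k t * j12 k s))) =
      (1 ⊗ₜ TensorProduct.rid k _ ((counit (R := k) ∘ₗ LinearMap.mulLeft k h).lTensor _ t)) * s) := by
  induction s with
  | zero => simp
  | add a b ha hb => simp only [mul_add, add_mul, map_add, ha, hb, and_self]
  | tmul a b =>
    induction t with
    | zero => simp
    | add a b ha hb =>
      simp only [mul_add, add_mul, map_add, ha, hb, TensorProduct.tmul_add, and_self]
    | tmul c d => simp

lemma comul_of_mem_Hs {y : H} (hy : y ∈ Hs k H) :
    Δ k y = Δ k 1 * (1 ⊗ₜ y) ∧ Δ k y = (1 ⊗ₜ y) * Δ k 1 := by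
  obtain ⟨h, rfl⟩ := hy
  have h1 := epsS_apply' k LinearMap.id h
  rw [LinearMap.id_apply] at h1
  have h2 : Δ k (epsS k h) = TensorProduct.rid k _ ((counit (R := k) ∘ₗ
      LinearMap.mulLeft k h).lTensor _ ((TensorProduct.assoc k H H H).symm (idΔ k (Δ k 1)))) := by
    rw [epsS_apply' k (Δ k) h, ← Δid_comul]
    generalize Δ k (1 : H) = s
    induction s with
    | zero => simp
    | add a b ha hb => simp only [map_add, ha, hb]
    | tmul a b => simp [Δid_tmul]
  constructor
  · rw [h2, ← j12_mul_j23, (rid_counit_mulLeft_j12_j23 k h _ _).1, h1]; rfl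
  · rw [h2, ← j23_mul_j12, (rid_counit_mulLeft_j12_j23 k h _ _).2, h1]; rfl

lemma epsS_eq_antipode_of_mem {z : H} (hz : z ∈ Ht k H) : epsS k z = S k z := by
  have h1 : epsS k z = LinearMap.mul' k H ((S k).rTensor H (Δ k z)) := rfl
  have key : ∀ t : H ⊗[k] H, LinearMap.mul' k H ((S k).rTensor H (t * (z ⊗ₜ 1))) =
      S k z * LinearMap.mul' k H ((S k).rTensor H t) := by
    intro t
    induction t with
    | zero => simp
    | add a b ha hb => simp only [mul_add, add_mul, map_add, ha, hb]
    | tmul a b => simp [S, antipode_mul, mul_assoc]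
  rw [h1, comul_of_mem k hz, key]
  have : LinearMap.mul' k H ((S k).rTensor H (Δ k 1)) = epsS k 1 := rfl
  rw [this, epsS_one, mul_one]

lemma epsT_eq_antipode_of_mem {y : H} (hy : y ∈ Hs k H) : epsT k y = S k y := by
  have h1 : epsT k y = LinearMap.mul' k H ((S k).lTensor H (Δ k y)) := rfl
  have key : ∀ t : H ⊗[k] H, LinearMap.mul' k H ((S k).lTensor H ((1 ⊗ₜ y) * t)) =
      LinearMap.mul' k H ((S k).lTensor H t) * S k y := by
    intro t
    induction t with
    | zero => simp
    | add a b ha hb => simp only [mul_add, add_mul, map_add, ha, hb]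
    | tmul a b => simp [S, antipode_mul, mul_assoc]
  rw [h1, (comul_of_mem_Hs k hy).2, key]
  have : LinearMap.mul' k H ((S k).lTensor H (Δ k 1)) = epsT k 1 := rfl
  rw [this, epsT_one, one_mul]

/-- `Δᵒᵖ(1) = S(1₍₁₎) ⊗ S(1₍₂₎)` -/
lemma map_antipode_comul_one :
    TensorProduct.map (S k) (S k) (Δ k (1 : H)) = TensorProduct.comm k H H (Δ k 1) := by
  have h1 := comul_antipode (k := k) (1 : H)
  rw [antipode_one] at h1
  have h2 := congrArg (TensorProduct.comm k H H) h1
  rw [TensorProduct.comm_comm] at h2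
  exact h2.symm

/-- `Δ(1) = S(1₍₂₎) ⊗ S(1₍₁₎)` -/
lemma comm_map_antipode_comul_one :
    TensorProduct.comm k H H (TensorProduct.map (S k) (S k) (Δ k (1 : H))) = Δ k 1 := by
  rw [map_antipode_comul_one, TensorProduct.comm_comm]

/-- `ε_s(h₍₁₎) ⊗ h₍₂₎ = 1₍₁₎ ⊗ h 1₍₂₎` -/
lemma epsS_id_comul (h : H) : (epsS k).rTensor H (Δ k h) = (1 ⊗ₜ h) * Δ k 1 := by
  have key : ∀ s : H ⊗[k] H, (epsS k).rTensor H s = c2 k (j23 k s * j12 k (Δ k 1)) := by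
    intro s
    induction s with
    | zero => simp
    | add a b ha hb => simp only [add_mul, map_add, ha, hb]
    | tmul a b =>
      have := epsS_apply' k LinearMap.id a
      rw [LinearMap.id_apply] at this
      rw [LinearMap.rTensor_tmul, this]
      generalize Δ k (1 : H) = s
      induction s with
      | zero => simp
      | add a b ha hb => simp only [mul_add, map_add, TensorProduct.add_tmul, ha, hb]
      | tmul c d => simp [TensorProduct.smul_tmul]
  have h2 : j23 k (Δ k h) * j12 k (Δ k 1) = idΔ k ((1 ⊗ₜ h) * Δ k 1) := by
    rw [← comul_one' k h, map_mul, mul_assoc, j23_mul_j12, idΔ_mul]; rfl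
  rw [key, h2, c2_idΔ]

/-- For `t ∈ H ⊗ H`, the map `x ↦ t₁ ε(t₂ x)`. -/
def contractSnd (t : H ⊗[k] H) : H →ₗ[k] H := (TensorProduct.rid k H).toLinearMap ∘ₗ
  (counit (R := k)).lTensor H ∘ₗ LinearMap.mulLeft k t ∘ₗ TensorProduct.mk k H H 1

lemma contractSnd_apply (t : H ⊗[k] H) (x : H) : contractSnd k t x =
    TensorProduct.rid k H ((counit (R := k)).lTensor H (t * (1 ⊗ₜ x))) := rfl

/-- `t₁ ⊗ ε_s(t₂) = t₁ ε(t₂ 1₍₂₎) ⊗ 1₍₁₎` -/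
lemma lTensor_epsS (t : H ⊗[k] H) : (epsS k).lTensor H t =
    TensorProduct.comm k H H ((contractSnd k t).lTensor H (Δ k 1)) := by
  induction t with
  | zero => simp [contractSnd]
  | add a b ha hb =>
    have : LinearMap.mulLeft k (a + b) = LinearMap.mulLeft k a + LinearMap.mulLeft k b := by
      ext; simp [add_mul]
    simp only [contractSnd, map_add, ha, hb, this, LinearMap.add_comp, LinearMap.comp_add,
      LinearMap.lTensor_add, LinearMap.add_apply]
  | tmul a b =>
    rw [LinearMap.lTensor_tmul, epsS_apply]
    generalize Δ k (1 : H) = s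
    induction s with
    | zero => simp
    | add a b ha hb => simp only [mul_add, map_add, TensorProduct.tmul_add, ha, hb]
    | tmul c d => simp [contractSnd, TensorProduct.smul_tmul']

/-- `h₍₁₎ ⊗ ε_s(h₍₂₎) = h 1₍₁₎ ⊗ S(1₍₂₎)` -/
lemma id_epsS_comul (h : H) :
    (epsS k).lTensor H (Δ k h) = (h ⊗ₜ 1) * (S k).lTensor H (Δ k 1) := by
  have hG : ∀ x : H, contractSnd k (Δ k x) = LinearMap.mulLeft k x ∘ₗ contractSnd k (Δ k 1) := by
    intro x
    have e : ∀ (t : H ⊗[k] H) (z : H), contractSnd k t z = TensorProduct.rid k H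
        (TensorProduct.map LinearMap.id ((counit (R := k)) ∘ₗ LinearMap.mulRight k z) t) := by
      intro t z
      rw [contractSnd_apply]
      induction t with
      | zero => simp
      | add a b ha hb => simp only [map_add, add_mul, ha, hb]
      | tmul a b => simp
    refine LinearMap.ext fun z => ?_
    rw [LinearMap.comp_apply, LinearMap.mulLeft_apply, e, e]
    exact counit_contract_right k z x
  have e1 : ∀ x : H, (epsS k).lTensor H (Δ k x) = (x ⊗ₜ 1) * (epsS k).lTensor H (Δ k 1) := by
    intro x
    rw [lTensor_epsS, lTensor_epsS, hG, LinearMap.lTensor_comp, LinearMap.comp_apply]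
    generalize (contractSnd k (Δ k 1)).lTensor H (Δ k 1) = s
    induction s with
    | zero => simp
    | add a b ha hb => simp only [mul_add, map_add, ha, hb]
    | tmul c d => simp
  rw [e1]
  congr 1
  conv_lhs => rw [← id_epsT_comul_one, ← LinearMap.comp_apply, ← LinearMap.lTensor_comp]
  conv_rhs => rw [← id_epsT_comul_one, ← LinearMap.comp_apply, ← LinearMap.lTensor_comp]
  congr 2
  ext x
  exact epsS_eq_antipode_of_mem k (epsT_mem k x)

end
end QG

/-! ### The antipode and the counital maps on the `R`-matrix -/

namespace QG
open Coalgebra QuantumGroupoid Quasitriangular RibbonQuantumGroupoid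

section Sandwich
variable {k A₁ A₂ B : Type*} [Field k] [AddCommGroup A₁] [Module k A₁] [AddCommGroup A₂]
  [Module k A₂] [Ring B] [Algebra k B]

/-- The sandwich `t ↦ ℓ(t₂) m r(t₁)`. -/
noncomputable def sand (l : A₂ →ₗ[k] B) (r : A₁ →ₗ[k] B) (m : B) : A₁ ⊗[k] A₂ →ₗ[k] B :=
  LinearMap.mul' k B ∘ₗ TensorProduct.map (LinearMap.mulRight k m ∘ₗ l) r ∘ₗ
    (TensorProduct.comm k A₁ A₂).toLinearMap

variable (l : A₂ →ₗ[k] B) (r : A₁ →ₗ[k] B)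

@[simp] lemma sand_tmul (m : B) (a : A₁) (b : A₂) : sand l r m (a ⊗ₜ b) = l b * m * r a := rfl

@[simp] lemma sand_add (m n : B) : sand l r (m + n) = sand l r m + sand l r n := by
  ext a b; simp [mul_add, add_mul]

@[simp] lemma sand_zero : sand l r (0 : B) = 0 := by
  ext a b; simp

end Sandwich

section
variable (k : Type u) {H : Type u} [Field k] [Ring H] [Algebra k H] [QuantumGroupoid k H]

lemma map_antipode_mul (s t : H ⊗[k] H) : TensorProduct.map (S k) (S k) (s * t) =
    TensorProduct.map (S k) (S k) t * TensorProduct.map (S k) (S k) s := by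
  induction s with
  | zero => simp
  | add a b ha hb => simp only [add_mul, mul_add, map_add, ha, hb]
  | tmul a b =>
    induction t with
    | zero => simp
    | add a b ha hb => simp only [add_mul, mul_add, map_add, ha, hb]
    | tmul c d => simp [S, antipode_mul]

/-- For `t ∈ H ⊗ H`, the map `x ↦ ε(t₁ x) t₂`. -/
noncomputable def contractFst (t : H ⊗[k] H) : H →ₗ[k] H := (TensorProduct.lid k H).toLinearMap ∘ₗ
  (counit (R := k)).rTensor H ∘ₗ LinearMap.mulLeft k t ∘ₗ (TensorProduct.mk k H H).flip 1

/-- For `t ∈ H ⊗ H`, the map `x ↦ ε(x t₁) t₂`. -/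
noncomputable def contractFst' (t : H ⊗[k] H) : H →ₗ[k] H :=
  (TensorProduct.lid k H).toLinearMap ∘ₗ
  (counit (R := k)).rTensor H ∘ₗ LinearMap.mulRight k t ∘ₗ (TensorProduct.mk k H H).flip 1

lemma contractFst_apply (t : H ⊗[k] H) (x : H) : contractFst k t x =
    TensorProduct.lid k H ((counit (R := k)).rTensor H (t * (x ⊗ₜ 1))) := rfl

lemma contractFst'_apply (t : H ⊗[k] H) (x : H) : contractFst' k t x =
    TensorProduct.lid k H ((counit (R := k)).rTensor H ((x ⊗ₜ 1) * t)) := rfl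

/-- `ε_s(t₁) ⊗ t₂ = 1₍₁₎ ⊗ ε(t₁ 1₍₂₎) t₂` -/
lemma rTensor_epsS (t : H ⊗[k] H) :
    (epsS k).rTensor H t = (contractFst k t).lTensor H (Δ k 1) := by
  induction t with
  | zero => simp [contractFst]
  | add a b ha hb =>
    have : LinearMap.mulLeft k (a + b) = LinearMap.mulLeft k a + LinearMap.mulLeft k b := by
      ext; simp [add_mul]
    simp only [contractFst, map_add, ha, hb, this, LinearMap.add_comp, LinearMap.comp_add,
      LinearMap.lTensor_add, LinearMap.add_apply]
  | tmul a b =>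
    rw [LinearMap.rTensor_tmul, epsS_apply]
    generalize Δ k (1 : H) = s
    induction s with
    | zero => simp
    | add a b ha hb => simp only [mul_add, map_add, TensorProduct.add_tmul, ha, hb]
    | tmul c d => simp [contractFst, TensorProduct.smul_tmul']

/-- `ε_t(t₁) ⊗ t₂ = 1₍₂₎ ⊗ ε(1₍₁₎ t₁) t₂` -/
lemma rTensor_epsT (t : H ⊗[k] H) : (epsT k).rTensor H t =
    TensorProduct.comm k H H ((contractFst' k t).rTensor H (Δ k 1)) := by
  induction t with
  | zero => simp [contractFst']
  | add a b ha hb =>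
    have : LinearMap.mulRight k (a + b) = LinearMap.mulRight k a + LinearMap.mulRight k b := by
      ext; simp [mul_add]
    simp only [contractFst', map_add, ha, hb, this, LinearMap.add_comp, LinearMap.comp_add,
      LinearMap.rTensor_add, LinearMap.add_apply]
  | tmul a b =>
    rw [LinearMap.rTensor_tmul, epsT_apply]
    generalize Δ k (1 : H) = s
    induction s with
    | zero => simp
    | add a b ha hb => simp only [add_mul, map_add, TensorProduct.add_tmul, ha, hb]
    | tmul c d => simp [contractFst', TensorProduct.smul_tmul']

lemma lid_counit_mul (x : H) (t : H ⊗[k] H) :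
    TensorProduct.lid k H ((counit (R := k)).rTensor H ((1 ⊗ₜ x) * t)) =
      x * TensorProduct.lid k H ((counit (R := k)).rTensor H t) := by
  induction t with
  | zero => simp
  | add a b ha hb => simp only [mul_add, map_add, ha, hb]
  | tmul a b => simp

lemma lid_counit_mul_right (x : H) (t : H ⊗[k] H) :
    TensorProduct.lid k H ((counit (R := k)).rTensor H (t * (1 ⊗ₜ x))) =
      TensorProduct.lid k H ((counit (R := k)).rTensor H t) * x := by
  induction t with
  | zero => simp
  | add a b ha hb => simp only [add_mul, map_add, ha, hb]
  | tmul a b => simp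

lemma rid_counit_mul (x : H) (t : H ⊗[k] H) :
    TensorProduct.rid k H ((counit (R := k)).lTensor H ((x ⊗ₜ 1) * t)) =
      x * TensorProduct.rid k H ((counit (R := k)).lTensor H t) := by
  induction t with
  | zero => simp
  | add a b ha hb => simp only [mul_add, map_add, ha, hb]
  | tmul a b => simp

end

section
variable (k : Type u) {H : Type u} [Field k] [Ring H] [Algebra k H] [Quasitriangular k H]

/-- `R` intertwines `Δ(z) = Δ(1) (z ⊗ 1)` and `Δᵒᵖ(z) = (1 ⊗ z) Δᵒᵖ(1)`. -/
lemma R_mul_of_mem_Ht {z : H} (hz : z ∈ Ht k H) : (R : H ⊗[k] H) * (z ⊗ₜ 1) = (1 ⊗ₜ z) * R := by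
  rw [← R_mul_one, mul_assoc, ← comul_of_mem k hz, ← R_comul, comul_of_mem_Ht_left k hz, map_mul,
    mul_assoc, R_mul_one, one_mul_R]; rfl

lemma R_mul_of_mem_Hs {y : H} (hy : y ∈ Hs k H) : (R : H ⊗[k] H) * (1 ⊗ₜ y) = (y ⊗ₜ 1) * R := by
  rw [← R_mul_one, mul_assoc, ← (comul_of_mem_Hs k hy).1, ← R_comul, (comul_of_mem_Hs k hy).2,
    map_mul, mul_assoc, R_mul_one, one_mul_R]; rfl

/-- `(ε ⊗ id) R = 1` -/
lemma counit_R_left :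
    TensorProduct.lid k H ((counit (R := k)).rTensor H (R : H ⊗[k] H)) = 1 := by
  set p := TensorProduct.lid k H ((counit (R := k)).rTensor H (R : H ⊗[k] H)) with hp
  let E : H ⊗[k] (H ⊗[k] H) →ₗ[k] H ⊗[k] H :=
    (TensorProduct.lid k (H ⊗[k] H)).toLinearMap ∘ₗ (counit (R := k)).rTensor _
  have h1 : ∀ t : H ⊗[k] H, E (Δid k t) = t := by
    intro t
    have aux : ∀ (s : H ⊗[k] H) (b : H), E (TensorProduct.assoc k H H H (s ⊗ₜ b)) =
        (TensorProduct.lid k H ((counit (R := k)).rTensor H s)) ⊗ₜ b := by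
      intro s b
      induction s with
      | zero => simp
      | add a b ha hb => simp only [map_add, TensorProduct.add_tmul, ha, hb]
      | tmul a b => simp [E, TensorProduct.smul_tmul']
    induction t with
    | zero => simp
    | add a b ha hb => simp only [map_add, ha, hb]
    | tmul a b => simp [Δid_tmul, aux, Δ, Coalgebra.rTensor_counit_comul]
  have h2 : ∀ s t : H ⊗[k] H, E (j13 k s * j23 k t) =
      (1 ⊗ₜ TensorProduct.lid k H ((counit (R := k)).rTensor H s)) * t := by
    intro s t
    induction s with
    | zero => simp
    | add a b ha hb => simp only [map_add, add_mul, TensorProduct.tmul_add, ha, hb]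
    | tmul a b =>
      induction t with
      | zero => simp
      | add a b ha hb => simp only [map_add, mul_add, ha, hb]
      | tmul c d => simp [E]
  have h3 : (1 ⊗ₜ p) * (R : H ⊗[k] H) = R := by
    rw [hp, ← h2, ← Δid_R, h1]
  have h4 : (1 ⊗ₜ p) * flip k (Δ k (1 : H)) = flip k (Δ k 1) := by
    rw [← R_mul_Rbar, ← mul_assoc, h3]
  have h5 := congrArg (fun t => TensorProduct.lid k H ((counit (R := k)).rTensor H t)) h4
  have h6 : TensorProduct.lid k H ((counit (R := k)).rTensor H (flip k (Δ k (1 : H)))) = 1 := by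
    have : ∀ t : H ⊗[k] H, TensorProduct.lid k H ((counit (R := k)).rTensor H (flip k t)) =
        TensorProduct.rid k H ((counit (R := k)).lTensor H t) := by
      intro t
      induction t with
      | zero => simp
      | add a b ha hb => simp only [map_add, ha, hb]
      | tmul a b => simp
    rw [this]; simp [Δ, Coalgebra.lTensor_counit_comul]
  simp only [lid_counit_mul, h6, mul_one] at h5
  exact h5

/-- `(id ⊗ ε) R = 1` -/
lemma counit_R_right :
    TensorProduct.rid k H ((counit (R := k)).lTensor H (R : H ⊗[k] H)) = 1 := by
  set p := TensorProduct.rid k H ((counit (R := k)).lTensor H (R : H ⊗[k] H)) with hp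
  let E : H ⊗[k] (H ⊗[k] H) →ₗ[k] H ⊗[k] H :=
    ((TensorProduct.rid k H).toLinearMap ∘ₗ (counit (R := k)).lTensor _).lTensor H
  have h1 : ∀ t : H ⊗[k] H, E (idΔ k t) = t := by
    intro t
    induction t with
    | zero => simp
    | add a b ha hb => simp only [map_add, ha, hb]
    | tmul a b => simp [E, Δ, Coalgebra.lTensor_counit_comul]
  have h2 : ∀ s t : H ⊗[k] H, E (j13 k s * j12 k t) =
      (TensorProduct.rid k H ((counit (R := k)).lTensor H s) ⊗ₜ 1) * t := by
    intro s t
    induction s with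
    | zero => simp
    | add a b ha hb => simp only [map_add, add_mul, TensorProduct.add_tmul, ha, hb]
    | tmul a b =>
      induction t with
      | zero => simp
      | add a b ha hb => simp only [map_add, mul_add, ha, hb]
      | tmul c d => simp [E, TensorProduct.smul_tmul']
  have h3 : (p ⊗ₜ 1) * (R : H ⊗[k] H) = R := by
    rw [hp, ← h2, ← idΔ_R, h1]
  have h4 : (p ⊗ₜ 1) * flip k (Δ k (1 : H)) = flip k (Δ k 1) := by
    rw [← R_mul_Rbar, ← mul_assoc, h3]
  have h5 := congrArg (fun t => TensorProduct.rid k H ((counit (R := k)).lTensor H t)) h4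
  have h6 : TensorProduct.rid k H ((counit (R := k)).lTensor H (flip k (Δ k (1 : H)))) = 1 := by
    have : ∀ t : H ⊗[k] H, TensorProduct.rid k H ((counit (R := k)).lTensor H (flip k t)) =
        TensorProduct.lid k H ((counit (R := k)).rTensor H t) := by
      intro t
      induction t with
      | zero => simp
      | add a b ha hb => simp only [map_add, ha, hb]
      | tmul a b => simp
    rw [this]; simp [Δ, Coalgebra.rTensor_counit_comul]
  simp only [rid_counit_mul, h6, mul_one] at h5
  exact h5

/-- `(ε_s ⊗ id) R = Δ(1)` -/
lemma epsS_R : (epsS k).rTensor H (R : H ⊗[k] H) = Δ k 1 := by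
  have h : contractFst k (R : H ⊗[k] H) ∘ₗ epsT k = epsT k := by
    refine LinearMap.ext fun x => ?_
    rw [LinearMap.comp_apply, contractFst_apply, R_mul_of_mem_Ht k (epsT_mem k x),
      lid_counit_mul, counit_R_left, mul_one]
  conv_lhs => rw [rTensor_epsS, ← id_epsT_comul_one, ← LinearMap.comp_apply,
    ← LinearMap.lTensor_comp, h]
  exact id_epsT_comul_one k

/-- `(ε_t ⊗ id) R = Δᵒᵖ(1)` -/
lemma epsT_R : (epsT k).rTensor H (R : H ⊗[k] H) = flip k (Δ k 1) := by
  have h : contractFst' k (R : H ⊗[k] H) ∘ₗ epsS k = epsS k := by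
    refine LinearMap.ext fun x => ?_
    rw [LinearMap.comp_apply, contractFst'_apply, ← R_mul_of_mem_Hs k (epsS_mem k x),
      lid_counit_mul_right, counit_R_left, one_mul]
  conv_lhs => rw [rTensor_epsT, ← epsS_id_comul_one, ← LinearMap.comp_apply,
    ← LinearMap.rTensor_comp, h, epsS_id_comul_one]
  rfl

/-- `(id ⊗ ε_s) R = 1₍₁₎ ⊗ S(1₍₂₎)` -/
lemma R_epsS : (epsS k).lTensor H (R : H ⊗[k] H) = (S k).lTensor H (Δ k 1) := by
  have h : contractSnd k (R : H ⊗[k] H) ∘ₗ S k ∘ₗ epsS k = epsS k := by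
    refine LinearMap.ext fun x => ?_
    have e : ∀ (t : H ⊗[k] H) (y : H), contractSnd k t (epsT k y) = contractSnd k t y := by
      intro t y
      simp only [contractSnd_apply]
      induction t with
      | zero => simp
      | add a b ha hb => simp only [map_add, add_mul, ha, hb]
      | tmul a b => simp [counit_mul_epsT]
    rw [LinearMap.comp_apply, LinearMap.comp_apply, ← epsT_eq_antipode_of_mem k (epsS_mem k x), e,
      contractSnd_apply, R_mul_of_mem_Hs k (epsS_mem k x), rid_counit_mul, counit_R_right, mul_one]
  rw [lTensor_epsS]
  have e : ∀ t : H ⊗[k] H, TensorProduct.comm k H H ((contractSnd k (R : H ⊗[k] H)).lTensor H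
      (TensorProduct.comm k H H (TensorProduct.map (S k) (S k) ((epsS k).rTensor H t)))) =
      TensorProduct.map (contractSnd k (R : H ⊗[k] H) ∘ₗ S k ∘ₗ epsS k) (S k) t := by
    intro t
    induction t with
    | zero => simp
    | add a b ha hb => simp only [map_add, ha, hb]
    | tmul a b => simp
  conv_lhs => rw [← comm_map_antipode_comul_one, ← epsS_id_comul_one, e, h]
  conv_rhs => rw [← epsS_id_comul_one]
  generalize Δ k (1 : H) = t
  induction t with
  | zero => simp
  | add a b ha hb => simp only [map_add, ha, hb]
  | tmul a b => simp

/-- `(S ⊗ id)(R) R = Δ(1)` -/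
lemma antipode_R_mul_R : (S k).rTensor H (R : H ⊗[k] H) * R = Δ k 1 := by
  rw [← epsS_R, ← mulFst_Δid, Δid_R]
  generalize (R : H ⊗[k] H) = s
  suffices h : ∀ t, (S k).rTensor H s * t = mulFst k (S k) (j13 k s * j23 k t) from h s
  intro t
  induction s with
  | zero => simp
  | add a b ha hb => simp only [map_add, add_mul, ha, hb]
  | tmul a b =>
    induction t with
    | zero => simp
    | add a b ha hb => simp only [map_add, mul_add, ha, hb]
    | tmul c d => simp

/-- `R (S ⊗ id)(R) = Δᵒᵖ(1)` -/
lemma R_mul_antipode_R : (R : H ⊗[k] H) * (S k).rTensor H R = flip k (Δ k 1) := by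
  let m : H ⊗[k] (H ⊗[k] H) →ₗ[k] H ⊗[k] H :=
    (LinearMap.mul' k H ∘ₗ (S k).lTensor H).rTensor H ∘ₗ
      (TensorProduct.assoc k H H H).symm.toLinearMap
  have h1 : ∀ t : H ⊗[k] H, m (Δid k t) = (epsT k).rTensor H t := by
    intro t
    induction t with
    | zero => simp
    | add a b ha hb => simp only [map_add, ha, hb]
    | tmul a b => simp [m, Δid_tmul, epsT]
  have h2 : ∀ s t : H ⊗[k] H, m (j13 k s * j23 k t) = s * (S k).rTensor H t := by
    intro s t
    induction s with
    | zero => simp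
    | add a b ha hb => simp only [map_add, add_mul, ha, hb]
    | tmul a b =>
      induction t with
      | zero => simp
      | add a b ha hb => simp only [map_add, mul_add, ha, hb]
      | tmul c d => simp [m]
  rw [← epsT_R, ← h1, Δid_R, h2]

/-- `r₁ R₁ ⊗ S(R₂) r₂ = 1₍₁₎ ⊗ S(1₍₂₎)` for two copies `r`, `R` of the `R`-matrix -/
lemma sand_antipode_R : sand (TensorProduct.mk k H H 1 ∘ₗ S k) ((TensorProduct.mk k H H).flip 1)
    (R : H ⊗[k] H) R = (S k).lTensor H (Δ k 1) := by
  let m : H ⊗[k] (H ⊗[k] H) →ₗ[k] H ⊗[k] H := (LinearMap.mul' k H ∘ₗ (S k).rTensor H).lTensor H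
  have h1 : ∀ t : H ⊗[k] H, m (idΔ k t) = (epsS k).lTensor H t := by
    intro t
    induction t with
    | zero => simp
    | add a b ha hb => simp only [map_add, ha, hb]
    | tmul a b => simp [m, epsS]
  have h2 : ∀ s t : H ⊗[k] H, m (j13 k s * j12 k t) =
      sand (TensorProduct.mk k H H 1 ∘ₗ S k) ((TensorProduct.mk k H H).flip 1) s t := by
    intro s t
    induction s with
    | zero => simp
    | add a b ha hb => simp only [map_add, add_mul, sand_add, LinearMap.add_apply, ha, hb]
    | tmul a b =>
      induction t with
      | zero => simp
      | add a b ha hb => simp only [map_add, mul_add, ha, hb]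
      | tmul c d => simp [m]
  rw [← R_epsS, ← h1, idΔ_R, h2]

/-- `(S ⊗ S) R = R` -/
lemma map_antipode_R : TensorProduct.map (S k) (S k) (R : H ⊗[k] H) = R := by
  have h1 := congrArg ((S k).rTensor H) (sand_antipode_R k (H := H))
  have h2 : ∀ s t : H ⊗[k] H, (S k).rTensor H
      (sand (TensorProduct.mk k H H 1 ∘ₗ S k) ((TensorProduct.mk k H H).flip 1) s t) =
      TensorProduct.map (S k) (S k) t * (S k).rTensor H s := by
    intro s t
    induction s with
    | zero => simp
    | add a b ha hb => simp only [map_add, mul_add, sand_add, LinearMap.add_apply, ha, hb]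
    | tmul a b =>
      induction t with
      | zero => simp
      | add a b ha hb => simp only [map_add, add_mul, ha, hb]
      | tmul c d => simp [S, antipode_mul]
  have h3 : (S k).rTensor H ((S k).lTensor H (Δ k (1 : H))) = flip k (Δ k 1) := by
    rw [← LinearMap.comp_apply, LinearMap.rTensor_comp_lTensor, map_antipode_comul_one]; rfl
  rw [h2, h3] at h1
  have h4 : Δ k (1 : H) = TensorProduct.map (S k) (S k) (flip k (Δ k 1)) := by
    conv_lhs => rw [← comm_map_antipode_comul_one]
    generalize Δ k (1 : H) = t
    induction t with
    | zero => simp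
    | add a b ha hb => simp only [map_add, ha, hb]
    | tmul c d => simp
  have h5 := congrArg (· * (R : H ⊗[k] H)) h1
  simp only [mul_assoc, antipode_R_mul_R, one_mul_R] at h5
  rwa [h4, ← map_antipode_mul, one_mul_R] at h5

end
end QG

/-! ### The Drinfeld element and bijectivity of the antipode -/

namespace QG
open Coalgebra QuantumGroupoid Quasitriangular RibbonQuantumGroupoid

section
variable (k : Type u) {H : Type u} [Field k] [Ring H] [Algebra k H] [QuantumGroupoid k H]

/-- The contraction `t ↦ S(t₂) t₁`. -/
noncomputable def antiMul : H ⊗[k] H →ₗ[k] H := sand (S k) LinearMap.id 1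

@[simp] lemma antiMul_tmul (a b : H) : antiMul k (a ⊗ₜ[k] b) = S k b * a := by simp [antiMul]

lemma sand_antiMul (s t : H ⊗[k] H) :
    sand (S k) LinearMap.id (antiMul k s) t = antiMul k (s * t) := by
  induction s with
  | zero => simp
  | add a b ha hb => simp only [map_add, add_mul, sand_add, LinearMap.add_apply, ha, hb]
  | tmul a b =>
    induction t with
    | zero => simp
    | add a b ha hb => simp only [map_add, mul_add, ha, hb]
    | tmul c d => simp [S, antipode_mul, mul_assoc]

lemma antiMul_mul_right (t : H ⊗[k] H) (y : H) :
    antiMul k (t * (1 ⊗ₜ y)) = S k y * antiMul k t := by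
  induction t with
  | zero => simp
  | add a b ha hb => simp only [map_add, mul_add, add_mul, ha, hb]
  | tmul a b => simp [S, antipode_mul, mul_assoc]

lemma antiMul_mul_left (t : H ⊗[k] H) (y : H) :
    antiMul k (t * (y ⊗ₜ 1)) = antiMul k t * y := by
  induction t with
  | zero => simp
  | add a b ha hb => simp only [map_add, add_mul, ha, hb]
  | tmul a b => simp [mul_assoc]

lemma antiMul_flip_comul_one : antiMul k (flip k (Δ k (1 : H))) = 1 := by
  have h : ∀ t : H ⊗[k] H, antiMul k (flip k t) = LinearMap.mul' k H ((S k).rTensor H t) := by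
    intro t
    induction t with
    | zero => simp
    | add a b ha hb => simp only [map_add, ha, hb]
    | tmul a b => simp
  rw [h]
  exact epsS_one k

/-- `a ⊗ b ⊗ c ↦ S²(c) S(b) a` -/
noncomputable def antiMul₃ : H ⊗[k] (H ⊗[k] H) →ₗ[k] H :=
  LinearMap.mul' k H ∘ₗ (TensorProduct.comm k H H).toLinearMap ∘ₗ
    (LinearMap.mul' k H ∘ₗ (TensorProduct.comm k H H).toLinearMap ∘ₗ
      TensorProduct.map (S k) (S k ∘ₗ S k)).lTensor H

@[simp] lemma antiMul₃_tmul (a b c : H) :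
    antiMul₃ k (a ⊗ₜ[k] (b ⊗ₜ c)) = S k (S k c) * S k b * a := rfl

lemma antiMul₃_j12_mul_idΔ (s t : H ⊗[k] H) : antiMul₃ k (j12 k s * idΔ k t) =
    sand (S k) LinearMap.id (antiMul k s) ((epsT k).lTensor H t) := by
  induction s with
  | zero => simp
  | add a b ha hb => simp only [map_add, add_mul, sand_add, LinearMap.add_apply, ha, hb]
  | tmul a b =>
    induction t with
    | zero => simp
    | add a b ha hb => simp only [map_add, mul_add, ha, hb]
    | tmul c d =>
      simp only [idΔ_tmul, LinearMap.lTensor_tmul, sand_tmul, antiMul_tmul, j12_tmul]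
      rw [show epsT k d = LinearMap.mul' k H ((S k).lTensor H (Δ k d)) from rfl]
      generalize Δ k d = x
      induction x with
      | zero => simp
      | add a b ha hb => simp only [map_add, TensorProduct.tmul_add, mul_add, add_mul, ha, hb]
      | tmul x y => simp [S, antipode_mul, mul_assoc]

lemma antiMul₃_leftComm_Δid_mul_j12 (s t : H ⊗[k] H) :
    antiMul₃ k (TensorProduct.leftComm k H H H (Δid k t) * j12 k s) =
    sand (S k ∘ₗ S k) (antiMul k ∘ₗ LinearMap.mulRight k s ∘ₗ (TensorProduct.mk k H H).flip 1) 1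
      (TensorProduct.map (epsS k) LinearMap.id t) := by
  induction t with
  | zero => simp
  | add a b ha hb => simp only [map_add, add_mul, ha, hb]
  | tmul c d =>
    simp only [Δid_tmul, TensorProduct.map_tmul, sand_tmul]
    rw [show epsS k c = LinearMap.mul' k H ((S k).rTensor H (Δ k c)) from rfl]
    generalize Δ k c = x
    induction x with
    | zero => simp
    | add a b ha hb => simp only [map_add, TensorProduct.add_tmul, mul_add, add_mul, ha, hb]
    | tmul x y =>
      induction s with
      | zero => simp
      | add a b ha hb =>
        simp only [map_add, mul_add, ha, hb, LinearMap.comp_apply, LinearMap.mulRight_apply]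
      | tmul a b => simp [S, antipode_mul, mul_assoc]

end

section
variable (k : Type u) {H : Type u} [Field k] [Ring H] [Algebra k H] [Quasitriangular k H]

variable (H) in
/-- The Drinfeld element `u = S(R₂) R₁`. -/
noncomputable def drinfeld : H := antiMul k (R : H ⊗[k] H)

/-- `Δᵒᵖ(h) R = R Δ(h)` in the first two of three factors. -/
lemma leftComm_Δid_mul_R (t : H ⊗[k] H) :
    TensorProduct.leftComm k H H H (Δid k t) * j12 k R = j12 k R * Δid k t := by
  have h1 : ∀ (x : H ⊗[k] H) (b : H), TensorProduct.leftComm k H H H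
      (TensorProduct.assoc k H H H (x ⊗ₜ b)) = TensorProduct.assoc k H H H (flip k x ⊗ₜ b) := by
    intro x b
    induction x with
    | zero => simp
    | add a b ha hb => simp only [map_add, TensorProduct.add_tmul, ha, hb]
    | tmul x y => simp
  have h2 : ∀ (x y : H ⊗[k] H) (b : H), TensorProduct.assoc k H H H (x ⊗ₜ b) * j12 k y =
      TensorProduct.assoc k H H H ((x * y) ⊗ₜ b) := by
    intro x y b
    have := map_mul (Algebra.TensorProduct.assoc k k k H H H) (x ⊗ₜ b) (y ⊗ₜ (1 : H))
    rw [Algebra.TensorProduct.tmul_mul_tmul, mul_one] at this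
    exact this.symm
  have h3 : ∀ (x y : H ⊗[k] H) (b : H), j12 k y * TensorProduct.assoc k H H H (x ⊗ₜ b) =
      TensorProduct.assoc k H H H ((y * x) ⊗ₜ b) := by
    intro x y b
    have := map_mul (Algebra.TensorProduct.assoc k k k H H H) (y ⊗ₜ (1 : H)) (x ⊗ₜ b)
    rw [Algebra.TensorProduct.tmul_mul_tmul, one_mul] at this
    exact this.symm
  induction t with
  | zero => simp
  | add a b ha hb => simp only [map_add, add_mul, mul_add, ha, hb]
  | tmul a b => rw [Δid_tmul, h1, h2, h3, R_comul]

lemma drinfeld_mul_eq_sand (h : H) :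
    sand (S k) LinearMap.id (drinfeld k H) ((epsT k).lTensor H (Δ k h)) = drinfeld k H * h := by
  rw [id_epsT_comul, drinfeld, sand_antiMul, ← mul_assoc, R_mul_one, antiMul_mul_left]

/-- `S²(h) u = u h` -/
lemma antipode_sq_mul_drinfeld (h : H) :
    S k (S k h) * drinfeld k H = drinfeld k H * h := by
  rw [← drinfeld_mul_eq_sand, drinfeld, ← antiMul₃_j12_mul_idΔ, ← Δid_comul, ← leftComm_Δid_mul_R,
    antiMul₃_leftComm_Δid_mul_j12, ← LinearMap.rTensor_def, epsS_id_comul]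
  set r := antiMul k ∘ₗ LinearMap.mulRight k (R : H ⊗[k] H) ∘ₗ (TensorProduct.mk k H H).flip 1
    with hr
  have h1 : ∀ t : H ⊗[k] H, sand (S k ∘ₗ S k) r 1 ((1 ⊗ₜ h) * t) =
      S k (S k h) * sand (S k ∘ₗ S k) r 1 t := by
    intro t
    induction t with
    | zero => simp
    | add a b ha hb => simp only [map_add, mul_add, ha, hb]
    | tmul a b => simp [S, antipode_mul, mul_assoc]
  have h2 : r ∘ₗ epsS k = LinearMap.mulRight k (drinfeld k H) ∘ₗ S k ∘ₗ epsS k := by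
    refine LinearMap.ext fun x => ?_
    simp only [hr, LinearMap.comp_apply, LinearMap.mulRight_apply, LinearMap.flip_apply,
      TensorProduct.mk_apply]
    rw [← R_mul_of_mem_Hs k (epsS_mem k x), antiMul_mul_right, drinfeld]
  rw [h1]
  have h3 : ∀ t : H ⊗[k] H, sand (S k ∘ₗ S k) r 1 ((epsS k).rTensor H t) =
      S k (LinearMap.mul' k H ((S k).lTensor H ((epsS k).rTensor H t))) * drinfeld k H := by
    intro t
    induction t with
    | zero => simp
    | add a b ha hb => simp only [map_add, add_mul, ha, hb]
    | tmul a b =>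
      have := LinearMap.congr_fun h2 a
      simp only [LinearMap.comp_apply, LinearMap.mulRight_apply] at this
      simp only [LinearMap.rTensor_tmul, sand_tmul, this]
      simp [S, antipode_mul, mul_assoc]
  have h4 := h3 (Δ k 1)
  rw [epsS_id_comul_one] at h4
  rw [h4, show LinearMap.mul' k H ((S k).lTensor H (Δ k 1)) = epsT k 1 from rfl, epsT_one,
    show S k (1 : H) = 1 from antipode_one, one_mul]
  rfl

/-- The Drinfeld element is invertible, with inverse `R₂ S²(R₁)`. -/
lemma isUnit_drinfeld : IsUnit (drinfeld k H) := by
  have := QuantumGroupoid.finiteDimensional (k := k) (H := H)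
  set v := LinearMap.mul' k H (TensorProduct.comm k H H ((S k).rTensor H
    ((S k).rTensor H (R : H ⊗[k] H))))
  have h1 : ∀ t : H ⊗[k] H, drinfeld k H * LinearMap.mul' k H (TensorProduct.comm k H H
      ((S k).rTensor H t)) = antiMul k (R * TensorProduct.map (S k) (S k) t) := by
    intro t
    rw [← sand_antiMul, ← drinfeld]
    induction t with
    | zero => simp
    | add a b ha hb => simp only [map_add, mul_add, ha, hb]
    | tmul a b => simp [← mul_assoc, antipode_sq_mul_drinfeld]
  have h2 : TensorProduct.map (S k) (S k) ((S k).rTensor H (R : H ⊗[k] H)) =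
      (S k).rTensor H R := by
    conv_rhs => rw [← map_antipode_R]
    generalize (R : H ⊗[k] H) = t
    induction t with
    | zero => simp
    | add a b ha hb => simp only [map_add, ha, hb]
    | tmul a b => simp
  have h3 : drinfeld k H * v = 1 := by
    rw [h1, h2, R_mul_antipode_R, antiMul_flip_comul_one]
  have hs : Function.Surjective (LinearMap.mulLeft k (drinfeld k H)) := fun y =>
    ⟨v * y, by rw [LinearMap.mulLeft_apply, ← mul_assoc, h3, one_mul]⟩
  have hi := LinearMap.injective_iff_surjective.2 hs
  refine ⟨⟨drinfeld k H, v, h3, hi ?_⟩, rfl⟩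
  simp only [LinearMap.mulLeft_apply]
  rw [← mul_assoc, h3, one_mul, mul_one]

/-- `S²` is conjugation by the Drinfeld element, so `S` is injective. -/
lemma antipode_bijective : Function.Bijective (S k (H := H)) := by
  have := QuantumGroupoid.finiteDimensional (k := k) (H := H)
  have hi : Function.Injective (S k (H := H)) := by
    rw [← LinearMap.ker_eq_bot, LinearMap.ker_eq_bot']
    intro x hx
    have h := antipode_sq_mul_drinfeld k x
    rw [hx, map_zero, zero_mul] at h
    exact (isUnit_drinfeld k (H := H)).mul_right_eq_zero.1 h.symm
  exact ⟨hi, LinearMap.injective_iff_surjective.1 hi⟩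

/-! ### The element `R₂₁ R` -/

variable (H) in
/-- The element `R₂₁ R`, which acts as the double braiding. -/
noncomputable def doubleR : H ⊗[k] H := flip k R * R

lemma doubleR_mul_comul (h : H) : doubleR k H * Δ k h = Δ k h * doubleR k H := by
  rw [doubleR, mul_assoc, ← R_comul, ← mul_assoc, ← map_mul, ← R_comul, map_mul, flip_flip,
    mul_assoc]

lemma doubleR_mul_comul_one : doubleR k H * Δ k 1 = doubleR k H := by
  rw [doubleR, mul_assoc, R_mul_one]

/-- `(R₂₁ R)₂₁ = (S ⊗ S)(R₂₁ R)` -/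
lemma map_antipode_doubleR :
    TensorProduct.map (S k) (S k) (doubleR k H) = flip k (doubleR k H) := by
  have h : ∀ t : H ⊗[k] H, TensorProduct.map (S k) (S k) (flip k t) =
      flip k (TensorProduct.map (S k) (S k) t) := by
    intro t
    induction t with
    | zero => simp
    | add a b ha hb => simp only [map_add, ha, hb]
    | tmul a b => simp
  rw [doubleR, map_antipode_mul, h, map_antipode_R, map_mul, flip_flip]

end
end QG

/-! ### The coproduct of the Drinfeld element -/

namespace QG
open Coalgebra QuantumGroupoid Quasitriangular RibbonQuantumGroupoid

section
variable (k : Type u) {H : Type u} [Field k] [Ring H] [Algebra k H] [Quasitriangular k H]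

/-- A consequence of `(Δ ⊗ id) R = R₁₃ R₂₃`. -/
lemma sand_comul_R {B : Type u} [Ring B] [Algebra k B] (l : H →ₗ[k] B)
    (hl : ∀ x y, l (x * y) = l y * l x) (f : H ⊗[k] H →ₐ[k] B) (m : B) :
    sand l (f.toLinearMap ∘ₗ Δ k) m (R : H ⊗[k] H) =
      sand l (f.toLinearMap ∘ₗ TensorProduct.mk k H H 1)
        (sand l (f.toLinearMap ∘ₗ (TensorProduct.mk k H H).flip 1) m R) R := by
  have h1 : ∀ t : H ⊗[k] H, sand l (f.toLinearMap ∘ₗ Δ k) m t =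
      sand l f.toLinearMap m ((TensorProduct.assoc k H H H).symm (Δid k t)) := by
    intro t
    induction t with
    | zero => simp
    | add a b ha hb => simp only [map_add, ha, hb]
    | tmul a b => simp [Δid_tmul]
  have h2 : ∀ s t : H ⊗[k] H, sand l f.toLinearMap m
      ((TensorProduct.assoc k H H H).symm (j13 k s * j23 k t)) =
      sand l (f.toLinearMap ∘ₗ TensorProduct.mk k H H 1)
        (sand l (f.toLinearMap ∘ₗ (TensorProduct.mk k H H).flip 1) m s) t := by
    intro s t
    induction s with
    | zero => simp
    | add a b ha hb => simp only [map_add, add_mul, sand_add, LinearMap.add_apply, ha, hb]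
    | tmul a b =>
      induction t with
      | zero => simp
      | add a b ha hb => simp only [map_add, mul_add, ha, hb]
      | tmul c d =>
        have : f (a ⊗ₜ[k] c) = f (a ⊗ₜ[k] 1) * f (1 ⊗ₜ[k] c) := by
          rw [← map_mul, Algebra.TensorProduct.tmul_mul_tmul, mul_one, one_mul]
        simp [hl, mul_assoc, this]
  rw [h1, Δid_R, h2]

/-- A consequence of `(id ⊗ Δ) R = R₁₃ R₁₂`. -/
lemma sand_comul_antipode_R (r : H →ₗ[k] H ⊗[k] H) (hr : ∀ x y, r (x * y) = r x * r y)
    (m : H ⊗[k] H) :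
    sand (Δ k ∘ₗ S k) r m (R : H ⊗[k] H) =
      sand (TensorProduct.mk k H H 1 ∘ₗ S k) r
        (sand ((TensorProduct.mk k H H).flip 1 ∘ₗ S k) r m R) R := by
  let l : H ⊗[k] H →ₗ[k] H ⊗[k] H :=
    (TensorProduct.comm k H H).toLinearMap ∘ₗ TensorProduct.map (S k) (S k)
  have hl : l ∘ₗ Δ k = Δ k ∘ₗ S k := LinearMap.ext fun x => (comul_antipode x).symm
  have h1 : ∀ t : H ⊗[k] H, sand (Δ k ∘ₗ S k) r m t = sand l r m (idΔ k t) := by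
    intro t
    rw [← hl]
    induction t with
    | zero => simp
    | add a b ha hb => simp only [map_add, ha, hb]
    | tmul a b => simp
  have h2 : ∀ s t : H ⊗[k] H, sand l r m (j13 k s * j12 k t) =
      sand (TensorProduct.mk k H H 1 ∘ₗ S k) r
        (sand ((TensorProduct.mk k H H).flip 1 ∘ₗ S k) r m s) t := by
    intro s t
    induction s with
    | zero => simp
    | add a b ha hb => simp only [map_add, add_mul, sand_add, LinearMap.add_apply, ha, hb]
    | tmul a b =>
      induction t with
      | zero => simp
      | add a b ha hb => simp only [map_add, mul_add, ha, hb]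
      | tmul c d =>
        have : S k b ⊗ₜ[k] S k d = (1 : H) ⊗ₜ[k] S k d * S k b ⊗ₜ[k] (1 : H) := by
          simp
        simp only [j13_tmul, j12_tmul, Algebra.TensorProduct.tmul_mul_tmul, sand_tmul,
          LinearMap.comp_apply, TensorProduct.mk_apply, LinearMap.flip_apply, one_mul, mul_one, hr,
          l, TensorProduct.map_tmul, LinearEquiv.coe_coe, TensorProduct.comm_tmul]
        rw [this]
        simp only [mul_assoc]
  rw [h1, idΔ_R, h2]

/-- The Yang–Baxter equation. -/
lemma sand_R_yangBaxter (l : H →ₗ[k] H ⊗[k] H) (hl : ∀ x y, l (x * y) = l y * l x)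
    (m : H ⊗[k] H) :
    sand l (TensorProduct.mk k H H 1)
        (sand l ((TensorProduct.mk k H H).flip 1) (m * R) R) (R : H ⊗[k] H) =
      sand l ((TensorProduct.mk k H H).flip 1)
        (sand l (TensorProduct.mk k H H 1) m R) R * R := by
  have h1 := sand_comul_R k l hl (AlgHom.id k (H ⊗[k] H)) (m * R)
  have h2 := sand_comul_R k l hl (flip k) m
  have e1 : (flip k).toLinearMap ∘ₗ TensorProduct.mk k H H 1 = (TensorProduct.mk k H H).flip 1 :=
    rfl
  have e2 : (flip k).toLinearMap ∘ₗ (TensorProduct.mk k H H).flip 1 = TensorProduct.mk k H H 1 :=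
    rfl
  rw [e1, e2] at h2
  rw [← h2]
  refine h1.symm.trans ?_
  have e3 : ∀ t : H ⊗[k] H, sand l ((AlgHom.id k (H ⊗[k] H)).toLinearMap ∘ₗ Δ k) (m * R) t =
      sand l ((flip k).toLinearMap ∘ₗ Δ k) m t * R := by
    intro t
    induction t with
    | zero => simp
    | add a b ha hb => simp only [map_add, add_mul, ha, hb]
    | tmul a b =>
      simp only [sand_tmul, LinearMap.comp_apply, AlgHom.toLinearMap_apply, AlgHom.id_apply,
        mul_assoc, R_comul]
  exact e3 _

/-- `Δ(u) R₂₁ R = (u ⊗ u) Δ(1)` -/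
lemma comul_drinfeld_mul_doubleR :
    Δ k (drinfeld k H) * doubleR k H = (drinfeld k H ⊗ₜ drinfeld k H) * Δ k 1 := by
  set u := drinfeld k H with hu
  let l₁ : H →ₗ[k] H ⊗[k] H := (TensorProduct.mk k H H).flip 1 ∘ₗ S k
  let l₂ : H →ₗ[k] H ⊗[k] H := TensorProduct.mk k H H 1 ∘ₗ S k
  let r₁ : H →ₗ[k] H ⊗[k] H := (TensorProduct.mk k H H).flip 1
  let r₂ : H →ₗ[k] H ⊗[k] H := TensorProduct.mk k H H 1
  have hl₁ : ∀ x y, l₁ (x * y) = l₁ y * l₁ x := fun x y => by simp [l₁, S, antipode_mul]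
  have hl₂ : ∀ x y, l₂ (x * y) = l₂ y * l₂ x := fun x y => by simp [l₂, S, antipode_mul]
  have hr₁ : ∀ x y, r₁ (x * y) = r₁ x * r₁ y := fun x y => by simp [r₁]
  have hr₂ : ∀ x y, r₂ (x * y) = r₂ x * r₂ y := fun x y => by simp [r₂]
  have hΔS : ∀ x y : H, (Δ k ∘ₗ S k) (x * y) = (Δ k ∘ₗ S k) y * (Δ k ∘ₗ S k) x := fun x y => by
    simp [S, antipode_mul, Δ, comul_mul]
  -- expand `Δ(u) Q` into four copies of the `R`-matrix acting on `Q`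
  have s1 : Δ k u * doubleR k H = sand (Δ k ∘ₗ S k) (Δ k) (doubleR k H) R := by
    rw [hu, drinfeld]
    generalize (R : H ⊗[k] H) = t
    induction t with
    | zero => simp
    | add a b ha hb => simp only [map_add, add_mul, ha, hb]
    | tmul a b =>
      rw [antiMul_tmul, sand_tmul, mul_assoc, doubleR_mul_comul, ← mul_assoc, LinearMap.comp_apply]
      congr 1
      exact comul_mul _ _
  have s2 : Δ k u * doubleR k H =
      sand l₂ r₂ (sand l₁ r₂ (sand l₂ r₁ (sand l₁ r₁ (doubleR k H) R) R) R) R := by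
    rw [s1]
    refine (sand_comul_R k (Δ k ∘ₗ S k) hΔS (AlgHom.id k (H ⊗[k] H)) (doubleR k H)).trans ?_
    change sand (Δ k ∘ₗ S k) r₂ (sand (Δ k ∘ₗ S k) r₁ (doubleR k H) R) R = _
    rw [sand_comul_antipode_R k r₂ hr₂, sand_comul_antipode_R k r₁ hr₁]
  have s3 : ∀ (m s t : H ⊗[k] H), sand l₁ r₂ (sand l₂ r₁ m s) t = sand l₂ r₁ (sand l₁ r₂ m t) s := by
    intro m s t
    induction s with
    | zero => simp
    | add a b ha hb => simp only [map_add, sand_add, LinearMap.add_apply, ha, hb]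
    | tmul a b =>
      induction t with
      | zero => simp
      | add a b ha hb => simp only [map_add, sand_add, LinearMap.add_apply, ha, hb]
      | tmul c d =>
        have e1 : l₁ d * l₂ b = l₂ b * l₁ d := by simp [l₁, l₂]
        have e2 : r₁ a * r₂ c = r₂ c * r₁ a := by simp [r₁, r₂]
        simp only [sand_tmul, mul_assoc, e2]
        simp only [← mul_assoc, e1]
  have s4 : Δ k u * doubleR k H =
      sand l₂ r₁ (sand l₂ r₂ (sand l₁ r₁ (sand l₁ r₂ (flip k R) R) R) R) R * R := by
    rw [s2, s3, doubleR, sand_R_yangBaxter k l₁ hl₁, sand_R_yangBaxter k l₂ hl₂]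
  -- evaluate the four sandwiches one after the other
  have t1 : sand l₁ r₂ (flip k R) (R : H ⊗[k] H) = (S k).rTensor H (flip k (Δ k 1)) := by
    have e1 : ∀ s t : H ⊗[k] H, sand l₁ r₂ (flip k s) t = flip k (sand l₂ r₁ s t) := by
      intro s t
      induction s with
      | zero => simp
      | add a b ha hb => simp only [map_add, sand_add, LinearMap.add_apply, ha, hb]
      | tmul a b =>
        induction t with
        | zero => simp
        | add a b ha hb => simp only [map_add, ha, hb]
        | tmul c d => simp [l₁, r₂, l₂, r₁]
    rw [e1, sand_antipode_R]
    generalize Δ k (1 : H) = t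
    induction t with
    | zero => simp
    | add a b ha hb => simp only [map_add, ha, hb]
    | tmul a b => simp
  have t2 : sand l₁ r₁ ((S k).rTensor H (flip k (Δ k 1))) (R : H ⊗[k] H) =
      (u ⊗ₜ 1) * flip k (Δ k 1) := by
    have e1 : ∀ (x y : H) (s : H ⊗[k] H), sand l₁ r₁ (S k x ⊗ₜ y) s =
        antiMul k ((1 ⊗ₜ x) * s) ⊗ₜ y := by
      intro x y s
      induction s with
      | zero => simp
      | add a b ha hb => simp only [map_add, mul_add, TensorProduct.add_tmul, ha, hb]
      | tmul a b => simp [l₁, r₁, S, antipode_mul]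
    rw [← id_epsT_comul_one]
    generalize Δ k (1 : H) = t
    induction t with
    | zero => simp
    | add a b ha hb => simp only [map_add, mul_add, sand_add, LinearMap.add_apply, ha, hb]
    | tmul a b =>
      simp only [LinearMap.lTensor_tmul, flip_tmul, LinearMap.rTensor_tmul]
      rw [e1, ← R_mul_of_mem_Ht k (epsT_mem k b), antiMul_mul_left]
      simp [hu, drinfeld]
  have t3 : sand l₂ r₂ ((u ⊗ₜ 1) * flip k (Δ k 1)) (R : H ⊗[k] H) =
      (u ⊗ₜ 1) * (S k).lTensor H (flip k (Δ k 1)) * (1 ⊗ₜ u) := by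
    have e1 : ∀ (x y : H) (s : H ⊗[k] H), sand l₂ r₂ (x ⊗ₜ y) s =
        x ⊗ₜ antiMul k ((y ⊗ₜ 1) * s) := by
      intro x y s
      induction s with
      | zero => simp
      | add a b ha hb => simp only [map_add, mul_add, TensorProduct.tmul_add, ha, hb]
      | tmul a b => simp [l₂, r₂, mul_assoc]
    rw [← epsS_id_comul_one]
    generalize Δ k (1 : H) = t
    induction t with
    | zero => simp
    | add a b ha hb =>
      simp only [map_add, mul_add, add_mul, sand_add, LinearMap.add_apply, ha, hb]
    | tmul a b =>
      simp only [LinearMap.rTensor_tmul, flip_tmul, LinearMap.lTensor_tmul,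
        Algebra.TensorProduct.tmul_mul_tmul, one_mul, mul_one]
      rw [e1, ← R_mul_of_mem_Hs k (epsS_mem k a), antiMul_mul_right]
      simp [hu, drinfeld]
  have t4 : sand l₂ r₁ ((u ⊗ₜ 1) * (S k).lTensor H (flip k (Δ k 1)) * (1 ⊗ₜ u)) (R : H ⊗[k] H) =
      (u ⊗ₜ 1) * (S k).lTensor H R * (1 ⊗ₜ u) := by
    have e1 : ∀ s t : H ⊗[k] H, sand l₂ r₁ ((u ⊗ₜ 1) * (S k).lTensor H s * (1 ⊗ₜ u)) t =
        (u ⊗ₜ 1) * (S k).lTensor H (s * t) * (1 ⊗ₜ u) := by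
      intro s t
      induction s with
      | zero => simp
      | add a b ha hb =>
        simp only [map_add, mul_add, add_mul, sand_add, LinearMap.add_apply, ha, hb]
      | tmul a b =>
        induction t with
        | zero => simp
        | add a b ha hb => simp only [map_add, mul_add, add_mul, ha, hb]
        | tmul c d => simp [l₂, r₁, S, antipode_mul, mul_assoc]
    rw [e1, one_mul_R]
  have t5 : ∀ s t : H ⊗[k] H, (u ⊗ₜ 1) * (S k).lTensor H s * (1 ⊗ₜ u) * t =
      (u ⊗ₜ 1) * (S k).lTensor H (sand l₂ r₁ s t) * (1 ⊗ₜ u) := by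
    intro s t
    induction s with
    | zero => simp
    | add a b ha hb =>
      simp only [map_add, mul_add, add_mul, sand_add, LinearMap.add_apply, ha, hb]
    | tmul a b =>
      induction t with
      | zero => simp
      | add a b ha hb => simp only [map_add, mul_add, add_mul, ha, hb]
      | tmul c d =>
        have := antipode_sq_mul_drinfeld k d
        simp only [S] at this
        simp [l₂, r₁, S, antipode_mul, mul_assoc, hu, this]
  rw [s4, t1, t2, t3, t4, t5, sand_antipode_R]
  generalize Δ k (1 : H) = t
  induction t with
  | zero => simp
  | add a b ha hb => simp only [map_add, mul_add, add_mul, ha, hb]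
  | tmul a b =>
    simp only [LinearMap.lTensor_tmul, Algebra.TensorProduct.tmul_mul_tmul, one_mul, mul_one]
    rw [hu, antipode_sq_mul_drinfeld]

end

section
variable (k : Type u) {H : Type u} [Field k] [Ring H] [Algebra k H] [RibbonQuantumGroupoid k H]

variable (H) in
/-- The group-like element `g = u ν`, which turns ordinary traces into quantum traces. -/
noncomputable def pivot : H := drinfeld k H * ν k

lemma isUnit_pivot : IsUnit (pivot k H) := (isUnit_drinfeld k).mul isUnit_ν

/-- `S²(h) g = g h` -/
lemma antipode_sq_mul_pivot (h : H) : S k (S k h) * pivot k H = pivot k H * h := by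
  rw [pivot, ← mul_assoc, antipode_sq_mul_drinfeld, mul_assoc, mul_assoc,
    (ν_central (k := k) (H := H)).comm h]

/-- `Δ(g) = (g ⊗ g) Δ(1)` -/
lemma comul_pivot : Δ k (pivot k H) = (pivot k H ⊗ₜ pivot k H) * Δ k 1 := by
  have h1 : Δ k (pivot k H) = Δ k (drinfeld k H) * Δ k (ν k) := comul_mul _ _
  have h2 : ∀ t : H ⊗[k] H, t * (ν k ⊗ₜ ν k) = (ν k ⊗ₜ ν k) * t := by
    intro t
    induction t with
    | zero => simp
    | add a b ha hb => simp only [mul_add, add_mul, ha, hb]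
    | tmul a b =>
      have := fun h => (ν_central (k := k) (H := H)).comm h
      simp [(this a).eq, (this b).eq]
  rw [h1, comul_ν, ← doubleR, ← mul_assoc, comul_drinfeld_mul_doubleR, mul_assoc, h2, ← mul_assoc,
    Algebra.TensorProduct.tmul_mul_tmul]
  rfl

end
end QG

/-! ### Averaging with a Haar integral -/

namespace QG
open Coalgebra QuantumGroupoid Quasitriangular RibbonQuantumGroupoid

section
variable (k : Type u) {H : Type u} [Field k] [Ring H] [Algebra k H] [QuantumGroupoid k H]

/-- `(1 ⊗ h₍₁₎) q (1 ⊗ S(h₍₂₎)) = (S(h₍₁₎) ⊗ 1) q (h₍₂₎ ⊗ 1)` for `q` commuting with the image of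
the coproduct: conjugation can be moved from the second factor of `q` to the first. -/
lemma adjoint_snd_eq_adjoint_fst (q : H ⊗[k] H) (hq : ∀ h, q * Δ k h = Δ k h * q)
    (hq1 : q * Δ k 1 = q) (h : H) :
    sand (TensorProduct.mk k H H 1) (TensorProduct.mk k H H 1 ∘ₗ S k) q
      (TensorProduct.comm k H H (Δ k h)) =
    sand ((TensorProduct.mk k H H).flip 1 ∘ₗ S k) ((TensorProduct.mk k H H).flip 1) q
      (TensorProduct.comm k H H (Δ k h)) := by
  let l : H →ₗ[k] H ⊗[k] H := (TensorProduct.mk k H H).flip 1 ∘ₗ S k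
  let r : H ⊗[k] H →ₗ[k] H ⊗[k] H :=
    LinearMap.mul' k (H ⊗[k] H) ∘ₗ TensorProduct.map (Δ k) (TensorProduct.mk k H H 1 ∘ₗ S k)
  have h1 : ∀ x : H, (1 ⊗ₜ x) * q = sand l (Δ k) q (TensorProduct.comm k H H (Δ k x)) := by
    intro x
    have e1 : ∀ t : H ⊗[k] H, sand l (Δ k) q (TensorProduct.comm k H H t) =
        mulFst k (S k) (idΔ k t) * q := by
      intro t
      induction t with
      | zero => simp
      | add a b ha hb => simp only [map_add, add_mul, ha, hb]
      | tmul a b =>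
        rw [TensorProduct.comm_tmul, sand_tmul, mul_assoc, hq, ← mul_assoc, idΔ_tmul]
        congr 1
        generalize Δ k b = s
        induction s with
        | zero => simp
        | add a b ha hb => simp only [map_add, mul_add, TensorProduct.tmul_add, ha, hb]
        | tmul a b => simp [l]
    rw [e1, ← Δid_comul, mulFst_Δid, epsS_id_comul, mul_assoc, ← hq, hq1]
  have h2 : ∀ t : H ⊗[k] H, sand (TensorProduct.mk k H H 1) (TensorProduct.mk k H H 1 ∘ₗ S k) q
      (TensorProduct.comm k H H t) =
      sand l r q (TensorProduct.comm k H (H ⊗[k] H) (Δid k t)) := by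
    intro t
    induction t with
    | zero => simp
    | add a b ha hb => simp only [map_add, ha, hb]
    | tmul a b =>
      rw [TensorProduct.comm_tmul, sand_tmul, TensorProduct.mk_apply, h1, Δid_tmul]
      generalize Δ k a = s
      induction s with
      | zero => simp
      | add a b ha hb => simp only [map_add, add_mul, TensorProduct.add_tmul, ha, hb]
      | tmul c d => simp [r, mul_assoc]
  have h3 : ∀ x : H, r (Δ k x) = Δ k 1 * (x ⊗ₜ 1) := by
    intro x
    let m : H ⊗[k] (H ⊗[k] H) →ₗ[k] H ⊗[k] H := (LinearMap.mul' k H ∘ₗ (S k).lTensor H).lTensor H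
    have e1 : ∀ t : H ⊗[k] H, r t = m (Δid k t) := by
      intro t
      induction t with
      | zero => simp
      | add a b ha hb => simp only [map_add, ha, hb]
      | tmul a b =>
        rw [Δid_tmul]
        simp only [r, LinearMap.comp_apply, TensorProduct.map_tmul, LinearMap.mul'_apply,
          TensorProduct.mk_apply]
        generalize Δ k a = s
        induction s with
        | zero => simp
        | add a b ha hb => simp only [map_add, add_mul, TensorProduct.add_tmul, ha, hb]
        | tmul c d => simp [m]
    have e2 : ∀ t : H ⊗[k] H, m (idΔ k t) = (epsT k).lTensor H t := by
      intro t
      induction t with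
      | zero => simp
      | add a b ha hb => simp only [map_add, ha, hb]
      | tmul a b => simp [m, epsT]
    rw [e1, Δid_comul, e2, id_epsT_comul]
  rw [h2, Δid_comul]
  generalize Δ k h = t
  induction t with
  | zero => simp
  | add a b ha hb => simp only [map_add, ha, hb]
  | tmul a b =>
    rw [idΔ_tmul, TensorProduct.comm_tmul, sand_tmul, h3, TensorProduct.comm_tmul, sand_tmul,
      ← mul_assoc, mul_assoc _ q, hq1]
    rfl

/-- The element `h₍₁₎ ⊗ S(h₍₂₎)`; for a Haar integral `h` it is a separability idempotent. -/
noncomputable def sepElt (h : H) : H ⊗[k] H := (S k).lTensor H (Δ k h)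

lemma mul'_sepElt {h : H} (hh : IsHaarIntegral k h) : LinearMap.mul' k H (sepElt k h) = 1 :=
  hh.epsT_eq_one

lemma lTensor_antipode_mul (s t : H ⊗[k] H) : (S k).lTensor H (s * t) =
    sand ((TensorProduct.mk k H H).flip 1) (TensorProduct.mk k H H 1 ∘ₗ S k) ((S k).lTensor H t)
      (TensorProduct.comm k H H s) := by
  induction s with
  | zero => simp
  | add a b ha hb => simp only [map_add, add_mul, ha, hb]
  | tmul a b =>
    induction t with
    | zero => simp
    | add a b ha hb => simp only [map_add, mul_add, sand_add, LinearMap.add_apply, ha, hb]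
    | tmul c d => simp [S, antipode_mul]

lemma sepElt_comm_of_mem {h : H} (hh : IsHaarIntegral k h) {y : H} (hy : y ∈ Hs k H) :
    sepElt k h * (1 ⊗ₜ S k y) = (S k y ⊗ₜ 1) * sepElt k h := by
  have e1 : sepElt k h * (1 ⊗ₜ S k y) = (S k).lTensor H ((1 ⊗ₜ y) * Δ k h) := by
    rw [lTensor_antipode_mul]
    simp only [TensorProduct.comm_tmul, sand_tmul, LinearMap.comp_apply, LinearMap.flip_apply,
      TensorProduct.mk_apply, ← Algebra.TensorProduct.one_def, one_mul, sepElt]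
  have e2 : (S k y ⊗ₜ 1) * sepElt k h = (S k).lTensor H ((S k y ⊗ₜ 1) * Δ k h) := by
    rw [lTensor_antipode_mul]
    simp only [TensorProduct.comm_tmul, sand_tmul, LinearMap.comp_apply, LinearMap.flip_apply,
      TensorProduct.mk_apply, S, antipode_one, ← Algebra.TensorProduct.one_def, mul_one, sepElt]
  have hz : S k y ∈ Ht k H := epsT_eq_antipode_of_mem k hy ▸ epsT_mem k y
  have e3 : Δ k (y * h) = Δ k y * Δ k h := comul_mul _ _
  have e4 : Δ k (S k y * h) = Δ k (S k y) * Δ k h := comul_mul _ _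
  rw [e1, e2, ← one_comul k h, ← mul_assoc, ← mul_assoc, ← (comul_of_mem_Hs k hy).2,
    ← comul_of_mem_Ht_left k hz, ← e3, ← e4, hh.left, epsT_eq_antipode_of_mem k hy]

/-- `y h₍₁₎ ⊗ S(h₍₂₎) = h₍₁₎ ⊗ S(h₍₂₎) y` for a Haar integral `h` -/
lemma sepElt_comm {h : H} (hh : IsHaarIntegral k h) (y : H) :
    (y ⊗ₜ 1) * sepElt k h = sepElt k h * (1 ⊗ₜ y) := by
  let D : H ⊗[k] H →ₗ[k] H ⊗[k] H := sand ((TensorProduct.mk k H H).flip 1)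
    (TensorProduct.mk k H H 1) (sepElt k h) ∘ₗ (TensorProduct.comm k H H).toLinearMap
  have hD : ∀ a b : H, D (a ⊗ₜ b) = (a ⊗ₜ 1) * sepElt k h * (1 ⊗ₜ b) := fun a b => rfl
  have hD1 : ∀ (a : H) (s : H ⊗[k] H), D ((a ⊗ₜ 1) * s) = (a ⊗ₜ 1) * D s := by
    intro a s
    induction s with
    | zero => simp
    | add a b ha hb => simp only [map_add, mul_add, ha, hb]
    | tmul c d =>
      rw [hD, ← mul_assoc, ← mul_assoc, Algebra.TensorProduct.tmul_mul_tmul, hD,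
        Algebra.TensorProduct.tmul_mul_tmul]
      simp only [one_mul]
  have hD2 : ∀ (a : H) (s : H ⊗[k] H), D (s * (1 ⊗ₜ a)) = D s * (1 ⊗ₜ a) := by
    intro a s
    induction s with
    | zero => simp
    | add a b ha hb => simp only [map_add, add_mul, ha, hb]
    | tmul c d =>
      rw [hD, mul_assoc _ _ (1 ⊗ₜ a), Algebra.TensorProduct.tmul_mul_tmul, hD,
        Algebra.TensorProduct.tmul_mul_tmul]
      simp only [mul_one]
  have hD3 : ∀ t : H ⊗[k] H, D ((S k).lTensor H t) = (S k).lTensor H (t * Δ k h) := by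
    intro t
    rw [lTensor_antipode_mul]
    induction t with
    | zero => simp
    | add a b ha hb => simp only [map_add, ha, hb]
    | tmul a b => rfl
  have hD4 : ∀ x : H, D ((S k).lTensor H (Δ k x)) = D (epsT k x ⊗ₜ 1) := by
    intro x
    have e1 : Δ k (x * h) = Δ k x * Δ k h := comul_mul _ _
    have e2 : Δ k (epsT k x * h) = Δ k (epsT k x) * Δ k h := comul_mul _ _
    have e3 : epsT k x ⊗ₜ[k] (1 : H) = (S k).lTensor H (epsT k x ⊗ₜ 1) := by
      simp [S, antipode_one]
    rw [hD3, ← e1, hh.left, e2, comul_of_mem_Ht_left k (epsT_mem k x), mul_assoc, one_comul]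
    conv_rhs => rw [e3, hD3]
  let m : H ⊗[k] (H ⊗[k] H) →ₗ[k] H ⊗[k] H := (LinearMap.mul' k H ∘ₗ (S k).rTensor H).lTensor H
  have m1 : ∀ t : H ⊗[k] H, m (idΔ k t) = (epsS k).lTensor H t := by
    intro t
    induction t with
    | zero => simp
    | add a b ha hb => simp only [map_add, ha, hb]
    | tmul a b => simp [m, epsS]
  have m2 : ∀ t : H ⊗[k] H, D (m (Δid k t)) = D ((epsT k).rTensor H t) := by
    intro t
    induction t with
    | zero => simp
    | add a b ha hb => simp only [map_add, ha, hb]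
    | tmul a b =>
      have e1 : ∀ s : H ⊗[k] H, m (TensorProduct.assoc k H H H (s ⊗ₜ b)) =
          (S k).lTensor H s * (1 ⊗ₜ b) := by
        intro s
        induction s with
        | zero => simp
        | add a b ha hb => simp only [map_add, add_mul, TensorProduct.add_tmul, ha, hb]
        | tmul c d => simp [m]
      have e2 : epsT k a ⊗ₜ[k] b = (epsT k a ⊗ₜ 1) * (1 ⊗ₜ b) := by simp
      rw [Δid_tmul, e1, hD2, hD4, ← hD2, LinearMap.rTensor_tmul, ← e2]
  have h1 : D ((S k).lTensor H (Δ k 1)) = sepElt k h := by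
    rw [hD3, one_comul]; rfl
  have h2 : D ((S k).rTensor H (Δ k 1)) = sepElt k h := by
    rw [← comm_map_antipode_comul_one, ← epsS_id_comul_one]
    have e1 : ∀ t : H ⊗[k] H, D ((S k).rTensor H (TensorProduct.comm k H H
        (TensorProduct.map (S k) (S k) ((epsS k).rTensor H t)))) =
        (S k (LinearMap.mul' k H ((S k).lTensor H ((epsS k).rTensor H t))) ⊗ₜ 1) *
          sepElt k h := by
      intro t
      induction t with
      | zero => simp
      | add a b ha hb => simp only [map_add, add_mul, TensorProduct.add_tmul, ha, hb]
      | tmul a b =>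
        simp only [LinearMap.rTensor_tmul, TensorProduct.map_tmul, TensorProduct.comm_tmul, hD,
          LinearMap.lTensor_tmul, LinearMap.mul'_apply]
        rw [mul_assoc, sepElt_comm_of_mem k hh (epsS_mem k a), ← mul_assoc]
        simp [S, antipode_mul]
    rw [e1, epsS_id_comul_one,
      show LinearMap.mul' k H ((S k).lTensor H (Δ k 1)) = epsT k 1 from rfl, epsT_one,
      show S k (1 : H) = 1 from antipode_one, ← Algebra.TensorProduct.one_def, one_mul]
  have e1 : (epsT k).rTensor H (Δ k 1 * (1 ⊗ₜ y)) = (S k).rTensor H (Δ k 1) * (1 ⊗ₜ y) := by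
    rw [← epsT_one_left]
    generalize Δ k (1 : H) = t
    induction t with
    | zero => simp
    | add a b ha hb => simp only [map_add, add_mul, ha, hb]
    | tmul a b => simp
  calc (y ⊗ₜ 1) * sepElt k h = D ((epsS k).lTensor H (Δ k y)) := by
        rw [id_epsS_comul, hD1, h1]
    _ = D ((epsT k).rTensor H (Δ k y)) := by rw [← m1, ← Δid_comul, m2]
    _ = sepElt k h * (1 ⊗ₜ y) := by rw [epsT_id_comul, e1, hD2, h2]

lemma comm_sepElt_mul {B : Type*} [Ring B] [Algebra k B] (f : H →ₐ[k] B) {h : H}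
    (hh : IsHaarIntegral k h) (b : B) (y : H) :
    f y * sand f.toLinearMap f.toLinearMap b (TensorProduct.comm k H H (sepElt k h)) =
      sand f.toLinearMap f.toLinearMap b (TensorProduct.comm k H H (sepElt k h)) * f y := by
  have h1 : ∀ t : H ⊗[k] H, f y * sand f.toLinearMap f.toLinearMap b (TensorProduct.comm k H H t) =
      sand f.toLinearMap f.toLinearMap b (TensorProduct.comm k H H ((y ⊗ₜ 1) * t)) := by
    intro t
    induction t with
    | zero => simp
    | add c d hc hd => simp only [map_add, mul_add, hc, hd]
    | tmul c d => simp [mul_assoc]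
  have h2 : ∀ t : H ⊗[k] H, sand f.toLinearMap f.toLinearMap b (TensorProduct.comm k H H t) * f y =
      sand f.toLinearMap f.toLinearMap b (TensorProduct.comm k H H (t * (1 ⊗ₜ y))) := by
    intro t
    induction t with
    | zero => simp
    | add c d hc hd => simp only [map_add, add_mul, hc, hd]
    | tmul c d => simp [mul_assoc]
  rw [h1, h2, sepElt_comm k hh]

/-- Maschke's theorem for quantum groupoids. -/
lemma isSemisimpleRing_of_isHaarIntegral {h : H} (hh : IsHaarIntegral k h) :
    IsSemisimpleRing H := by
  refine (isSemisimpleModule_iff H H).2 ⟨fun p => ?_⟩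
  obtain ⟨π, hπ⟩ := LinearMap.exists_leftInverse_of_injective (p.restrictScalars k).subtype
    (Submodule.ker_subtype _)
  -- average the `k`-linear projection onto `p` to an `H`-linear one
  let P : Module.End k H := sand (Algebra.lmul k H).toLinearMap (Algebra.lmul k H).toLinearMap
    ((p.restrictScalars k).subtype ∘ₗ π) (TensorProduct.comm k H H (sepElt k h))
  have hP : ∀ y x, P (y * x) = y * P x := fun y x =>
    (LinearMap.congr_fun (comm_sepElt_mul k (Algebra.lmul k H) hh
      ((p.restrictScalars k).subtype ∘ₗ π) y) x).symm
  have hmem : ∀ x, P x ∈ p := by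
    intro x
    simp only [P]
    generalize sepElt k h = t
    induction t with
    | zero => simp
    | add a b ha hb =>
      simp only [map_add, LinearMap.add_apply]
      exact p.add_mem ha hb
    | tmul a b =>
      exact p.smul_mem a (π (b * x)).2
  have hid : ∀ x ∈ p, P x = x := by
    intro x hx
    have e : ∀ t : H ⊗[k] H, sand (Algebra.lmul k H).toLinearMap (Algebra.lmul k H).toLinearMap
        ((p.restrictScalars k).subtype ∘ₗ π) (TensorProduct.comm k H H t) x =
        LinearMap.mul' k H t * x := by
      intro t
      induction t with
      | zero => simp
      | add a b ha hb => simp only [map_add, LinearMap.add_apply, add_mul, ha, hb]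
      | tmul a b =>
        have h1 := LinearMap.congr_fun hπ ⟨b * x, p.smul_mem b hx⟩
        have h2 := congrArg Subtype.val h1
        change a * (π (b * x) : H) = a * b * x
        rw [mul_assoc]
        exact congrArg (a * ·) h2
    rw [e, mul'_sepElt k hh, one_mul]
  refine ⟨_, LinearMap.isCompl_of_proj (f := { toFun := fun x => ⟨P x, hmem x⟩
                                               map_add' := fun x y => by ext; simp
                                               map_smul' := fun y x => by ext; exact hP y x })
    fun x => ?_⟩
  ext
  exact hid x x.2

end

section
variable (k : Type u) {H : Type u} [Field k] [Ring H] [Algebra k H] [RibbonQuantumGroupoid k H]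

/-- `S(h₍₂₎) g h₍₁₎ = g` for a Haar integral `h` -/
lemma sand_pivot_sepElt {h : H} (hh : IsHaarIntegral k h) :
    sand LinearMap.id LinearMap.id (pivot k H) (sepElt k h) = pivot k H := by
  have e : ∀ t : H ⊗[k] H, sand LinearMap.id LinearMap.id (pivot k H) ((S k).lTensor H t) =
      S k (LinearMap.mul' k H ((S k).rTensor H t)) * pivot k H := by
    intro t
    induction t with
    | zero => simp
    | add a b ha hb => simp only [map_add, add_mul, ha, hb]
    | tmul a b =>
      have := antipode_sq_mul_pivot k a
      simp only [S] at this
      simp [S, antipode_mul, mul_assoc, this]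
  rw [sepElt, e]
  have h1 : LinearMap.mul' k H ((S k).rTensor H (Δ k h)) = 1 := hh.epsS_eq_one
  rw [h1, show S k (1 : H) = 1 from antipode_one, one_mul]

end
end QG

/-! ### Simple objects and domination -/

namespace QG

section
universe v₁ u₁
variable {k : Type*} [Field k] {C : Type u₁} [Category.{v₁} C] [Preadditive C]

lemma dominates_of_fintype {I : Type} {V : I → C} {X : C} {ι : Type*} [Fintype ι] (i : ι → I)
    (f : ∀ r, V (i r) ⟶ X) (g : ∀ r, X ⟶ V (i r)) (h : 𝟙 X = ∑ r, g r ≫ f r) :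
    Dominates V X := by
  let e := Fintype.equivFin ι
  refine ⟨Fintype.card ι, fun r => i (e.symm r), fun r => f (e.symm r), fun r => g (e.symm r), ?_⟩
  rw [h]
  exact (Equiv.sum_comp e.symm (fun r => g r ≫ f r)).symm

lemma Dominates.of_iso {I : Type} {V W : I → C} {X : C} (h : Dominates V X)
    (e : ∀ i, V i ≅ W i) : Dominates W X := by
  obtain ⟨n, i, f, g, hfg⟩ := h
  refine ⟨n, i, fun r => (e (i r)).inv ≫ f r, fun r => g r ≫ (e (i r)).hom, ?_⟩
  simpa using hfg

variable [Linear k C]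

lemma IsSimpleObj.of_iso {X Y : C} (h : IsSimpleObj k X) (e : X ≅ Y) : IsSimpleObj k Y := by
  intro f
  obtain ⟨c, hc, hu⟩ := h (e.hom ≫ f ≫ e.inv)
  refine ⟨c, ?_, fun d hd => hu d ?_⟩
  · have := congrArg (fun t => e.inv ≫ t ≫ e.hom) hc
    simpa using this
  · simp [hd]

lemma IsSimpleObj.id_ne_zero {X : C} (h : IsSimpleObj k X) : 𝟙 X ≠ 0 := by
  intro h0
  obtain ⟨c, -, hu⟩ := h 0
  exact zero_ne_one ((hu 0 (by simp)).trans (hu 1 (by simp [h0])).symm)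

/-- A simple object dominated by a family of simple objects is isomorphic to one of them. -/
lemma IsSimpleObj.exists_iso_of_dominates {I : Type} {V : I → C} {X : C}
    (hV : ∀ i, IsSimpleObj k (V i)) (hX : IsSimpleObj k X) (h : Dominates V X) :
    ∃ i, Nonempty (V i ≅ X) := by
  obtain ⟨n, i, f, g, hfg⟩ := h
  have h1 : ∃ r, g r ≫ f r ≠ 0 := by
    by_contra! h0
    exact hX.id_ne_zero (hfg.trans (Finset.sum_eq_zero fun r _ => h0 r))
  obtain ⟨r, hr⟩ := h1
  obtain ⟨c, hc, -⟩ := hX (g r ≫ f r)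
  obtain ⟨d, hd, -⟩ := hV (i r) (f r ≫ g r)
  have hc0 : c ≠ 0 := by
    rintro rfl
    exact hr (by rw [hc, zero_smul])
  have hf : f r ≠ 0 := by
    intro h0
    exact hr (by rw [h0, Limits.comp_zero])
  have hcd : c = d := by
    have h2 : c • f r = d • f r := by
      calc c • f r = f r ≫ (g r ≫ f r) := by rw [hc]; simp
        _ = (f r ≫ g r) ≫ f r := (Category.assoc _ _ _).symm
        _ = d • f r := by rw [hd]; simp
    exact smul_left_injective k hf h2
  refine ⟨i r, ⟨⟨f r, c⁻¹ • g r, ?_, ?_⟩⟩⟩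
  · rw [Linear.comp_smul, hd, smul_smul, ← hcd, inv_mul_cancel₀ hc0, one_smul]
  · rw [Linear.smul_comp, hc, smul_smul, inv_mul_cancel₀ hc0, one_smul]

end

section MatrixUnits
variable {k ι : Type*} [Field k] [Fintype ι] [DecidableEq ι] {d : ι → ℕ}

/-- The matrix unit `e_{ab}` in the `i`-th factor of a product of matrix algebras. -/
def piMatUnit (k : Type*) [Field k] {ι : Type*} [DecidableEq ι] {d : ι → ℕ} (i : ι)
    (a b : Fin (d i)) : ∀ i, Matrix (Fin (d i)) (Fin (d i)) k :=
  Pi.single i (Matrix.single a b 1)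

lemma mul_piMatUnit (M : ∀ i, Matrix (Fin (d i)) (Fin (d i)) k) (i : ι) (a b : Fin (d i)) :
    M * piMatUnit k i a b = ∑ c, M i c a • piMatUnit k i c b := by
  ext j x y
  rw [Finset.sum_apply, Matrix.sum_apply, Pi.mul_apply]
  simp only [Pi.smul_apply, piMatUnit]
  by_cases hj : j = i
  · subst hj
    by_cases hby : b = y <;> simp [Matrix.mul_apply, Matrix.single_apply, hby]
  · simp [Pi.single_eq_of_ne hj]

lemma piMatUnit_mul (M : ∀ i, Matrix (Fin (d i)) (Fin (d i)) k) (i : ι) (a b : Fin (d i)) :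
    piMatUnit k i a b * M = ∑ c, M i b c • piMatUnit k i a c := by
  ext j x y
  rw [Finset.sum_apply, Matrix.sum_apply, Pi.mul_apply]
  simp only [Pi.smul_apply, piMatUnit]
  by_cases hj : j = i
  · subst hj
    by_cases hax : a = x <;> simp [Matrix.mul_apply, Matrix.single_apply, hax]
  · simp [Pi.single_eq_of_ne hj]

lemma sum_piMatUnit : ∑ i, ∑ a, piMatUnit k (d := d) i a a = 1 := by
  ext j x y
  rw [Finset.sum_apply, Matrix.sum_apply, Pi.one_apply, Matrix.one_apply]
  rw [Finset.sum_eq_single j]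
  · rw [Finset.sum_apply, Matrix.sum_apply]
    simp only [piMatUnit, Pi.single_eq_same, Matrix.single_apply]
    by_cases hxy : x = y
    · subst hxy; simp
    · simp only [hxy, if_false]
      exact Finset.sum_eq_zero fun a _ => if_neg fun h => hxy (h.1.symm.trans h.2)
  · intro i _ hi
    rw [Finset.sum_apply, Matrix.sum_apply]
    simp [piMatUnit, Pi.single_eq_of_ne hi.symm]
  · simp

lemma piMatUnit_mul_piMatUnit (i : ι) (a b c : Fin (d i)) :
    piMatUnit k i a b * piMatUnit k i b c = piMatUnit k i a c := by
  rw [piMatUnit_mul]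
  simp [piMatUnit, Matrix.single_apply]

lemma single_one_mem_center (i : ι) :
    (Pi.single i 1 : ∀ i, Matrix (Fin (d i)) (Fin (d i)) k) ∈ Set.center _ := by
  rw [Semigroup.mem_center_iff]
  intro M
  rw [← Pi.single_mul_right, ← Pi.single_mul_left, mul_one, one_mul]

end MatrixUnits

namespace RepCat
variable {k H : Type u} [Field k] [Ring H] [Algebra k H]

lemma lin_sum {X Y : RepCat k H} {ι : Type*} (s : Finset ι) (f : ι → (X ⟶ Y)) :
    lin (∑ i ∈ s, f i) = ∑ i ∈ s, lin (f i) := by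
  classical
  induction s using Finset.induction_on with
  | empty => rfl
  | insert a s ha ih => rw [Finset.sum_insert ha, Finset.sum_insert ha, lin_add, ih]

lemma isSimpleObj_of_lin {X : RepCat k H} [Nontrivial X.V]
    (h : ∀ f : X ⟶ X, ∃ c : k, lin f = c • LinearMap.id) : IsSimpleObj k X := by
  intro f
  obtain ⟨c, hc⟩ := h f
  refine ⟨c, hom_ext fun x => by rw [hc]; rfl, fun d hd => ?_⟩
  obtain ⟨v, hv⟩ := exists_ne (0 : X.V)
  have h1 : lin f v = d • v := by rw [hd]; rfl
  rw [hc] at h1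
  exact (smul_left_injective k hv h1).symm

lemma nontrivial_of_isSimpleObj {X : RepCat k H} (h : IsSimpleObj k X) : Nontrivial X.V := by
  by_contra h0
  rw [not_nontrivial_iff_subsingleton] at h0
  exact h.id_ne_zero (hom_ext fun x => Subsingleton.elim _ _)

lemma exists_lin_of_isSimpleObj {X : RepCat k H} (h : IsSimpleObj k X) (f : X ⟶ X) :
    ∃ c : k, lin f = c • LinearMap.id := by
  obtain ⟨c, hc, -⟩ := h f
  exact ⟨c, by rw [hc]; rfl⟩

/-- The regular representation. -/
def regular [FiniteDimensional k H] : RepCat k H where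
  V := H
  ρ := Algebra.lmul k H

/-- The representation on column vectors given by a matrix representation. -/
def matrixRep {m : ℕ} (f : H →ₐ[k] Matrix (Fin m) (Fin m) k) : RepCat k H where
  V := Fin m → k
  ρ := (Matrix.toLinAlgEquiv' (R := k) (n := Fin m)).toAlgHom.comp f

lemma isSimpleObj_matrixRep {m : ℕ} [NeZero m] (f : H →ₐ[k] Matrix (Fin m) (Fin m) k)
    (hf : Function.Surjective f) : IsSimpleObj k (matrixRep f) := by
  have : Nontrivial (matrixRep f).V := inferInstanceAs (Nontrivial (Fin m → k))
  refine isSimpleObj_of_lin fun g => ?_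
  let g' : (Fin m → k) →ₗ[k] (Fin m → k) := lin g
  have h1 : LinearMap.toMatrixAlgEquiv' g' ∈ Set.range (Matrix.scalar (Fin m)) := by
    apply Matrix.mem_range_scalar_of_commute_single
    intro a b _
    obtain ⟨h, hh⟩ := hf (Matrix.single a b 1)
    have h2 : g' * Matrix.toLinAlgEquiv' (f h) = Matrix.toLinAlgEquiv' (f h) * g' :=
      LinearMap.ext fun x => lin_ρ g h x
    have h3 := congrArg LinearMap.toMatrixAlgEquiv' h2
    rw [map_mul, map_mul, LinearMap.toMatrixAlgEquiv'_toLinAlgEquiv', hh] at h3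
    exact h3.symm
  obtain ⟨c, hc⟩ := h1
  refine ⟨c, ?_⟩
  have h2 : g' = Matrix.toLinAlgEquiv' (Matrix.scalar (Fin m) c) := by
    rw [hc, Matrix.toLinAlgEquiv'_toMatrixAlgEquiv']
  refine LinearMap.ext fun (v : Fin m → k) => ?_
  change g' v = c • v
  rw [h2, Matrix.toLinAlgEquiv'_apply]
  ext x
  simp [Matrix.mulVec_diagonal]

/-- A semisimple algebra over an algebraically closed field has a finite dominating family of
simple modules `V_i`, together with central elements `e_i` acting on `V_j` by `δ_{ij}`. -/
lemma exists_dominating_family [IsAlgClosed k] [FiniteDimensional k H] [IsSemisimpleRing H] :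
    ∃ (n : ℕ) (V : Fin n → RepCat k H) (e : Fin n → H), (∀ i, IsSimpleObj k (V i)) ∧
      (∀ X, Dominates V X) ∧ (∀ i, e i ∈ Set.center H) ∧
      ∀ i j, (V j).ρ (e i) = if i = j then 1 else 0 := by
  obtain ⟨n, d, hd, ⟨φ⟩⟩ := IsSemisimpleRing.exists_algEquiv_pi_matrix_of_isAlgClosed k H
  let p : ∀ i, H →ₐ[k] Matrix (Fin (d i)) (Fin (d i)) k := fun i =>
    (Pi.evalAlgHom k (fun i => Matrix (Fin (d i)) (Fin (d i)) k) i).comp φ.toAlgHom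
  have hp : ∀ i h, p i h = φ h i := fun i h => rfl
  -- the matrix units of `H`
  let E : ∀ i, Fin (d i) → Fin (d i) → H := fun i a b => φ.symm (piMatUnit k i a b)
  have mulE : ∀ h i a b, h * E i a b = ∑ c, p i h c a • E i c b := by
    intro h i a b
    apply φ.injective
    simp only [E, map_mul, map_sum, map_smul, φ.apply_symm_apply, mul_piMatUnit, hp]
  have Emul : ∀ h i a b, E i a b * h = ∑ c, p i h b c • E i a c := by
    intro h i a b
    apply φ.injective
    simp only [E, map_mul, map_sum, map_smul, φ.apply_symm_apply, piMatUnit_mul, hp]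
  have EE : ∀ i a b c, E i a b * E i b c = E i a c := by
    intro i a b c
    simp only [E]
    rw [← map_mul, piMatUnit_mul_piMatUnit]
  have sumE : ∑ i, ∑ a, E i a a = 1 := by
    simp only [E, ← map_sum]
    rw [sum_piMatUnit, map_one]
  refine ⟨n, fun i => matrixRep (p i), fun i => φ.symm (Pi.single i 1), fun i => ?_, fun X => ?_,
    fun i => ?_, fun i j => ?_⟩
  · have := hd i
    refine isSimpleObj_matrixRep _ fun M => ⟨φ.symm (Pi.single i M), ?_⟩
    rw [hp, φ.apply_symm_apply, Pi.single_eq_same]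
  · -- `id_X` is the sum of `E_{aa} = E_{a0} E_{0a}`, with a decomposition of `id_X` in the middle
    let b := Module.finBasis k X.V
    let z : ∀ i, Fin (d i) := fun i => ⟨0, Nat.pos_of_ne_zero (hd i).out⟩
    let F : ∀ i, Fin (Module.finrank k X.V) → (Fin (d i) → k) →ₗ[k] X.V := fun i r =>
      ∑ a, (LinearMap.proj a : (Fin (d i) → k) →ₗ[k] k).smulRight (X.ρ (E i a (z i)) (b r))
    let G : ∀ i, Fin (Module.finrank k X.V) → X.V →ₗ[k] (Fin (d i) → k) := fun i r =>
      LinearMap.pi fun a => b.coord r ∘ₗ X.ρ (E i (z i) a)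
    have hF : ∀ i r h v, F i r ((p i h).mulVec v) = X.ρ h (F i r v) := by
      intro i r h v
      simp only [F, LinearMap.sum_apply, LinearMap.smulRight_apply, LinearMap.proj_apply, map_sum,
        map_smul, Matrix.mulVec, dotProduct]
      simp only [← Module.End.mul_apply, ← map_mul, mulE]
      simp only [map_sum, map_smul, LinearMap.sum_apply, LinearMap.smul_apply, Finset.sum_smul,
        Finset.smul_sum, smul_smul]
      rw [Finset.sum_comm]
      simp only [mul_comm]
    have hG : ∀ i r h x, G i r (X.ρ h x) = (p i h).mulVec (G i r x) := by
      intro i r h x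
      refine funext fun a => ?_
      simp only [G, LinearMap.pi_apply, LinearMap.comp_apply, Matrix.mulVec, dotProduct]
      rw [← Module.End.mul_apply, ← map_mul, Emul]
      simp only [map_sum, map_smul, LinearMap.sum_apply, LinearMap.smul_apply, smul_eq_mul]
    have hFG : ∀ x, ∑ i, ∑ r, F i r (G i r x) = x := by
      intro x
      simp only [F, G, LinearMap.sum_apply, LinearMap.smulRight_apply, LinearMap.proj_apply,
        LinearMap.pi_apply, LinearMap.comp_apply]
      have e1 : ∀ i a, ∑ r, b.coord r (X.ρ (E i (z i) a) x) • X.ρ (E i a (z i)) (b r) =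
          X.ρ (E i a a) x := by
        intro i a
        simp only [← map_smul, ← map_sum, Module.Basis.coord_apply]
        rw [b.sum_repr, ← Module.End.mul_apply, ← map_mul, EE]
      have e2 : ∑ i, ∑ a, X.ρ (E i a a) x = x := by
        have := congrArg (fun h => X.ρ h x) sumE
        simpa using this
      conv_rhs => rw [← e2]
      refine Finset.sum_congr rfl fun i _ => ?_
      rw [Finset.sum_comm]
      exact Finset.sum_congr rfl fun a _ => e1 i a
    refine dominates_of_fintype (ι := Fin n × Fin (Module.finrank k X.V)) (fun r => r.1)
      (fun r => ofLin (F r.1 r.2) (hF r.1 r.2)) (fun r => ofLin (G r.1 r.2) (hG r.1 r.2)) ?_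
    refine hom_ext fun x => ?_
    rw [lin_sum, LinearMap.sum_apply, Fintype.sum_prod_type]
    exact (hFG x).symm
  · rw [Semigroup.mem_center_iff]
    intro h
    apply φ.injective
    rw [map_mul, map_mul, φ.apply_symm_apply]
    exact (Semigroup.mem_center_iff.1 (single_one_mem_center i)) _
  · refine LinearMap.ext fun (v : Fin (d j) → k) => ?_
    change (φ (φ.symm (Pi.single i 1)) j).mulVec v = _
    rw [φ.apply_symm_apply]
    by_cases hij : i = j
    · subst hij
      rw [Pi.single_eq_same, Matrix.one_mulVec, if_pos rfl]; rfl
    · rw [Pi.single_eq_of_ne (Ne.symm hij), Matrix.zero_mulVec, if_neg hij]; rfl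

end RepCat
end QG

/-! ### The unit object and the dual of a simple object are simple -/

namespace QG
open Coalgebra QuantumGroupoid Quasitriangular RibbonQuantumGroupoid MonoidalCategory

namespace RepCat
variable {k H : Type u} [Field k] [Ring H] [Algebra k H] [Quasitriangular k H]

/-- An endomorphism `f` of the unit object sends `1` to a central element `w` of `H`: one has
`f(ε_t(x)) = ε_t(x w)`, hence `x w = ε(x₍₁₎ w) x₍₂₎ = f(ε_t(x₍₁₎)) x₍₂₎ = f(1₍₁₎) 1₍₂₎ x`, and `x = 1`
identifies `f(1₍₁₎) 1₍₂₎` with `w`. -/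
lemma mul_coeT_endo (f : unit k H ⟶ unit k H) (h : H) :
    h * coeT (lin f oneT) = coeT (lin f oneT) * h := by
  set z := lin f oneT with hz
  let ι : H →ₗ[k] (unit k H).V := (epsT k).codRestrict (Ht k H) (epsT_mem k)
  let F : H →ₗ[k] H := coeT ∘ₗ lin f ∘ₗ ι
  have hF : epsT k ∘ₗ LinearMap.mulRight k (coeT z) = F := by
    refine LinearMap.ext fun x => ?_
    have h1 : ι x = (unit k H).ρ x oneT := coeT_injective (by
      rw [coeT_ρ, coeT_oneT, mul_one]; rfl)
    change epsT k (x * coeT z) = coeT (lin f (ι x))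
    rw [h1, lin_ρ, coeT_ρ]
  have hFe : F ∘ₗ epsT k = F := by
    refine LinearMap.ext fun x => ?_
    have h1 : ι (epsT k x) = ι x := coeT_injective (epsT_epsT k x)
    exact congrArg (fun y => coeT (lin f y)) h1
  have key : ∀ x : H, x * coeT z =
      LinearMap.mul' k H (TensorProduct.map F LinearMap.id (Δ k 1)) * x := by
    intro x
    rw [← counit_contract_of_mem k (coeT_mem z), ← epsT_mul_contract, hF]
    have e1 : ∀ t : H ⊗[k] H, TensorProduct.map F LinearMap.id ((epsT k).rTensor H t) =
        TensorProduct.map F LinearMap.id t := by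
      intro t
      rw [← LinearMap.rTensor_def, ← LinearMap.comp_apply, ← LinearMap.rTensor_comp, hFe]
    rw [← e1, epsT_id_comul, e1]
    generalize Δ k (1 : H) = t
    induction t with
    | zero => simp
    | add a b ha hb => simp only [map_add, add_mul, ha, hb]
    | tmul a b => simp [mul_assoc]
  have h1 := key 1
  rw [one_mul, mul_one] at h1
  rw [key, ← h1]

/-- If `H` is connected then `End(𝟙) = k`: an endomorphism of the unit object is the
multiplication by an element of `H_t ∩ Z(H)`, and `S` maps `H_t ∩ Z(H)` into `H_s ∩ Z(H) = k`. -/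
lemma isSimpleObj_unit (hconn : IsConnected k H) : IsSimpleObj k (𝟙_ (RepCat k H)) := by
  have := hconn.1
  have : Nontrivial (unit k H).V := ⟨oneT, 0, fun h => one_ne_zero (α := H) (by
    rw [← coeT_oneT (k := k), h, map_zero])⟩
  refine isSimpleObj_of_lin (X := unit k H) fun f => ?_
  set z := lin f oneT with hz
  have hS : S k (coeT z) ∈ (Hs k H : Set H) ∩ Set.center H := by
    constructor
    · rw [← epsS_eq_antipode_of_mem k (coeT_mem z)]
      exact epsS_mem k _
    · rw [Semigroup.mem_center_iff]
      intro g
      obtain ⟨h, rfl⟩ := (antipode_bijective k).2 g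
      have := congrArg (S k) (mul_coeT_endo f h)
      simp only [S, antipode_mul] at this ⊢
      exact this.symm
  rw [hconn.2] at hS
  obtain ⟨c, hc⟩ := hS
  have hc' : coeT z = c • 1 := (antipode_bijective k).1 (by
    rw [← hc, map_smul, show S k (1 : H) = 1 from antipode_one, Algebra.algebraMap_eq_smul_one])
  refine ⟨c, LinearMap.ext fun x => coeT_injective ?_⟩
  have h1 : x = (unit k H).ρ (coeT x) oneT := coeT_injective (by
    rw [coeT_ρ, coeT_oneT, mul_one, epsT_of_mem k (coeT_mem x)])
  conv_lhs => rw [h1, lin_ρ, coeT_ρ, ← hz, hc', mul_smul_comm, mul_one, map_smul,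
    epsT_of_mem k (coeT_mem x)]
  rfl

/-- The transpose of an endomorphism of `X*` is an endomorphism of `X`, since `S` is surjective. -/
lemma isSimpleObj_dual {X : RepCat k H} (hX : IsSimpleObj k X) : IsSimpleObj k (dual X) := by
  have := nontrivial_of_isSimpleObj hX
  have : Nontrivial (dual X).V := inferInstanceAs (Nontrivial (Module.Dual k X.V))
  refine isSimpleObj_of_lin fun f => ?_
  let F : Module.Dual k X.V →ₗ[k] Module.Dual k X.V :=
    (form X).toLinearMap ∘ₗ lin f ∘ₗ (form X).symm.toLinearMap
  let f' : X.V →ₗ[k] X.V :=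
    (Module.evalEquiv k X.V).symm.toLinearMap ∘ₗ F.dualMap ∘ₗ (Module.evalEquiv k X.V).toLinearMap
  have hf' : ∀ (φ : Module.Dual k X.V) v, φ (f' v) = F φ v := by
    intro φ v
    simp only [f', LinearMap.comp_apply, LinearEquiv.coe_coe, Module.apply_evalEquiv_symm_apply]
    rfl
  have hlin : ∀ h v, f' (X.ρ h v) = X.ρ h (f' v) := by
    intro g v
    obtain ⟨h, rfl⟩ := (antipode_bijective k).2 g
    refine (Module.forall_dual_apply_eq_zero_iff k _).1 ?_ |> sub_eq_zero.1
    intro φ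
    rw [map_sub, hf', sub_eq_zero]
    have h1 := congrArg (fun ψ => form X ψ v) (lin_ρ f h ((form X).symm φ))
    change F (form X ((dual X).ρ h ((form X).symm φ))) v = F φ (X.ρ (S k h) v) at h1
    rw [← h1, ← hf']
    rfl
  obtain ⟨c, hc⟩ := exists_lin_of_isSimpleObj hX (ofLin f' hlin)
  rw [lin_ofLin] at hc
  refine ⟨c, LinearMap.ext fun φ => (form X).injective (LinearMap.ext fun v => ?_)⟩
  change F (form X φ) v = c • form X φ v
  rw [← hf', hc]
  simp

/-- The family of simple objects of a semisimple connected quantum groupoid, containing the unit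
object, together with central elements `e_i` acting on `V_j` by `δ_{ij}`. -/
lemma exists_simple_family [IsAlgClosed k] [FiniteDimensional k H] [IsSemisimpleRing H]
    (hconn : IsConnected k H) :
    ∃ (n : ℕ) (V : Fin n → RepCat k H) (e : Fin n → H), (∀ i, IsSimpleObj k (V i)) ∧
      (∃ i, V i = 𝟙_ (RepCat k H)) ∧ (∀ X, Dominates V X) ∧ (∀ i, e i ∈ Set.center H) ∧
      ∀ i j, (V j).ρ (e i) = if i = j then 1 else 0 := by
  obtain ⟨n, V, e, hV, hdom, he, hδ⟩ := exists_dominating_family (k := k) (H := H)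
  obtain ⟨i₀, ⟨φ⟩⟩ := (isSimpleObj_unit hconn).exists_iso_of_dominates hV (hdom _)
  let W : Fin n → RepCat k H := fun i => if i = i₀ then 𝟙_ _ else V i
  have ψ : ∀ i, V i ≅ W i := fun i => by
    by_cases hi : i = i₀
    · exact (eqToIso (by rw [hi])).trans (φ.trans (eqToIso (if_pos hi).symm))
    · exact eqToIso (if_neg hi).symm
  refine ⟨n, W, e, fun i => (hV i).of_iso (ψ i), ⟨i₀, if_pos rfl⟩, fun X => (hdom X).of_iso ψ, he,
    fun i j => LinearMap.ext fun x => ?_⟩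
  have h1 : x = lin (ψ j).hom (lin (ψ j).inv x) := by
    rw [← LinearMap.comp_apply, ← lin_comp, (ψ j).inv_hom_id]; rfl
  rw [h1, ← lin_ρ, hδ]
  by_cases hij : i = j
  · rw [if_pos hij, if_pos hij]; rfl
  · rw [if_neg hij, if_neg hij]; simp

end RepCat
end QG

/-! ### Quantum traces -/

namespace QG
open Coalgebra QuantumGroupoid Quasitriangular RibbonQuantumGroupoid MonoidalCategory

namespace RepCat

section
variable {k H : Type u} [Field k] [Ring H] [Algebra k H] [QuantumGroupoid k H]

lemma counit_evalH_tmul (X : RepCat k H) (φ : (dual X).V) (v : X.V) :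
    counit (R := k) (evalH X (φ ⊗ₜ v)) = form X φ v := by
  have e : ∀ t : H ⊗[k] H, counit (R := k) (TensorProduct.lid k H
      ((form X φ ∘ₗ LinearMap.applyₗ v ∘ₗ X.ρ.toLinearMap).rTensor H t)) =
      form X φ (X.ρ (TensorProduct.rid k H ((counit (R := k)).lTensor H t)) v) := by
    intro t
    induction t with
    | zero => simp
    | add a b ha hb => simp only [map_add, LinearMap.add_apply, ha, hb]
    | tmul a b => simp [mul_comm]
  rw [evalH_tmul, e, Coalgebra.lTensor_counit_comul, TensorProduct.rid_tmul, one_smul, map_one]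
  rfl

lemma trace_toEnd_tmul (X : RepCat k H) (v : X.V) (φ : (dual X).V) :
    LinearMap.trace k X.V (toEnd X (v ⊗ₜ φ)) = form X φ v :=
  LinearMap.trace_eq_contract_apply k X.V (form X φ ⊗ₜ v)

lemma toEnd_map_id (X : RepCat k H) (F : Module.End k X.V) (x : X.V ⊗[k] (dual X).V) :
    toEnd X (TensorProduct.map F LinearMap.id x) = F * toEnd X x := by
  induction x with
  | zero => simp
  | add c d ha hb => simp only [map_add, mul_add, ha, hb]
  | tmul v φ => ext w; simp

/-- The ordinary trace behind the quantum trace: the form `φ ⊗ v ↦ φ(v)` applied to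
`t · x` with the factors exchanged. -/
lemma counit_evalH_comm_act (X : RepCat k H) (t : H ⊗[k] H) (x : X.V ⊗[k] (dual X).V) :
    counit (R := k) (evalH X (TensorProduct.comm k X.V (dual X).V (act X (dual X) t x))) =
      LinearMap.trace k X.V (X.ρ (antiMul k t) * toEnd X x) := by
  rw [← toEnd_map_id]
  induction t with
  | zero => simp
  | add c d ha hb =>
    simp only [map_add, LinearMap.add_apply, TensorProduct.map_add_left, ha, hb]
  | tmul a b =>
    induction x with
    | zero => simp
    | add c d ha hb => simp only [map_add, ha, hb]
    | tmul v φ =>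
      rw [act2_tmul, TensorProduct.comm_tmul, counit_evalH_tmul, TensorProduct.map_tmul,
        trace_toEnd_tmul, antiMul_tmul, form_ρ, map_mul]
      rfl

end

variable {k H : Type u} [Field k] [Ring H] [Algebra k H] [RibbonQuantumGroupoid k H]

/-- The quantum trace is the ordinary trace twisted by the pivot `g`: the scalar by which
`tr_q(f)` acts is recovered from `ε(tr_q(f)(1)) = tr(g f)`. -/
lemma counit_qtrace {X : RepCat k H} (f : X ⟶ X) :
    counit (R := k) (coeT (lin (qtrace f) (oneT (k := k) (H := H)))) =
      LinearMap.trace k X.V (X.ρ (pivot k H) * lin f) := by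
  have h1 : counit (R := k) (coeT (lin (qtrace f) (oneT (k := k) (H := H)))) =
      counit (R := k) (evalH X (braidLin X (dual X)
        (TensorProduct.map (lin (f ≫ (twistIso X).hom)) (lin (𝟙 (dual X))) (coevLin X 1)))) := rfl
  rw [h1, coevLin_apply, act_map, braidLin, LinearMap.comp_apply, ← Module.End.mul_apply, ← map_mul,
    R_mul_one, LinearEquiv.coe_coe, counit_evalH_comm_act, lin_id, toEnd_map_id, toEnd_coevElt,
    mul_one, pivot, map_mul X.ρ, mul_assoc]
  rfl

/-- The quantum character `h ↦ tr_X(g h)`. -/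
noncomputable def qchar (X : RepCat k H) : H →ₗ[k] k :=
  LinearMap.trace k X.V ∘ₗ X.ρ.toLinearMap ∘ₗ LinearMap.mulLeft k (pivot k H)

lemma qchar_apply (X : RepCat k H) (h : H) :
    qchar X h = LinearMap.trace k X.V (X.ρ (pivot k H) * X.ρ h) := by
  simp [qchar]

/-- The partial quantum trace `(id ⊗ χ_X)(R₂₁ R)`. -/
noncomputable def partialTrace (X : RepCat k H) : H :=
  TensorProduct.rid k H ((qchar X).lTensor H (doubleR k H))

lemma trace_act_pivot_mul (X Y : RepCat k H) (t : H ⊗[k] H) :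
    LinearMap.trace k (X.V ⊗[k] Y.V) (act X Y ((pivot k H ⊗ₜ pivot k H) * t)) =
      qchar X (TensorProduct.rid k H ((qchar Y).lTensor H t)) := by
  induction t with
  | zero => simp
  | add c d ha hb => simp only [map_add, mul_add, ha, hb]
  | tmul a b =>
    rw [Algebra.TensorProduct.tmul_mul_tmul]
    have : act X Y ((pivot k H * a) ⊗ₜ (pivot k H * b)) =
        TensorProduct.map (X.ρ (pivot k H * a)) (Y.ρ (pivot k H * b)) := rfl
    rw [this, LinearMap.trace_tensorProduct']
    simp [qchar, mul_comm]

/-- The double braiding is the action of `Q = R₂₁ R` on `X ⊗ Y`. As `Q` absorbs the projection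
`Δ(1)`, the trace may be taken over `X ⊗_k Y`, where `Δ(g) Q = (g ⊗ g) Q` factorizes. -/
lemma counit_qtrace_doubleBraiding (X Y : RepCat k H) :
    counit (R := k) (coeT (lin (qtrace ((β_ X Y).hom ≫ (β_ Y X).hom)) (oneT (k := k) (H := H)))) =
      qchar X (partialTrace Y) := by
  have h1 : ∀ x, incl X Y (lin ((β_ X Y).hom ≫ (β_ Y X).hom) x) =
      act X Y (doubleR k H) (incl X Y x) := by
    intro x
    change braidLin Y X (braidLin X Y (incl X Y x)) = _
    rw [doubleR, map_mul, Module.End.mul_apply]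
    simp only [braidLin, LinearMap.comp_apply, LinearEquiv.coe_coe]
    rw [comm_act Y X, TensorProduct.comm_comm]
  have h2 : Δ k (pivot k H) * doubleR k H = (pivot k H ⊗ₜ pivot k H) * doubleR k H := by
    rw [comul_pivot, mul_assoc, ← doubleR_mul_comul, doubleR_mul_comul_one]
  have h3 : (tensor X Y).ρ (pivot k H) * lin ((β_ X Y).hom ≫ (β_ Y X).hom) =
      proj X Y ∘ₗ act X Y ((pivot k H ⊗ₜ pivot k H) * doubleR k H) ∘ₗ incl X Y := by
    refine LinearMap.ext fun x => incl_injective X Y ?_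
    rw [Module.End.mul_apply, incl_ρ, h1, LinearMap.comp_apply, LinearMap.comp_apply, incl_proj,
      ← Module.End.mul_apply, ← map_mul, ← h2, ← Module.End.mul_apply, ← map_mul, ← mul_assoc,
      one_comul]
  have h4 : incl X Y ∘ₗ proj X Y = act X Y (Δ k 1) := rfl
  rw [counit_qtrace]
  refine (congrArg (LinearMap.trace k (tensor X Y).V) h3).trans ?_
  rw [LinearMap.trace_comp_comm', LinearMap.comp_assoc, h4, ← Module.End.mul_eq_comp, ← map_mul,
    mul_assoc, doubleR_mul_comul_one, trace_act_pivot_mul]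
  rfl

/-- `tr(g h₍₁₎ F S(h₍₂₎)) = tr(g F)`: by cyclicity of the trace the average passes to the pivot `g`,
which it fixes. -/
lemma trace_pivot_mul_average (X : RepCat k H) {h : H} (hh : IsHaarIntegral k h)
    (F : Module.End k X.V) :
    LinearMap.trace k X.V (X.ρ (pivot k H) *
      sand X.ρ.toLinearMap X.ρ.toLinearMap F (TensorProduct.comm k H H (sepElt k h))) =
      LinearMap.trace k X.V (X.ρ (pivot k H) * F) := by
  have e : ∀ t : H ⊗[k] H, LinearMap.trace k X.V (X.ρ (pivot k H) *
      sand X.ρ.toLinearMap X.ρ.toLinearMap F (TensorProduct.comm k H H t)) =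
      LinearMap.trace k X.V (X.ρ (sand LinearMap.id LinearMap.id (pivot k H) t) * F) := by
    intro t
    induction t with
    | zero => simp
    | add c d ha hb => simp only [map_add, mul_add, add_mul, ha, hb]
    | tmul a b =>
      simp only [TensorProduct.comm_tmul, sand_tmul, AlgHom.toLinearMap_apply, LinearMap.id_apply,
        map_mul]
      rw [← mul_assoc, ← mul_assoc, LinearMap.trace_mul_comm, ← mul_assoc, ← mul_assoc]
  rw [e, sand_pivot_sepElt k hh]

/-- `χ_X(h₍₁₎ x S(h₍₂₎)) = χ_X(x)` -/
lemma qchar_average (X : RepCat k H) {h : H} (hh : IsHaarIntegral k h) (x : H) :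
    qchar X (sand LinearMap.id LinearMap.id x (TensorProduct.comm k H H (sepElt k h))) =
      qchar X x := by
  have e : ∀ t : H ⊗[k] H, X.ρ (sand LinearMap.id LinearMap.id x t) =
      sand X.ρ.toLinearMap X.ρ.toLinearMap (X.ρ x) t := by
    intro t
    induction t with
    | zero => simp
    | add c d ha hb => simp only [map_add, ha, hb]
    | tmul a b => simp
  rw [qchar_apply, e, trace_pivot_mul_average X hh, qchar_apply]

/-- The quantum dimension of a simple object does not vanish: averaging makes any operator `F` on
`X` a scalar without changing `tr(g F)`, so otherwise the trace form would be degenerate. -/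
lemma qchar_one_ne_zero {X : RepCat k H} (hX : IsSimpleObj k X) {h : H}
    (hh : IsHaarIntegral k h) : qchar X 1 ≠ 0 := by
  intro h0
  rw [qchar_apply, map_one, mul_one] at h0
  -- the average of `F` is a scalar, hence has trace zero against `g`
  have h1 : ∀ F : Module.End k X.V, LinearMap.trace k X.V (X.ρ (pivot k H) * F) = 0 := by
    intro F
    set A : Module.End k X.V :=
      sand X.ρ.toLinearMap X.ρ.toLinearMap F (TensorProduct.comm k H H (sepElt k h)) with hA
    obtain ⟨c, hc⟩ := exists_lin_of_isSimpleObj hX (ofLin A fun y v =>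
      (LinearMap.congr_fun (comm_sepElt_mul k X.ρ hh F y) v).symm)
    rw [lin_ofLin] at hc
    rw [← trace_pivot_mul_average X hh F, ← hA, hc, mul_smul_comm, map_smul,
      ← Module.End.one_eq_id, mul_one, h0, smul_zero]
  have h2 : X.ρ (pivot k H) = 0 := by
    refine LinearMap.ext fun v => (Module.forall_dual_apply_eq_zero_iff k _).1 fun φ => ?_
    have h3 : X.ρ (pivot k H) * φ.smulRight v = φ.smulRight (X.ρ (pivot k H) v) := by
      ext w; simp
    rw [← LinearMap.trace_smulRight, ← h3, h1]
  have := nontrivial_of_isSimpleObj hX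
  exact ((isUnit_pivot k (H := H)).map X.ρ).ne_zero h2

end RepCat
end QG

/-! ### Central elements and the `S`-matrix -/

namespace QG
open Coalgebra QuantumGroupoid Quasitriangular RibbonQuantumGroupoid MonoidalCategory

namespace RepCat

section
variable {k H : Type u} [Field k] [Ring H] [Algebra k H]

/-- A dominating family is jointly faithful, since it dominates the regular representation. -/
lemma eq_of_forall_ρ_eq [FiniteDimensional k H] {I : Type} {V : I → RepCat k H}
    (hV : ∀ X, Dominates V X) {x y : H} (hxy : ∀ i, (V i).ρ x = (V i).ρ y) : x = y := by
  obtain ⟨m, i, f, g, hfg⟩ := hV (regular (k := k) (H := H))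
  let o : (regular (k := k) (H := H)).V := (1 : H)
  have h1 : ∀ z : H, (regular (k := k) (H := H)).ρ z o =
      ∑ r, lin (f r) ((V (i r)).ρ z (lin (g r) o)) := by
    intro z
    have h2 := congrArg (fun t => lin t ((regular (k := k) (H := H)).ρ z o)) hfg
    simp only [lin_sum, LinearMap.sum_apply, lin_comp, LinearMap.comp_apply, lin_id,
      LinearMap.id_apply] at h2
    rw [h2]
    exact Finset.sum_congr rfl fun r _ => congrArg (lin (f r)) (lin_ρ (g r) z o)
  have h3 : ∀ z : H, (regular (k := k) (H := H)).ρ z o = z := fun z => mul_one z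
  rw [← h3 x, ← h3 y, h1, h1]
  exact Finset.sum_congr rfl fun r _ => by rw [hxy]

end

variable {k H : Type u} [Field k] [Ring H] [Algebra k H] [RibbonQuantumGroupoid k H]

/-- A central element acts on a simple module by a scalar, which its quantum character detects. -/
lemma ρ_of_mem_center {X : RepCat k H} (hX : IsSimpleObj k X) (hq : qchar X 1 ≠ 0) {w : H}
    (hw : w ∈ Set.center H) : X.ρ w = ((qchar X 1)⁻¹ * qchar X w) • 1 := by
  obtain ⟨c, hc⟩ := exists_lin_of_isSimpleObj hX (ofLin (X.ρ w) fun h v => by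
    rw [← Module.End.mul_apply, ← map_mul, hw.comm h, map_mul, Module.End.mul_apply])
  rw [lin_ofLin, ← Module.End.one_eq_id] at hc
  have h1 : qchar X w = c * qchar X 1 := by
    rw [qchar_apply, qchar_apply, hc, mul_smul_comm, map_smul, map_one, smul_eq_mul]
  rw [h1, mul_comm c, inv_mul_cancel_left₀ hq, hc]

section Family
variable {n : ℕ} {V : Fin n → RepCat k H} {e : Fin n → H}

/-- A central element is determined by its quantum characters. -/
lemma eq_sum_qchar_smul (hV : ∀ i, IsSimpleObj k (V i)) (hdom : ∀ X, Dominates V X)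
    (he : ∀ i j, (V j).ρ (e i) = if i = j then 1 else 0) (hq : ∀ i, qchar (V i) 1 ≠ 0) {w : H}
    (hw : w ∈ Set.center H) : w = ∑ i, ((qchar (V i) 1)⁻¹ * qchar (V i) w) • e i := by
  have := QuantumGroupoid.finiteDimensional (k := k) (H := H)
  refine eq_of_forall_ρ_eq hdom fun j => ?_
  rw [ρ_of_mem_center (hV j) (hq j) hw, map_sum, Finset.sum_eq_single j]
  · rw [map_smul, he, if_pos rfl]
  · intro i _ hij
    rw [map_smul, he, if_neg hij, smul_zero]
  · simp

/-- If `H` is factorizable and has a Haar integral, the partial quantum traces of `R₂₁ R` over the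
simple modules span the center: a central element is `(id ⊗ ψ)(R₂₁ R)` for some `ψ`, and averaging
replaces `ψ` by a combination of the quantum characters of simple modules. -/
lemma exists_eq_sum_partialTrace (hfact : IsFactorizable k H) {h : H} (hh : IsHaarIntegral k h)
    (hV : ∀ i, IsSimpleObj k (V i)) (hdom : ∀ X, Dominates V X)
    (he : ∀ i j, (V j).ρ (e i) = if i = j then 1 else 0) {z : H} (hz : z ∈ Set.center H) :
    ∃ a : Fin n → k, z = ∑ i, a i • partialTrace (V i) := by
  have hq : ∀ i, qchar (V i) 1 ≠ 0 := fun i => qchar_one_ne_zero (hV i) hh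
  -- write `z = S(z')` with `z' = (φ ⊗ id)(R₂₁ R)` and use `(S ⊗ S)(R₂₁ R) = (R₂₁ R)₂₁`
  have hbij := antipode_bijective k (H := H)
  obtain ⟨z', hz'⟩ := hbij.2 z
  have hz'c : z' ∈ Set.center H := by
    rw [Semigroup.mem_center_iff]
    intro y
    apply hbij.1
    simp only [S, antipode_mul] at hz' ⊢
    rw [hz', hz.comm]
  obtain ⟨φ, hφ⟩ := hfact z' (Set.center_subset_centralizer _ hz'c)
  let T := LinearEquiv.ofBijective (S k (H := H)) hbij
  let ψ : H →ₗ[k] k := φ ∘ₗ T.symm.toLinearMap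
  have hψ : ∀ x, ψ (S k x) = φ x := fun x => congrArg φ (T.symm_apply_apply x)
  have h1 : z = TensorProduct.rid k H (ψ.lTensor H (doubleR k H)) := by
    have e1 : ∀ t : H ⊗[k] H, TensorProduct.rid k H (ψ.lTensor H (flip k
        (TensorProduct.map (S k) (S k) t))) = S k (TensorProduct.lid k H (φ.rTensor H t)) := by
      intro t
      induction t with
      | zero => simp
      | add a b ha hb => simp only [map_add, ha, hb]
      | tmul a b => simp [hψ]
    have h2 := e1 (doubleR k H)
    rw [map_antipode_doubleR, flip_flip] at h2
    rw [h2, ← hz', ← hφ]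
    rfl
  -- `h₍₁₎ x S(h₍₂₎)` is central, so the form `x ↦ ψ(h₍₁₎ x S(h₍₂₎))` is a combination of the
  -- quantum characters; applied to the second factor of `R₂₁ R` it gives `z` again, as the average
  -- moves to the first factor and becomes `S(h₍₁₎) z h₍₂₎ = z ε_s(h)`
  refine ⟨fun i => (qchar (V i) 1)⁻¹ * ψ (e i), ?_⟩
  have h2 : ∀ x, ψ (sand LinearMap.id LinearMap.id x (TensorProduct.comm k H H (sepElt k h))) =
      ∑ i, ((qchar (V i) 1)⁻¹ * ψ (e i)) * qchar (V i) x := by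
    intro x
    have hc : sand LinearMap.id LinearMap.id x (TensorProduct.comm k H H (sepElt k h)) ∈
        Set.center H := by
      rw [Semigroup.mem_center_iff]
      exact comm_sepElt_mul k (AlgHom.id k H) hh x
    rw [eq_sum_qchar_smul hV hdom he hq hc, map_sum]
    refine Finset.sum_congr rfl fun i _ => ?_
    rw [map_smul, qchar_average _ hh, smul_eq_mul]
    ring
  have h3 : ∀ q : H ⊗[k] H, TensorProduct.rid k H (ψ.lTensor H (sand (TensorProduct.mk k H H 1)
      (TensorProduct.mk k H H 1 ∘ₗ S k) q (TensorProduct.comm k H H (Δ k h)))) =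
      ∑ i, ((qchar (V i) 1)⁻¹ * ψ (e i)) •
        TensorProduct.rid k H ((qchar (V i)).lTensor H q) := by
    intro q
    induction q with
    | zero => simp
    | add a b ha hb =>
      simp only [sand_add, LinearMap.add_apply, map_add, smul_add, Finset.sum_add_distrib, ha, hb]
    | tmul x y =>
      have e1 : ∀ t : H ⊗[k] H, TensorProduct.rid k H (ψ.lTensor H
          (sand (TensorProduct.mk k H H 1) (TensorProduct.mk k H H 1 ∘ₗ S k) (x ⊗ₜ y)
            (TensorProduct.comm k H H t))) =
          ψ (sand LinearMap.id LinearMap.id y (TensorProduct.comm k H H ((S k).lTensor H t))) •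
            x := by
        intro t
        induction t with
        | zero => simp
        | add a b ha hb => simp only [map_add, add_smul, ha, hb]
        | tmul a b => simp
      rw [e1]
      have h4 := h2 y
      rw [sepElt] at h4
      rw [h4, Finset.sum_smul]
      simp [smul_smul]
  have h4 : ∀ t : H ⊗[k] H, TensorProduct.rid k H (ψ.lTensor H
      (sand ((TensorProduct.mk k H H).flip 1 ∘ₗ S k) ((TensorProduct.mk k H H).flip 1)
        (doubleR k H) (TensorProduct.comm k H H t))) =
      z * LinearMap.mul' k H ((S k).rTensor H t) := by
    intro t
    induction t with
    | zero => simp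
    | add a b ha hb => simp only [map_add, mul_add, ha, hb]
    | tmul a b =>
      have e1 : ∀ q : H ⊗[k] H, TensorProduct.rid k H (ψ.lTensor H
          ((S k a ⊗ₜ 1) * q * (b ⊗ₜ 1))) =
          S k a * TensorProduct.rid k H (ψ.lTensor H q) * b := by
        intro q
        induction q with
        | zero => simp
        | add c d hc hd => simp only [map_add, mul_add, add_mul, hc, hd]
        | tmul c d => simp
      refine (e1 (doubleR k H)).trans ?_
      rw [← h1, ← hz.comm (S k a), mul_assoc]
      rfl
  have h5 : LinearMap.mul' k H ((S k).rTensor H (Δ k h)) = 1 := hh.epsS_eq_one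
  have h6 := h4 (Δ k h)
  rw [h5, mul_one, ← adjoint_snd_eq_adjoint_fst k (doubleR k H) (doubleR_mul_comul k)
    (doubleR_mul_comul_one k), h3] at h6
  exact h6.symm

/-- The `S`-matrix is invertible: its entries, up to the factor `ε(1)`, are
`χ_j((id ⊗ χ_i)(R₂₁ R))`, and the elements `(id ⊗ χ_i)(R₂₁ R)` span the center, on which the `χ_j`
are a basis of the linear forms. -/
lemma exists_sMatrix (hconn : IsConnected k H) (hfact : IsFactorizable k H) {h : H}
    (hh : IsHaarIntegral k h) (hV : ∀ i, IsSimpleObj k (V i)) (hdom : ∀ X, Dominates V X)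
    (hec : ∀ i, e i ∈ Set.center H) (he : ∀ i j, (V j).ρ (e i) = if i = j then 1 else 0) :
    ∃ s : Matrix (Fin n) (Fin n) k,
      (∀ i j, qtrace ((β_ (V j) (V i)).hom ≫ (β_ (V i) (V j)).hom) =
        s i j • 𝟙 (𝟙_ (RepCat k H))) ∧ IsUnit s := by
  choose s hs _ using fun i j => isSimpleObj_unit hconn
    (qtrace ((β_ (V j) (V i)).hom ≫ (β_ (V i) (V j)).hom))
  have hsq : ∀ i j, s i j * counit (R := k) (1 : H) = qchar (V j) (partialTrace (V i)) := by
    intro i j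
    rw [← counit_qtrace_doubleBraiding, hs]
    have : coeT (lin (s i j • 𝟙 (𝟙_ (RepCat k H))) (oneT (k := k) (H := H))) = s i j • (1 : H) :=
      rfl
    rw [this, map_smul, smul_eq_mul]
  choose a ha using fun l => exists_eq_sum_partialTrace hfact hh hV hdom he (hec l)
  have hq : ∀ i, qchar (V i) 1 ≠ 0 := fun i => qchar_one_ne_zero (hV i) hh
  refine ⟨Matrix.of s, hs, ?_⟩
  -- a left inverse, read off from `χ_j(e_l) = δ_{lj} χ_l(1)` and `e_l = ∑ a_{li} (id ⊗ χ_i)(Q)`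
  let b : Matrix (Fin n) (Fin n) k :=
    Matrix.of fun l i => (qchar (V l) 1)⁻¹ * counit (R := k) (1 : H) * a l i
  have hb : b * Matrix.of s = 1 := by
    ext l j
    have h1 : qchar (V j) (e l) = ∑ i, a l i * qchar (V j) (partialTrace (V i)) := by
      conv_lhs => rw [ha l, map_sum]
      simp only [map_smul, smul_eq_mul]
    have h2 : qchar (V j) (e l) = if l = j then qchar (V j) 1 else 0 := by
      rw [qchar_apply, he, qchar_apply, map_one]
      split_ifs <;> simp
    rw [Matrix.mul_apply, Matrix.one_apply]
    have h3 : ∑ i, b l i * Matrix.of s i j = (qchar (V l) 1)⁻¹ * qchar (V j) (e l) := by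
      rw [h1, Finset.mul_sum]
      refine Finset.sum_congr rfl fun i _ => ?_
      rw [← hsq]
      simp only [b, Matrix.of_apply]
      ring
    rw [h3, h2]
    by_cases hlj : l = j
    · subst hlj
      rw [if_pos rfl, if_pos rfl, inv_mul_cancel₀ (hq l)]
    · rw [if_neg hlj, if_neg hlj, mul_zero]
  exact .of_mul_eq_one_right _ hb

end Family

end RepCat
end QG

theorem mainTheorem2 {k H : Type u} [Field k] [IsAlgClosed k] [Ring H] [Algebra k H]
    [QG.RibbonQuantumGroupoid k H] (hconn : QG.IsConnected k H) (hfact : QG.IsFactorizable k H)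
    (hHaar : ∃ h : H, QG.IsHaarIntegral k h) :
    QG.IsModularCategory k (QG.RepCat k H) := by
  obtain ⟨h, hh⟩ := hHaar
  have := QG.QuantumGroupoid.finiteDimensional (k := k) (H := H)
  have := QG.isSemisimpleRing_of_isHaarIntegral k hh
  obtain ⟨n, V, e, hV, hunit, hdom, hec, he⟩ :=
    QG.RepCat.exists_simple_family (k := k) (H := H) hconn
  exact ⟨Fin n, inferInstance, inferInstance, V, hV, hunit,
    fun i => (QG.RepCat.isSimpleObj_dual (hV i)).exists_iso_of_dominates hV (hdom _),
    hdom, QG.RepCat.exists_sMatrix hconn hfact hh hV hdom hec he⟩
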